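/- **Theorem (linear instability criterion for the gfKdV equation).** Let $0\le\gamma\le\alpha<1$, $\alpha>0$, $a_1,a_2>0$ and $b,b_0\in\mathbb R$. Let $\beta:\mathbb R\to\mathbb R$ be continuous and even, with $\beta(\xi)>b$ for all $\xi$ and $$a_1|\xi|^\gamma\le\beta(\xi)\le a_2(1+|\xi|)^\alpha\quad\text{for }|\xi|\ge b_0,$$ and suppose that $\eta(\xi)=\beta(\xi)-|\xi|^\alpha$ is locally absolutely continuous with $\eta'\in L^2(\mathbb R)$. Let $\mathcal M$ be the Fourier multiplier $\widehat{\mathcal Mg}(\xi)=\beta(\xi)\widehat g(\xi)$, where $\widehat g(\xi)=\int g(x)e^{-ix\xi}\,dx$, let $f\in C^\infty(\mathbb R;\mathbb R)$, and consider $u_t+(f(u))_x-(\mathcal Mu)_x=0$. Let $I\subset(0,\infty)$ be a nondegenerate interval and let $c\in I\mapsto\psi_c\in H^{\alpha+1}(\mathbb R)$ be a $C^1$ (in particular, any smooth) curve of positive real-valued solutions of $\mathcal M\psi_c+c\psi_c-f(\psi_c)=0$. Fix $c\in I$ such that $c+b-f'(0)>0$. Let $\mathcal N_c=\mathcal M+c-f'(\psi_c)$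 on its natural domain in $L^2(\mathbb R;\mathbb C)$, and assume that this domain is $H^\alpha(\mathbb R)$ (so that $\mathcal N_c$ is self-adjoint with domain $H^\alpha(\mathbb R)$) and that $\ker\mathcal N_c$ is spanned by $\frac{d}{dx}\psi_c$. Let $n(\mathcal N_c)$ be the number, counted with multiplicity, of negative eigenvalues of $\mathcal N_c$. Assume that one of the following two conditions holds: (i) $n(\mathcal N_c)$ is even and $\frac{d}{dc}\langle\psi_c,\psi_c\rangle>0$; (ii) $n(\mathcal N_c)$ is odd and $\frac{d}{dc}\langle\psi_c,\psi_c\rangle<0$. (The derivative is one-sided if $c$ is an endpoint of $I$.) Then there are $\lambda>0$ and a real-valued $w\neq0$ with $w\in H^s(\mathbb R)$ for every $s\ge0$ such that the purely growing mode $u(x,t)=e^{\lambda t}w(x)$ solves the linearized equation $$(\partial_t-c\,\partial_x)u+\partial_x\big(f'(\psi_c)u-\mathcal Mu\big)=0 .$$ -/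

import Mathlib

open MeasureTheory Set
open scoped FourierTransform SchwartzMap LineDeriv ContDiff

noncomputable section

/-- `L²(ℝ; ℂ)`, the Hilbert space on which the linear operators act. -/
abbrev L2C : Type := Lp ℂ 2 (volume : Measure ℝ)

/-- `L²(ℝ; ℝ)`, the space of real-valued profiles. -/
abbrev L2R : Type := Lp ℝ 2 (volume : Measure ℝ)

/-- The inclusion `L²(ℝ; ℝ) → L²(ℝ; ℂ)`. -/
def complexify (u : L2R) : L2C := Complex.ofRealCLM.compLpL 2 volume u

/-- The Sobolev space `H^s(ℝ)` inside `L²(ℝ; ℂ)` (for `s ≥ 0` this is all of `H^s(ℝ)`). -/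
def InH (s : ℝ) (u : L2C) : Prop :=
  TemperedDistribution.MemSobolev s 2 (u : 𝓢'(ℝ, ℂ))

/-- The operator of multiplication by the real function `m`, on its maximal domain
`{u ∈ L² : m u ∈ L²}`. -/
def mulOp (m : ℝ → ℝ) : L2C →ₗ.[ℂ] L2C where
  domain :=
    { carrier := {u | MemLp (fun x => (m x : ℂ) * u x) 2 volume}
      zero_mem' := by
        refine (memLp_congr_ae ?_).mpr (MemLp.zero (ε := ℂ) (p := 2) (μ := (volume : Measure ℝ)))
        filter_upwards [Lp.coeFn_zero ℂ 2 (volume : Measure ℝ)] with x hx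
        simp
      add_mem' := by
        intro u v hu hv
        refine (memLp_congr_ae ?_).mpr (MemLp.add hu hv)
        filter_upwards [Lp.coeFn_add u v] with x hx
        rw [hx]
        exact mul_add _ _ _
      smul_mem' := by
        intro a u hu
        refine (memLp_congr_ae ?_).mpr (MemLp.const_smul hu a)
        filter_upwards [Lp.coeFn_smul a u] with x hx
        simp only [hx, Pi.smul_apply, smul_eq_mul]
        ring }
  toFun :=
    { toFun := fun u => MemLp.toLp (fun x => (m x : ℂ) * (u : L2C) x) u.2
      map_add' := by
        intro u v
        refine Lp.ext ?_
        refine (MemLp.coeFn_toLp _).trans ?_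
        filter_upwards [Lp.coeFn_add (u : L2C) (v : L2C), MemLp.coeFn_toLp u.2,
          MemLp.coeFn_toLp v.2, Lp.coeFn_add (MemLp.toLp _ u.2) (MemLp.toLp _ v.2)]
          with x h1 h2 h3 h4
        rw [h4, Pi.add_apply, h2, h3, Submodule.coe_add, h1, Pi.add_apply, mul_add]
      map_smul' := by
        intro a u
        refine Lp.ext ?_
        refine (MemLp.coeFn_toLp _).trans ?_
        filter_upwards [Lp.coeFn_smul a (u : L2C), MemLp.coeFn_toLp u.2,
          Lp.coeFn_smul a (MemLp.toLp _ u.2)] with x h1 h2 h3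
        rw [RingHom.id_apply, h3, Pi.smul_apply, h2, Submodule.coe_smul, h1, Pi.smul_apply,
          smul_eq_mul, smul_eq_mul]
        ring }

/-- The Fourier multiplier `M` with real symbol `β`, on its maximal domain
`{u ∈ L² : β û ∈ L²}`. The symbol is taken with respect to the convention
`û(ξ) = ∫ u(x) e^{-i x ξ} dx`, in which `∂ₓ` has symbol `i ξ`; Mathlib's Fourier transform `𝓕` uses
`e^{-2π i x ξ}` instead, so that `M` is multiplication by `β(2πξ)` on its side. -/
def multiplierOp (β : ℝ → ℝ) : L2C →ₗ.[ℂ] L2C where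
  domain := (mulOp fun ξ => β (2 * Real.pi * ξ)).domain.comap
    (Lp.fourierTransformₗᵢ ℝ ℂ).toLinearEquiv.toLinearMap
  toFun := (Lp.fourierTransformₗᵢ ℝ ℂ).symm.toLinearEquiv.toLinearMap ∘ₗ
    (mulOp fun ξ => β (2 * Real.pi * ξ)).toFun ∘ₗ
      (Lp.fourierTransformₗᵢ ℝ ℂ).toLinearEquiv.toLinearMap.submoduleComap
        (mulOp fun ξ => β (2 * Real.pi * ξ)).domain

/-- `ψ` solves the solitary wave equation `M ψ + c ψ - f(ψ) = 0`. -/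
def IsSolitaryWave (β f : ℝ → ℝ) (c : ℝ) (ψ : L2R) : Prop :=
  ∃ h : complexify ψ ∈ (multiplierOp β).domain,
    ∀ᵐ x : ℝ, multiplierOp β ⟨complexify ψ, h⟩ x + (c * ψ x - f (ψ x) : ℝ) = 0

/-- The linearized operator `N_c = M + c - f'(ψ)`, on its natural domain. -/
def linOp (β f : ℝ → ℝ) (c : ℝ) (ψ : L2R) : L2C →ₗ.[ℂ] L2C :=
  multiplierOp β + mulOp (fun x => c - deriv f (ψ x))

/-- The eigenspace `{u ∈ D(T) : T u = μ u}` (the kernel of `T` when `μ = 0`). -/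
def eigenspaceOf (T : L2C →ₗ.[ℂ] L2C) (μ : ℝ) : Submodule ℂ L2C :=
  (LinearMap.ker (T.toFun - (μ : ℂ) • T.domain.subtype)).map T.domain.subtype

/-- `n(T)`: the number of negative eigenvalues of `T`, counted with multiplicity. -/
def negIndex (T : L2C →ₗ.[ℂ] L2C) : ℕ :=
  Module.finrank ℂ (⨆ μ : {μ : ℝ // μ < 0}, eigenspaceOf T μ : Submodule ℂ L2C)

/-- `c ↦ ψ c` is a `C¹` curve on `I` with values in `H^s(ℝ)`: `c ↦ J^s (ψ c)` is `C¹` into `L²`,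
where `J^s` is the Bessel potential, an isomorphism from `H^s` onto `L²`. -/
def IsC1CurveInH (s : ℝ) (I : Set ℝ) (ψ : ℝ → L2R) : Prop :=
  ∃ g : ℝ → L2C, ContDiffOn ℝ 1 g I ∧ ∀ c ∈ I,
    TemperedDistribution.besselPotential ℝ ℂ s (complexify (ψ c) : 𝓢'(ℝ, ℂ)) = (g c : 𝓢'(ℝ, ℂ))

/-- `η` is locally absolutely continuous with `η' ∈ L²(ℝ)`. -/
def HasDerivInL2 (η : ℝ → ℝ) : Prop :=
  ∃ g : ℝ → ℝ, MemLp g 2 volume ∧ ∀ x y : ℝ, η y - η x = ∫ t in x..y, g t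

/-- `u : ℝ → L²` solves the linearized equation
`(∂ₜ - c ∂ₓ) u + ∂ₓ (f'(ψ) u - M u) = 0`: the time derivative is taken in `L²`, and `f'(ψ) u`
and `M u` lie in `L²`; the space derivatives are distributional. -/
def SolvesLinearized (β f : ℝ → ℝ) (c : ℝ) (ψ : L2R) (u : ℝ → L2C) : Prop :=
  ∀ t : ℝ, ∃ u' : L2C, HasDerivAt u u' t ∧
    ∃ (hV : u t ∈ (mulOp fun x => deriv f (ψ x)).domain) (hM : u t ∈ (multiplierOp β).domain),
      (u' : 𝓢'(ℝ, ℂ)) - (c : ℂ) • ∂_{(1 : ℝ)} (u t : 𝓢'(ℝ, ℂ))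
        + ∂_{(1 : ℝ)} (((mulOp fun x => deriv f (ψ x)) ⟨u t, hV⟩
            - multiplierOp β ⟨u t, hM⟩ : L2C) : 𝓢'(ℝ, ℂ)) = 0

end

/-! Write the linearized operator as N = S − q, where S = M + c − f'(0) is a Fourier multiplier
whose symbol s is at least δ = c + b − f'(0) > 0, and q = f'(ψ) − f'(0) is multiplication by a
function vanishing at infinity. A mode e^{λt}w solves the linearized equation exactly when λw =
∂ₓNw. Solving for the constant coefficient part gives w = (∂ₓS − λ)⁻¹ ∂ₓ q w. Put P = S^{-1/2}, w =
Pz and T = PqP; the equation becomes z = B_λ T z, where B_λ is the multiplier ip/(ip − λ) and ip is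
the symbol of ∂ₓS. The function p is real and odd, so B_λ acts on real functions. T is real and
symmetric, and compact because q and 1/s vanish at infinity (`isCompactOperator_bmul_fmul`). It
remains to find λ > 0 for which B_λ T has a nonzero fixed vector.

The B_λ are contractions tending strongly to 0 as λ → ∞ and to 1 as λ → 0⁺, so B_λ T tends in norm
to 0 and to T. A finite determinant replaces the Fredholm determinant of 1 − B_λ T:
`IsCompactOperator.exists_eigenfamily` gives finitely many eigenvectors of T off which ‖T‖ ≤ 1/2,
and with Q the projection off their span, `reducedMatrix` compresses (1 − B_λ T Q)⁻¹(1 − B_λ T) to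
that span. Its determinant is continuous in λ, tends to 1 at ∞, and its zeros produce fixed vectors
(`exists_fixed_of_det_reducedMatrix_eq_zero`).

At λ = 0 the determinant vanishes, because Nψₓ = 0 gives T the eigenvalue 1, which is simple by the
kernel hypothesis. The behaviour near 0 is of second order: differentiating the wave equation in c
gives N∂_cψ = −ψ (`exists_deriv_wave`), and rescaling one row and one column
(`exists_tendsto_scaledMatrix`) shows that λ⁻² det tends to −∏(1 − μᵢ)·⟨ψ, ∂_cψ⟩ up to a positive
factor, the product running over the eigenvalues μᵢ ≠ 1 of the family. The product has the sign of
(−1) to the number of μᵢ > 1. By the Birman–Schwinger principle (`finrank_iSup_eigenspaces_eq_card`)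
that number is n(N), and ⟨ψ, ∂_cψ⟩ is half of d/dc⟨ψ, ψ⟩. So under either condition the determinant
is negative for small λ and positive for large λ, and the intermediate value theorem yields λ
(`exists_fixed_of_sign`).

Smoothness of w follows from w = m(D)(q w) with a symbol m vanishing at infinity: the high
frequencies form a contraction, both in L² and in H^k, and the low frequencies are smooth
(`memH_of_fixed`). -/

open Filter Topology
open scoped ENNReal

/-! ### Eigenvectors from maximizing a Rayleigh quotient. -/

section RayleighQuotient

variable {𝕜 H : Type*} [RCLike 𝕜] [NormedAddCommGroup H] [InnerProductSpace 𝕜 H]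

/-- Cauchy-Schwarz for the form of an operator which is nonnegative on an invariant subspace. -/
theorem norm_sq_le_mul_re_inner_of_nonneg {A : H →L[𝕜] H} (hA : (A : H →ₗ[𝕜] H).IsSymmetric)
    {K : Submodule 𝕜 H} (hK : ∀ x ∈ K, A x ∈ K)
    (h0 : ∀ x ∈ K, 0 ≤ RCLike.re (inner 𝕜 (A x) x)) {C : ℝ} (hC : 0 < C)
    (hle : ∀ x ∈ K, RCLike.re (inner 𝕜 (A x) x) ≤ C * ‖x‖ ^ 2) {x : H} (hx : x ∈ K) :
    ‖A x‖ ^ 2 ≤ C * RCLike.re (inner 𝕜 (A x) x) := by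
  have h1 := h0 (x - (((C⁻¹ : ℝ) : 𝕜)) • A x) (K.sub_mem hx (K.smul_mem _ (hK x hx)))
  have h2 := hle (A x) (hK x hx)
  have h3 : inner 𝕜 (A (A x)) x = inner 𝕜 (A x) (A x) := hA (A x) x
  rw [map_sub, map_smul, inner_sub_left, inner_sub_right, inner_sub_right, inner_smul_left,
    inner_smul_left, inner_smul_right, inner_smul_right, h3] at h1
  simp only [map_sub, RCLike.conj_ofReal, RCLike.re_ofReal_mul, inner_self_eq_norm_sq] at h1
  have h4 : C⁻¹ * (C⁻¹ * RCLike.re (inner 𝕜 (A (A x)) (A x))) ≤ C⁻¹ * ‖A x‖ ^ 2 := by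
    have : C⁻¹ * RCLike.re (inner 𝕜 (A (A x)) (A x)) ≤ ‖A x‖ ^ 2 := by
      rw [inv_mul_le_iff₀ hC]; exact h2
    exact mul_le_mul_of_nonneg_left this (by positivity)
  have h5 : C⁻¹ * ‖A x‖ ^ 2 ≤ RCLike.re (inner 𝕜 (A x) x) := by linarith
  rwa [inv_mul_le_iff₀ hC] at h5

/-- Let `X = Y + Z` be symmetric, `Z` compact, and `Y ≤ a < b`. If the quadratic form of `X` exceeds
`b` somewhere on a closed invariant subspace, then `X` has an eigenvalue above `b` there. -/
theorem exists_eigenvector_gt_of_form_gt [CompleteSpace H] {X Y Z : H →L[𝕜] H}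
    (hX : (X : H →ₗ[𝕜] H).IsSymmetric) (hXYZ : ∀ x, X x = Y x + Z x) (hZ : IsCompactOperator Z)
    {a b : ℝ} (hab : a < b) (hY : ∀ x, RCLike.re (inner 𝕜 (Y x) x) ≤ a * ‖x‖ ^ 2)
    {K : Submodule 𝕜 H} (hKc : IsClosed (K : Set H)) (hK : ∀ x ∈ K, X x ∈ K) {x₀ : H}
    (hx₀ : x₀ ∈ K) (hgt : b * ‖x₀‖ ^ 2 < RCLike.re (inner 𝕜 (X x₀) x₀)) :
    ∃ M : ℝ, b < M ∧ ∃ v ∈ K, v ≠ 0 ∧ X v = (M : 𝕜) • v := by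
  set S : Set ℝ := {r | ∃ x ∈ K, ‖x‖ = 1 ∧ r = RCLike.re (inner 𝕜 (X x) x)} with hS
  have hx0 : x₀ ≠ 0 := by
    rintro rfl
    simp at hgt
  have hn0 : 0 < ‖x₀‖ := norm_pos_iff.mpr hx0
  have scale : ∀ x : H, x ≠ 0 → RCLike.re (inner 𝕜 (X (((‖x‖⁻¹ : ℝ) : 𝕜) • x)) (((‖x‖⁻¹ : ℝ) : 𝕜) • x))
      = (‖x‖ ^ 2)⁻¹ * RCLike.re (inner 𝕜 (X x) x) := by
    intro x hx
    rw [map_smul, inner_smul_left, inner_smul_right, RCLike.conj_ofReal, RCLike.re_ofReal_mul,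
      RCLike.re_ofReal_mul]
    ring
  have unit : ∀ x : H, x ≠ 0 → ‖(((‖x‖⁻¹ : ℝ) : 𝕜) • x)‖ = 1 := by
    intro x hx
    rw [norm_smul, RCLike.norm_ofReal, abs_of_nonneg (by positivity)]
    exact inv_mul_cancel₀ (norm_ne_zero_iff.mpr hx)
  have hmem : (‖x₀‖ ^ 2)⁻¹ * RCLike.re (inner 𝕜 (X x₀) x₀) ∈ S :=
    ⟨_, K.smul_mem _ hx₀, unit x₀ hx0, (scale x₀ hx0).symm⟩
  have hbdd : BddAbove S := by
    refine ⟨‖X‖, ?_⟩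
    rintro r ⟨x, -, hx1, rfl⟩
    calc RCLike.re (inner 𝕜 (X x) x) ≤ ‖X x‖ * ‖x‖ := re_inner_le_norm _ _
      _ ≤ ‖X‖ := by
        rw [hx1, mul_one]
        simpa [hx1] using X.le_opNorm x
  set M := sSup S with hM
  have hbM : b < M := by
    refine lt_of_lt_of_le ?_ (le_csSup hbdd hmem)
    rw [lt_inv_mul_iff₀ (by positivity)]
    linarith
  have hle : ∀ x ∈ K, RCLike.re (inner 𝕜 (X x) x) ≤ M * ‖x‖ ^ 2 := by
    intro x hx
    by_cases h : x = 0
    · simp [h]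
    have := le_csSup hbdd (show (‖x‖ ^ 2)⁻¹ * RCLike.re (inner 𝕜 (X x) x) ∈ S from
      ⟨_, K.smul_mem _ hx, unit x h, (scale x h).symm⟩)
    have hp : 0 < ‖x‖ ^ 2 := by have := norm_pos_iff.mpr h; positivity
    rw [inv_mul_le_iff₀ hp] at this
    linarith
  -- the shifted operator
  set A : H →L[𝕜] H := (M : 𝕜) • ContinuousLinearMap.id 𝕜 H - X with hAdef
  have hAx : ∀ x, A x = (M : 𝕜) • x - X x := fun x => by simp [hAdef]
  have hAsym : (A : H →ₗ[𝕜] H).IsSymmetric := by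
    intro x y
    have := hX x y
    simp only [ContinuousLinearMap.coe_coe] at this ⊢
    rw [hAx, hAx, inner_sub_left, inner_sub_right, this, inner_smul_left, inner_smul_right,
      RCLike.conj_ofReal]
  have hAre : ∀ x, RCLike.re (inner 𝕜 (A x) x) = M * ‖x‖ ^ 2 - RCLike.re (inner 𝕜 (X x) x) := by
    intro x
    rw [hAx, inner_sub_left, map_sub, inner_smul_left, RCLike.conj_ofReal, RCLike.re_ofReal_mul,
      inner_self_eq_norm_sq]
  have hAK : ∀ x ∈ K, A x ∈ K := fun x hx => by
    rw [hAx]; exact K.sub_mem (K.smul_mem _ hx) (hK x hx)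
  have hA0 : ∀ x ∈ K, 0 ≤ RCLike.re (inner 𝕜 (A x) x) := fun x hx => by
    rw [hAre]; linarith [hle x hx]
  set C := ‖A‖ + 1 with hC
  have hCpos : 0 < C := by positivity
  have hAC : ∀ x ∈ K, RCLike.re (inner 𝕜 (A x) x) ≤ C * ‖x‖ ^ 2 := by
    intro x _
    calc RCLike.re (inner 𝕜 (A x) x) ≤ ‖A x‖ * ‖x‖ := re_inner_le_norm _ _
      _ ≤ (‖A‖ * ‖x‖) * ‖x‖ := by gcongr; exact A.le_opNorm x
      _ ≤ C * ‖x‖ ^ 2 := by nlinarith [sq_nonneg ‖x‖]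
  have hseq : ∀ n : ℕ, ∃ x ∈ K, ‖x‖ = 1 ∧ M - 1 / ((n : ℝ) + 1) < RCLike.re (inner 𝕜 (X x) x) := by
    intro n
    obtain ⟨r, ⟨x, hxK, hx1, rfl⟩, hr⟩ := exists_lt_of_lt_csSup ⟨_, hmem⟩
      (show M - 1 / ((n : ℝ) + 1) < sSup S by
        have : 0 < 1 / ((n : ℝ) + 1) := by positivity
        linarith)
    exact ⟨x, hxK, hx1, hr⟩
  choose x hxK hx1 hxM using hseq
  -- A maximizing sequence is an approximate eigenvector sequence: M − X is nonnegative on K, so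
  -- Cauchy–Schwarz for its form bounds ‖(M − X)xₙ‖ by the defect of the quotient.
  have hAlim : Tendsto (fun n => A (x n)) atTop (𝓝 0) := by
    rw [tendsto_zero_iff_norm_tendsto_zero]
    have h1 : Tendsto (fun n : ℕ => C * (1 / ((n : ℝ) + 1))) atTop (𝓝 0) := by
      simpa using (tendsto_one_div_add_atTop_nhds_zero_nat (𝕜 := ℝ)).const_mul C
    have h2 : Tendsto (fun n => ‖A (x n)‖ ^ 2) atTop (𝓝 0) := by
      refine squeeze_zero (fun n => by positivity) (fun n => ?_) h1
      refine (norm_sq_le_mul_re_inner_of_nonneg hAsym hAK hA0 hCpos hAC (hxK n)).trans ?_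
      refine mul_le_mul_of_nonneg_left ?_ hCpos.le
      rw [hAre, hx1]
      linarith [hxM n]
    have h3 := h2.sqrt
    simpa [Real.sqrt_sq] using h3
  obtain ⟨Kc, hKc', hsub⟩ := hZ.image_closedBall_subset_compact 1
  obtain ⟨z, -, σ, hσ, hz⟩ := hKc'.tendsto_subseq (x := fun n => Z (x n))
    (fun n => hsub ⟨x n, by simp [hx1], rfl⟩)
  -- `D = M - Y` is bounded below
  have hD : Tendsto (fun n => (M : 𝕜) • x (σ n) - Y (x (σ n))) atTop (𝓝 z) := by
    have := (hAlim.comp hσ.tendsto_atTop).add hz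
    simp only [zero_add] at this
    refine this.congr fun n => ?_
    simp only [Function.comp_apply, hAx, hXYZ]
    abel
  -- Since M exceeds the upper bound a of the form of Y, M − Y is bounded below; convergence of (M −
  -- Y)x along the subsequence therefore forces x itself to converge.
  have hlow : ∀ y : H, (M - a) * ‖y‖ ≤ ‖(M : 𝕜) • y - Y y‖ := by
    intro y
    by_cases hy : y = 0
    · simp [hy]
    have hyp : 0 < ‖y‖ := norm_pos_iff.mpr hy
    have h1 : (M - a) * ‖y‖ ^ 2 ≤ RCLike.re (inner 𝕜 ((M : 𝕜) • y - Y y) y) := by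
      rw [inner_sub_left, map_sub, inner_smul_left, RCLike.conj_ofReal, RCLike.re_ofReal_mul,
        inner_self_eq_norm_sq]
      linarith [hY y]
    have h2 : RCLike.re (inner 𝕜 ((M : 𝕜) • y - Y y) y) ≤ ‖(M : 𝕜) • y - Y y‖ * ‖y‖ :=
      re_inner_le_norm _ _
    refine le_of_mul_le_mul_right ?_ hyp
    nlinarith
  have hMa : 0 < M - a := by linarith
  have hcau : CauchySeq fun n => x (σ n) := by
    have h1 := hD.cauchySeq
    rw [Metric.cauchySeq_iff'] at h1 ⊢
    intro ε hε
    obtain ⟨N, hN⟩ := h1 ((M - a) * ε) (by positivity)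
    refine ⟨N, fun n hn => ?_⟩
    have h2 := hN n hn
    rw [dist_eq_norm] at h2 ⊢
    have h3 := hlow (x (σ n) - x (σ N))
    have h4 : (M : 𝕜) • (x (σ n) - x (σ N)) - Y (x (σ n) - x (σ N))
        = ((M : 𝕜) • x (σ n) - Y (x (σ n))) - ((M : 𝕜) • x (σ N) - Y (x (σ N))) := by
      rw [smul_sub, map_sub]; abel
    rw [h4] at h3
    exact lt_of_mul_lt_mul_left (h3.trans_lt h2) hMa.le
  obtain ⟨v, hv⟩ := cauchySeq_tendsto_of_complete hcau
  have hv1 : ‖v‖ = 1 := by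
    have := hv.norm
    simp only [hx1] at this
    exact (tendsto_nhds_unique this tendsto_const_nhds)
  refine ⟨M, hbM, v, hKc.mem_of_tendsto hv (Eventually.of_forall fun n => hxK _), ?_, ?_⟩
  · rintro rfl
    simp at hv1
  · have h1 : Tendsto (fun n => A (x (σ n))) atTop (𝓝 (A v)) := (A.continuous.tendsto v).comp hv
    have h2 := tendsto_nhds_unique h1 (hAlim.comp hσ.tendsto_atTop)
    rw [hAx, sub_eq_zero] at h2
    exact h2.symm

end RayleighQuotient

/-! ### Finitely many eigenvectors carrying the large part of a compact symmetric operator. -/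

section CompactSymmetric

variable {H : Type*} [NormedAddCommGroup H] [InnerProductSpace ℝ H]

/-- An orthonormal family of eigenvectors. -/
structure IsEigenfamily {ι : Type*} (T : H →L[ℝ] H) (v : ι → H) (μ : ι → ℝ) : Prop where
  orthonormal : Orthonormal ℝ v
  apply_eq : ∀ i, T (v i) = μ i • v i

/-- The images μᵢvᵢ are orthogonal of length above 1/2, hence more than 1/2 apart, while the image
of the unit ball is covered by finitely many balls of radius 1/4, each of which holds at most one of
them. -/
theorem IsCompactOperator.exists_bound_eigenfamily {T : H →L[ℝ] H} (hT : IsCompactOperator T) :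
    ∃ N : ℕ, ∀ (m : ℕ) (v : Fin m → H) (μ : Fin m → ℝ), IsEigenfamily T v μ →
      (∀ i, 1 / 2 < |μ i|) → m ≤ N := by
  by_contra! hcon
  obtain ⟨Kc, hKc, hsub⟩ := hT.image_closedBall_subset_compact 1
  obtain ⟨t, htf, hcov⟩ := Metric.totallyBounded_iff.mp hKc.totallyBounded (1 / 4) (by norm_num)
  obtain ⟨m, v, μ, hv, hμ, hm⟩ := hcon htf.toFinset.card
  have hex : ∀ i : Fin m, ∃ y ∈ htf.toFinset, T (v i) ∈ Metric.ball y (1 / 4) := by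
    intro i
    have : T (v i) ∈ Kc := hsub ⟨v i, by simp [hv.orthonormal.1 i], rfl⟩
    obtain ⟨y, hy, hy'⟩ := Set.mem_iUnion₂.mp (hcov this)
    exact ⟨y, by simpa using hy, hy'⟩
  choose f hf hf' using hex
  obtain ⟨i, -, j, -, hij, hfij⟩ := Finset.exists_ne_map_eq_of_card_lt_of_maps_to
    (s := (Finset.univ : Finset (Fin m))) (by simpa using hm) (fun i _ => hf i)
  have h1 : ‖T (v i) - T (v j)‖ < 1 / 2 := by
    rw [← dist_eq_norm]
    calc dist (T (v i)) (T (v j)) ≤ dist (T (v i)) (f i) + dist (T (v j)) (f i) :=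
          dist_triangle_right _ _ _
      _ < 1 / 4 + 1 / 4 := by
        have a1 := hf' i
        have a2 := hf' j
        rw [← hfij] at a2
        exact add_lt_add (Metric.mem_ball.mp a1) (Metric.mem_ball.mp a2)
      _ = 1 / 2 := by norm_num
  have h2 : ‖T (v i) - T (v j)‖ ^ 2 = μ i ^ 2 + μ j ^ 2 := by
    rw [hv.apply_eq, hv.apply_eq, norm_sub_sq_real, norm_smul, norm_smul, hv.orthonormal.1,
      hv.orthonormal.1, inner_smul_left, inner_smul_right, hv.orthonormal.2 hij]
    simp
  have h3 : 1 / 4 < μ i ^ 2 := by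
    rw [← sq_abs]; nlinarith [hμ i]
  nlinarith [norm_nonneg (T (v i) - T (v j)), sq_nonneg (μ j)]

/-- Take a family of largest size among those with |μ| > 1/2. If T stretched some vector of the
orthogonal complement by more than 1/2, the complement would contain a further eigenvector of this
kind. -/
theorem IsCompactOperator.exists_eigenfamily [CompleteSpace H] {T : H →L[ℝ] H}
    (hT : IsCompactOperator T) (hTs : (T : H →ₗ[ℝ] H).IsSymmetric) :
    ∃ (m : ℕ) (v : Fin m → H) (μ : Fin m → ℝ), IsEigenfamily T v μ ∧
      ∀ x, (∀ i, inner ℝ (v i) x = 0) → ‖T x‖ ≤ 1 / 2 * ‖x‖ := by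
  obtain ⟨N, hN⟩ := hT.exists_bound_eigenfamily
  set Pm : ℕ → Prop := fun m => ∃ (v : Fin m → H) (μ : Fin m → ℝ), IsEigenfamily T v μ ∧
      ∀ i, 1 / 2 < |μ i| with hPm
  have h0 : Pm 0 := ⟨fun i => i.elim0, fun i => i.elim0,
    ⟨⟨fun i => i.elim0, fun i => i.elim0⟩, fun i => i.elim0⟩, fun i => i.elim0⟩
  obtain ⟨m, hm, hm'⟩ : ∃ m, Pm m ∧ ¬ Pm (m + 1) := by
    by_contra! hcon
    have hall : ∀ m, Pm m := fun m => Nat.rec h0 hcon m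
    obtain ⟨v, μ, h1, h2⟩ := hall (N + 1)
    have := hN _ v μ h1 h2
    omega
  obtain ⟨v, μ, hv, hμ⟩ := hm
  refine ⟨m, v, μ, hv, fun x hx => ?_⟩
  by_contra! hlt
  apply hm'
  set K : Submodule ℝ H := (Submodule.span ℝ (Set.range v))ᗮ with hK
  have hmemK : ∀ y, y ∈ K ↔ ∀ i, inner ℝ (v i) y = 0 := by
    intro y
    rw [hK, Submodule.mem_orthogonal]
    constructor
    · intro h i
      exact h _ (Submodule.subset_span ⟨i, rfl⟩)
    · intro h u hu
      induction hu using Submodule.span_induction with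
      | mem u hu => obtain ⟨i, rfl⟩ := hu; exact h i
      | zero => simp
      | add a b _ _ ha hb => rw [inner_add_left, ha, hb, add_zero]
      | smul c a _ ha => rw [inner_smul_left, ha, mul_zero]
  have hTsym : ∀ a b, inner ℝ (T a) b = inner ℝ a (T b) := fun a b => hTs a b
  have hTK : ∀ y ∈ K, T y ∈ K := by
    intro y hy
    rw [hmemK] at hy ⊢
    intro i
    rw [← hTsym, hv.apply_eq, inner_smul_left, hy i, mul_zero]
  -- The Rayleigh argument reaches only the top of the spectrum; passing to T² treats large positive
  -- and large negative eigenvalues at once.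
  set X : H →L[ℝ] H := T.comp T with hX
  have hXs : (X : H →ₗ[ℝ] H).IsSymmetric := by
    intro a b
    change inner ℝ (T (T a)) b = inner ℝ a (T (T b))
    rw [hTsym, hTsym]
  obtain ⟨M, hM, w, hwK, hw0, hw⟩ := exists_eigenvector_gt_of_form_gt (𝕜 := ℝ) (X := X) (Y := 0)
    (Z := X) hXs (by simp) (hT.clm_comp T) (a := 0) (b := 1 / 4) (by norm_num) (by simp)
    (Submodule.isClosed_orthogonal _) (fun y hy => hTK _ (hTK _ hy)) ((hmemK x).mpr hx) (by
      change 1 / 4 * ‖x‖ ^ 2 < inner ℝ (T (T x)) x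
      rw [hTsym, real_inner_self_eq_norm_sq]
      have := mul_self_lt_mul_self (by positivity) hlt
      nlinarith)
  have hw' : T (T w) = M • w := hw
  set r := Real.sqrt M with hr
  have hr2 : r * r = M := Real.mul_self_sqrt (by linarith)
  have hr1 : 1 / 2 < r := by
    rw [hr, Real.lt_sqrt (by norm_num)]; linarith
  -- From (T − r)(T + r)w = 0: either (T + r)w is an eigenvector for r, or it vanishes and w is one
  -- for −r.
  obtain ⟨u, ν, huK, hu0, hTu, hν⟩ : ∃ (u : H) (ν : ℝ), u ∈ K ∧ u ≠ 0 ∧ T u = ν • u ∧ 1 / 2 < |ν| := by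
    by_cases h : T w + r • w = 0
    · refine ⟨w, -r, hwK, hw0, ?_, ?_⟩
      · rw [neg_smul]; exact eq_neg_of_add_eq_zero_left h
      · rw [abs_neg]; exact hr1.trans_le (le_abs_self _)
    · refine ⟨_, r, K.add_mem (hTK _ hwK) (K.smul_mem r hwK), h, ?_, hr1.trans_le (le_abs_self _)⟩
      rw [map_add, map_smul, hw', ← hr2, smul_add, smul_smul, add_comm]
  set u' : H := ‖u‖⁻¹ • u with hu'
  have hu1 : ‖u'‖ = 1 := norm_smul_inv_norm (𝕜 := ℝ) hu0
  have hu'K : ∀ i, inner ℝ (v i) u' = 0 := by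
    rw [← hmemK]; exact K.smul_mem _ huK
  refine ⟨Fin.cons u' v, Fin.cons ν μ, ⟨⟨?_, ?_⟩, ?_⟩, ?_⟩
  · intro i
    refine Fin.cases ?_ ?_ i
    · simpa using hu1
    · intro j; simpa using hv.orthonormal.1 j
  · intro i j
    refine Fin.cases ?_ (fun i => ?_) i
    · refine Fin.cases (fun h => absurd rfl h) (fun j _ => ?_) j
      simpa [real_inner_comm] using hu'K j
    · refine Fin.cases (fun _ => ?_) (fun j hij => ?_) j
      · simpa using hu'K i
      · simp only [Fin.cons_succ]
        exact hv.orthonormal.2 (fun h => hij (by rw [h]))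
  · intro i
    refine Fin.cases ?_ (fun i => ?_) i
    · simp only [Fin.cons_zero, hu', map_smul, hTu]
      rw [smul_comm]
    · simpa using hv.apply_eq i
  · intro i
    refine Fin.cases ?_ (fun i => ?_) i
    · simpa using hν
    · simpa using hμ i

end CompactSymmetric

/-! ### From strong to norm convergence. -/

section StrongConvergence

variable {𝕜 H : Type*} [RCLike 𝕜] [NormedAddCommGroup H] [NormedSpace 𝕜 H]

/-- Bounded strong convergence becomes norm convergence after composition with a compact operator. -/
theorem IsCompactOperator.tendsto_comp_of_strong {ι : Type*} {l : Filter ι}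
    {B : ι → H →L[𝕜] H} {B₀ : H →L[𝕜] H} {C : ℝ} (hB : ∀ᶠ i in l, ‖B i‖ ≤ C)
    (hlim : ∀ x, Tendsto (fun i => B i x) l (𝓝 (B₀ x))) {T : H →L[𝕜] H}
    (hT : IsCompactOperator T) :
    Tendsto (fun i => (B i).comp T) l (𝓝 (B₀.comp T)) := by
  rw [Metric.tendsto_nhds]
  intro ε hε
  set D := max C 0 + ‖B₀‖ + 1 with hD
  have hDpos : 0 < D := by positivity
  obtain ⟨Kc, hKc, hsub⟩ := hT.image_closedBall_subset_compact 1
  obtain ⟨t, htf, hcov⟩ := Metric.totallyBounded_iff.mp hKc.totallyBounded (ε / (4 * D)) (by positivity)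
  have hfin : ∀ᶠ i in l, ∀ y ∈ t, ‖B i y - B₀ y‖ < ε / 4 := by
    rw [eventually_all_finite htf]
    intro y _
    have := Metric.tendsto_nhds.mp (hlim y) (ε / 4) (by positivity)
    simpa [dist_eq_norm] using this
  filter_upwards [hB, hfin] with i hi hif
  rw [dist_eq_norm]
  have : ‖(B i).comp T - B₀.comp T‖ ≤ ε / 2 := by
    refine ContinuousLinearMap.opNorm_le_of_unit_norm (by positivity) fun x hx => ?_
    obtain ⟨y, hy, hy'⟩ := Set.mem_iUnion₂.mp (hcov (hsub ⟨x, by simp [hx], rfl⟩))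
    rw [Metric.mem_ball, dist_eq_norm] at hy'
    have e1 : ((B i).comp T - B₀.comp T) x
        = B i (T x - y) + (B i y - B₀ y) - B₀ (T x - y) := by
      simp only [sub_apply, ContinuousLinearMap.comp_apply, map_sub]
      abel
    rw [e1]
    have h1 : ‖B i (T x - y)‖ + ‖B₀ (T x - y)‖ ≤ D * (ε / (4 * D)) := by
      calc ‖B i (T x - y)‖ + ‖B₀ (T x - y)‖ ≤ ‖B i‖ * ‖T x - y‖ + ‖B₀‖ * ‖T x - y‖ :=
            add_le_add (ContinuousLinearMap.le_opNorm _ _) (ContinuousLinearMap.le_opNorm _ _)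
        _ = (‖B i‖ + ‖B₀‖) * ‖T x - y‖ := by ring
        _ ≤ D * (ε / (4 * D)) := by
          refine mul_le_mul ?_ hy'.le (norm_nonneg _) hDpos.le
          rw [hD]; linarith [le_max_left C 0]
    have h2 : D * (ε / (4 * D)) = ε / 4 := by field_simp
    have h3 := norm_sub_le (B i (T x - y) + (B i y - B₀ y)) (B₀ (T x - y))
    have h4 := norm_add_le (B i (T x - y)) (B i y - B₀ y)
    linarith [hif y hy]
  linarith

end StrongConvergence

/-! ### A finite determinant standing in for det(1 − K). -/

section ReducedDeterminant

variable {H : Type*} [NormedAddCommGroup H] [InnerProductSpace ℝ H] [CompleteSpace H] {m : ℕ}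

/-- The orthogonal projection onto the complement of a finite family. -/
noncomputable def complProj (v : Fin m → H) : H →L[ℝ] H :=
  Submodule.starProjection (Submodule.orthogonal (Submodule.span ℝ (Set.range v)))

omit [CompleteSpace H] in
theorem mem_orthogonal_span_range_iff (v : Fin m → H) (y : H) :
    y ∈ (Submodule.span ℝ (Set.range v))ᗮ ↔ ∀ i, inner ℝ (v i) y = 0 := by
  rw [Submodule.mem_orthogonal]
  constructor
  · intro h i
    exact h _ (Submodule.subset_span ⟨i, rfl⟩)
  · intro h u hu
    induction hu using Submodule.span_induction with
    | mem u hu => obtain ⟨i, rfl⟩ := hu; exact h i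
    | zero => simp
    | add a b _ _ ha hb => rw [inner_add_left, ha, hb, add_zero]
    | smul c a _ ha => rw [inner_smul_left, ha, mul_zero]

theorem inner_complProj (v : Fin m → H) (i : Fin m) (x : H) : inner ℝ (v i) (complProj v x) = 0 :=
  (mem_orthogonal_span_range_iff v _).mp (Submodule.starProjection_apply_mem _ x) i

theorem complProj_eq_self (v : Fin m → H) {x : H} (hx : ∀ i, inner ℝ (v i) x = 0) :
    complProj v x = x :=
  Submodule.starProjection_eq_self_iff.mpr ((mem_orthogonal_span_range_iff v x).mpr hx)

theorem complProj_apply_family (v : Fin m → H) (i : Fin m) : complProj v (v i) = 0 := by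
  rw [complProj, Submodule.starProjection_apply_eq_zero_iff]
  exact Submodule.le_orthogonal_orthogonal _ (Submodule.subset_span ⟨i, rfl⟩)

theorem norm_complProj_le (v : Fin m → H) (x : H) : ‖complProj v x‖ ≤ ‖x‖ :=
  ((complProj v).le_opNorm x).trans
    (mul_le_of_le_one_left (norm_nonneg _) (Submodule.starProjection_norm_le _))

theorem sub_complProj_eq_sum {v : Fin m → H} (hv : Orthonormal ℝ v) (x : H) :
    x - complProj v x = ∑ i, inner ℝ (v i) x • v i := by
  have h : complProj v (x - ∑ i, inner ℝ (v i) x • v i) = x - ∑ i, inner ℝ (v i) x • v i := by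
    apply complProj_eq_self
    intro i
    rw [inner_sub_right, hv.inner_right_fintype, sub_self]
  rw [map_sub, map_sum] at h
  simp only [map_smul, complProj_apply_family, smul_zero, Finset.sum_const_zero, sub_zero] at h
  rw [h]; abel

/-- The matrix of `(1 - K Q)⁻¹ (1 - K)` compressed to the span of `v`, `Q` being the projection onto
the orthogonal complement. -/
noncomputable def reducedMatrix (v : Fin m → H) (K : H →L[ℝ] H) : Matrix (Fin m) (Fin m) ℝ :=
  fun i j => inner ℝ (v i) (Ring.inverse (1 - K * complProj v) ((1 - K) (v j)))

omit [CompleteSpace H] in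
theorem tendsto_clm_apply {ι : Type*} {l : Filter ι} {A : ι → H →L[ℝ] H} {A₀ : H →L[ℝ] H}
    {x : ι → H} {x₀ : H} (hA : Tendsto A l (𝓝 A₀)) (hx : Tendsto x l (𝓝 x₀)) :
    Tendsto (fun i => A i (x i)) l (𝓝 (A₀ x₀)) :=
  (isBoundedBilinearMap_apply.continuous.tendsto (A₀, x₀)).comp (hA.prodMk_nhds hx)

theorem tendsto_ringInverse {ι : Type*} {l : Filter ι} {A : ι → H →L[ℝ] H}
    {A₀ : H →L[ℝ] H} (hA : Tendsto A l (𝓝 A₀)) (hu : IsUnit A₀) :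
    Tendsto (fun i => Ring.inverse (A i)) l (𝓝 (Ring.inverse A₀)) := by
  obtain ⟨u, rfl⟩ := hu
  exact (NormedRing.inverse_continuousAt u).tendsto.comp hA

theorem tendsto_reducedMatrix {ι : Type*} {l : Filter ι} (v : Fin m → H)
    {K : ι → H →L[ℝ] H} {K₀ : H →L[ℝ] H} (hK : Tendsto K l (𝓝 K₀))
    (hu : IsUnit (1 - K₀ * complProj v)) :
    Tendsto (fun i => reducedMatrix v (K i)) l (𝓝 (reducedMatrix v K₀)) := by
  refine tendsto_pi_nhds.mpr fun i => tendsto_pi_nhds.mpr fun j => ?_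
  have h1 := tendsto_ringInverse ((tendsto_const_nhds (x := (1 : H →L[ℝ] H))).sub
    (hK.mul_const (complProj v))) hu
  have h2 := ((tendsto_const_nhds (x := (1 : H →L[ℝ] H))).sub hK)
  have h3 := tendsto_clm_apply h2 (tendsto_const_nhds (x := v j))
  exact tendsto_const_nhds.inner (tendsto_clm_apply h1 h3)

theorem reducedMatrix_zero {v : Fin m → H} (hv : Orthonormal ℝ v) : reducedMatrix v 0 = 1 := by
  ext i j
  have : Ring.inverse (1 : H →L[ℝ] H) = 1 := Ring.inverse_one _
  simp [reducedMatrix, this, Matrix.one_apply, orthonormal_iff_ite.mp hv]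

/-- A null vector of the matrix is an x in the span for which y = (1 − KQ)⁻¹(1 − K)x is orthogonal
to the span. Then Qy = y, so (1 − K)y = (1 − K)x and x − y is fixed by K; it is not 0 because its
coordinates are the null vector. -/
theorem exists_fixed_of_det_reducedMatrix_eq_zero {v : Fin m → H} (hv : Orthonormal ℝ v)
    {K : H →L[ℝ] H} (hu : IsUnit (1 - K * complProj v)) (hdet : (reducedMatrix v K).det = 0) :
    ∃ z ≠ 0, K z = z := by
  obtain ⟨c, hc0, hc⟩ := Matrix.exists_mulVec_eq_zero_iff.mpr hdet
  set x : H := ∑ j, c j • v j with hx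
  set y : H := Ring.inverse (1 - K * complProj v) ((1 - K) x) with hy
  have hyv : ∀ i, inner ℝ (v i) y = 0 := by
    intro i
    have h1 := congrFun hc i
    simp only [Matrix.mulVec, dotProduct, reducedMatrix, Pi.zero_apply] at h1
    rw [hy, hx]
    simp only [map_sum, map_smul, inner_sum, inner_smul_right]
    rw [← h1]
    exact Finset.sum_congr rfl fun j _ => mul_comm _ _
  have h2 : (1 - K * complProj v) y = (1 - K) x := by
    rw [hy, ← mul_apply_eq_comp, Ring.mul_inverse_cancel _ hu, one_apply_eq_self]
  have h3 : y - K y = x - K x := by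
    have := h2
    simp only [sub_apply, one_apply_eq_self, mul_apply_eq_comp] at this
    rwa [complProj_eq_self v hyv] at this
  refine ⟨x - y, ?_, ?_⟩
  · intro h0
    apply hc0
    ext i
    have h4 : inner ℝ (v i) x = c i := by rw [hx, hv.inner_right_fintype]
    rw [sub_eq_zero] at h0
    rw [h0, hyv] at h4
    exact h4.symm
  · rw [map_sub, ← sub_eq_zero]
    have : K x - K y - (x - y) = (y - K y) - (x - K x) := by abel
    rw [this, h3, sub_self]

/-- On the range of Q the operators 1 − K and 1 − KQ agree, so (1 − KQ)⁻¹(1 − K) is the identity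
there. It is thus block triangular, and the part of z off the span does not contribute to the
coordinates. -/
theorem inner_inverse_apply_eq_sum {v : Fin m → H} (hv : Orthonormal ℝ v) {K : H →L[ℝ] H}
    (hu : IsUnit (1 - K * complProj v)) (i : Fin m) (z : H) :
    inner ℝ (v i) (Ring.inverse (1 - K * complProj v) ((1 - K) z))
      = ∑ k, reducedMatrix v K i k * inner ℝ (v k) z := by
  have h1 : (1 - K) (complProj v z) = (1 - K * complProj v) (complProj v z) := by
    simp only [sub_apply, one_apply_eq_self, mul_apply_eq_comp]
    rw [complProj_eq_self v (x := complProj v z) fun i => inner_complProj v i z]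
  have h2 : Ring.inverse (1 - K * complProj v) ((1 - K) (complProj v z)) = complProj v z := by
    rw [h1, ← mul_apply_eq_comp, Ring.inverse_mul_cancel _ hu, one_apply_eq_self]
  have h3 : z = complProj v z + ∑ k, inner ℝ (v k) z • v k := by
    rw [← sub_complProj_eq_sum hv]; abel
  conv_lhs => rw [h3]
  simp only [map_add, map_sum, map_smul]
  rw [h2, inner_add_right, inner_complProj, zero_add, inner_sum]
  refine Finset.sum_congr rfl fun k _ => ?_
  rw [inner_smul_right, mul_comm]
  rfl

/-- The reduced matrix, with the row of `i₀` scaled by `l⁻¹` and the column of `i₀` replaced by the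
one belonging to `l⁻¹ (v i₀) - φ`. -/
noncomputable def scaledMatrix (v : Fin m → H) (K : H →L[ℝ] H) (i₀ : Fin m) (φ : H) (l : ℝ) :
    Matrix (Fin m) (Fin m) ℝ :=
  fun i j => (if i = i₀ then l⁻¹ else 1) *
    inner ℝ (v i) (Ring.inverse (1 - K * complProj v)
      ((1 - K) (if j = i₀ then l⁻¹ • v i₀ - φ else v j)))

/-- The scaling factors as a diagonal matrix on the left and, on the right, an identity matrix with
one column replaced by coordinates; by block triangularity only the coordinates of l⁻¹v − φ in the
span enter. -/
theorem det_scaledMatrix {v : Fin m → H} (hv : Orthonormal ℝ v) {K : H →L[ℝ] H}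
    (hu : IsUnit (1 - K * complProj v)) (i₀ : Fin m) (φ : H) (l : ℝ) :
    (scaledMatrix v K i₀ φ l).det
      = l⁻¹ * (reducedMatrix v K).det * (l⁻¹ - inner ℝ (v i₀) φ) := by
  have h1 : scaledMatrix v K i₀ φ l
      = Matrix.diagonal (fun i => if i = i₀ then l⁻¹ else 1) * (reducedMatrix v K *
        (1 : Matrix (Fin m) (Fin m) ℝ).updateCol i₀ (fun k => inner ℝ (v k) (l⁻¹ • v i₀ - φ))) := by
    ext i j
    rw [Matrix.diagonal_mul, scaledMatrix, inner_inverse_apply_eq_sum hv hu, Matrix.mul_apply]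
    congr 1
    refine Finset.sum_congr rfl fun k _ => ?_
    congr 1
    by_cases hj : j = i₀
    · subst hj; simp
    · simp [hj, Matrix.one_apply, orthonormal_iff_ite.mp hv]
  rw [h1, Matrix.det_mul, Matrix.det_mul, Matrix.det_diagonal, ← Matrix.cramer_apply,
    Matrix.cramer_one]
  simp only [Finset.prod_ite_eq', Finset.mem_univ, if_true, Module.End.one_apply]
  rw [inner_sub_right, inner_smul_right, real_inner_self_eq_norm_sq, hv.1]
  ring

end ReducedDeterminant

/-! ### Sign of the determinant near zero and existence of a fixed vector. -/

section GrowingMode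

variable {H : Type*} [NormedAddCommGroup H] [InnerProductSpace ℝ H] [CompleteSpace H] {m : ℕ}

/-- A factor 1 − μ is negative exactly when μ > 1, so the power of −1 turns the product into the
product of absolute values. -/
theorem zero_lt_neg_one_pow_mul_prod_one_sub {μ : Fin m → ℝ} {i₀ : Fin m} (hμ₀ : μ i₀ = 1)
    (hμ : ∀ i, i ≠ i₀ → μ i ≠ 1) :
    0 < (-1 : ℝ) ^ (Finset.univ.filter fun i => 1 < μ i).card *
      ∏ i, (if i = i₀ then 1 else 1 - μ i) := by
  have h1 : ∏ i, (if i = i₀ then (1 : ℝ) else 1 - μ i)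
      = (-1 : ℝ) ^ (Finset.univ.filter fun i => 1 < μ i).card *
        ∏ i, |if i = i₀ then (1 : ℝ) else 1 - μ i| := by
    have h2 : (-1 : ℝ) ^ (Finset.univ.filter fun i => 1 < μ i).card
        = ∏ i, if 1 < μ i then (-1 : ℝ) else 1 := by
      rw [Finset.prod_ite]; simp
    rw [h2, ← Finset.prod_mul_distrib]
    refine Finset.prod_congr rfl fun i _ => ?_
    by_cases hi : i = i₀
    · subst hi; simp [hμ₀]
    · rcases lt_or_gt_of_ne (hμ i hi) with h | h
      · simp [hi, h.le.not_gt, abs_of_pos (sub_pos.mpr h)]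
      · simp [hi, h, abs_of_neg (sub_neg.mpr h)]
  rw [h1, ← mul_assoc, ← mul_pow]
  simp only [mul_neg, mul_one, neg_neg, one_pow, one_mul]
  refine Finset.prod_pos fun i _ => abs_pos.mpr ?_
  split_ifs with h
  · norm_num
  · exact sub_ne_zero.mpr (hμ i h).symm

variable {T : H →L[ℝ] H} {v : Fin m → H} {μ : Fin m → ℝ}

theorem norm_mul_complProj_le (hQ : ∀ x, (∀ i, inner ℝ (v i) x = 0) → ‖T x‖ ≤ 1 / 2 * ‖x‖) :
    ‖T * complProj v‖ ≤ 1 / 2 := by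
  refine ContinuousLinearMap.opNorm_le_bound _ (by norm_num) fun x => ?_
  rw [mul_apply_eq_comp]
  refine (hQ _ fun i => inner_complProj v i x).trans ?_
  gcongr
  exact norm_complProj_le v x

theorem isUnit_one_sub_mul_complProj
    (hQ : ∀ x, (∀ i, inner ℝ (v i) x = 0) → ‖T x‖ ≤ 1 / 2 * ‖x‖) {B : H →L[ℝ] H} (hB : ‖B‖ ≤ 1) :
    IsUnit (1 - B * T * complProj v) := by
  apply isUnit_one_sub_of_norm_lt_one
  rw [mul_assoc]
  calc ‖B * (T * complProj v)‖ ≤ ‖B‖ * ‖T * complProj v‖ := norm_mul_le _ _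
    _ ≤ 1 * (1 / 2) := by gcongr; exact norm_mul_complProj_le hQ
    _ < 1 := by norm_num

/-- The limit of `scaledMatrix` as `l → 0⁺`. -/
theorem exists_tendsto_scaledMatrix (hTs : (T : H →ₗ[ℝ] H).IsSymmetric) (hT : IsCompactOperator T)
    (hv : IsEigenfamily T v μ)
    (hQ : ∀ x, (∀ i, inner ℝ (v i) x = 0) → ‖T x‖ ≤ 1 / 2 * ‖x‖)
    {i₀ : Fin m} (hμ₀ : μ i₀ = 1) {B : ℝ → H →L[ℝ] H} (hB1 : ∀ l > 0, ‖B l‖ ≤ 1)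
    (hB0 : ∀ x, Tendsto (fun l => B l x) (𝓝[>] 0) (𝓝 x)) {g φ : H} (hφ : φ - T φ = -g)
    (hBe : ∀ l > 0, ∀ x, inner ℝ (v i₀) (x - B l x) = l * inner ℝ g (B l x))
    (hBg : ∀ l > 0, v i₀ - B l (v i₀) = -(l • B l g)) :
    ∃ b : Fin m → ℝ, Tendsto (fun l => scaledMatrix v (B l * T) i₀ φ l) (𝓝[>] 0)
      (𝓝 (Matrix.diagonal (fun i => if i = i₀ then 1 else 1 - μ i) *
        (1 : Matrix (Fin m) (Fin m) ℝ).updateRow i₀ (Function.update b i₀ (-inner ℝ g φ)))) := by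
  have hpos : ∀ᶠ l : ℝ in 𝓝[>] 0, 0 < l := eventually_mem_nhdsWithin
  have hTsym : ∀ a b, inner ℝ (T a) b = inner ℝ a (T b) := fun a b => hTs a b
  have hTe : T (v i₀) = v i₀ := by rw [hv.apply_eq, hμ₀, one_smul]
  have hK : Tendsto (fun l => B l * T) (𝓝[>] 0) (𝓝 T) := by
    have := hT.tendsto_comp_of_strong (B₀ := ContinuousLinearMap.id ℝ H) (C := 1)
      (hpos.mono fun l hl => hB1 l hl) hB0
    rwa [ContinuousLinearMap.id_comp] at this
  set Q := complProj v with hQdef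
  have hu0 : IsUnit (1 - T * Q) := by
    have := isUnit_one_sub_mul_complProj hQ (B := 1) ContinuousLinearMap.norm_id_le
    rwa [one_mul] at this
  set I : ℝ → H →L[ℝ] H := fun l => Ring.inverse (1 - B l * T * Q) with hI
  set I₀ := Ring.inverse (1 - T * Q) with hI₀
  have hIlim : Tendsto I (𝓝[>] 0) (𝓝 I₀) :=
    tendsto_ringInverse (tendsto_const_nhds.sub (hK.mul_const Q)) hu0
  have hIv : ∀ j, I₀ (v j) = v j := by
    intro j
    have h1 : (1 - T * Q) (v j) = v j := by
      rw [sub_apply, one_apply_eq_self, mul_apply_eq_comp, hQdef, complProj_apply_family, map_zero,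
        sub_zero]
    conv_lhs => rw [← h1]
    rw [← mul_apply_eq_comp, hI₀, Ring.inverse_mul_cancel _ hu0, one_apply_eq_self]
  -- The source of the first power of l. In I z = z + B T Q I z the vector T Q I z is orthogonal to
  -- `v i₀`, since T fixes `v i₀` and Q maps off it; `hBe` then produces the factor l that cancels
  -- l⁻¹.
  have key : ∀ l > 0, ∀ z, l⁻¹ * inner ℝ (v i₀) (I l z)
      = l⁻¹ * inner ℝ (v i₀) z - inner ℝ g ((B l * T) (Q (I l z))) := by
    intro l hl z
    have h1 : (1 - B l * T * Q) (I l z) = z := by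
      rw [← mul_apply_eq_comp, hI]
      simp only
      rw [Ring.mul_inverse_cancel _ (isUnit_one_sub_mul_complProj hQ (hB1 l hl)),
        one_apply_eq_self]
    have h2 : I l z = z + (B l) (T (Q (I l z))) := by
      have h1' := h1
      simp only [sub_apply, one_apply_eq_self, mul_apply_eq_comp] at h1'
      exact sub_eq_iff_eq_add.mp h1'
    have h3 := hBe l hl (T (Q (I l z)))
    rw [inner_sub_right, ← hTsym, hTe, hQdef, inner_complProj, zero_sub] at h3
    conv_lhs => rw [h2, inner_add_right]
    rw [mul_apply_eq_comp]
    rw [← hQdef] at h3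
    have h4 : inner ℝ (v i₀) ((B l) (T (Q (I l z)))) = -(l * inner ℝ g ((B l) (T (Q (I l z))))) := by
      linarith
    rw [h4]
    field_simp
    ring
  -- The source of the second power of l. Applying 1 − BT to `v i₀` gives −l B g, and the correction
  -- −lφ with (1 − T)φ = −g cancels this leading term, so that even after division by l what remains
  -- tends to 0.
  have hcol : ∀ l > 0, (1 - B l * T) (l⁻¹ • v i₀ - φ) = -(φ - B l φ) := by
    intro l hl
    have h1 : T φ = φ + g := by
      rw [← neg_eq_iff_eq_neg] at hφ
      rw [← hφ]; abel
    rw [sub_apply, one_apply_eq_self, mul_apply_eq_comp, map_sub, map_smul, map_sub, map_smul, hTe,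
      h1, map_add]
    have h2 : l⁻¹ • (v i₀ - B l (v i₀)) = -B l g := by
      rw [hBg l hl, smul_neg, smul_smul, inv_mul_cancel₀ hl.ne', one_smul]
    rw [smul_sub] at h2
    have h3 : l⁻¹ • v i₀ - φ - (l⁻¹ • (B l) (v i₀) - ((B l) φ + (B l) g))
      = (l⁻¹ • v i₀ - l⁻¹ • (B l) (v i₀)) + (B l) g - (φ - (B l) φ) := by abel
    rw [h3, h2]
    abel
  have hφ0 : Tendsto (fun l => φ - B l φ) (𝓝[>] 0) (𝓝 0) := by
    simpa using (tendsto_const_nhds (x := φ)).sub (hB0 φ)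
  have hIφ : Tendsto (fun l => I l (φ - B l φ)) (𝓝[>] 0) (𝓝 0) := by
    simpa using tendsto_clm_apply hIlim hφ0
  have h1K : ∀ x, Tendsto (fun l => (1 - B l * T) x) (𝓝[>] 0) (𝓝 ((1 - T) x)) := fun x =>
    tendsto_clm_apply (tendsto_const_nhds.sub hK) tendsto_const_nhds
  -- The off-diagonal limits in row `i₀` do not matter later: column `i₀` of the limit is zero off
  -- the diagonal, so they drop out of the determinant.
  refine ⟨fun j => inner ℝ g (T (v j)) - inner ℝ g (T (Q (I₀ ((1 - T) (v j))))), ?_⟩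
  refine tendsto_pi_nhds.mpr fun i => tendsto_pi_nhds.mpr fun j => ?_
  rw [Matrix.diagonal_mul]
  by_cases hi : i = i₀
  · subst hi
    by_cases hj : j = i
    · subst hj
      simp only [if_true, one_mul, Matrix.updateRow_self, Function.update_self]
      have hlim : Tendsto (fun l => -inner ℝ g (B l φ)
          + inner ℝ g ((B l * T) (Q (I l (φ - B l φ))))) (𝓝[>] 0) (𝓝 (-inner ℝ g φ)) := by
        have h1 := tendsto_clm_apply hK ((Q.continuous.tendsto 0).comp hIφ)
        have h2 := ((tendsto_const_nhds (x := g)).inner (𝕜 := ℝ) (hB0 φ)).neg.add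
          ((tendsto_const_nhds (x := g)).inner (𝕜 := ℝ) h1)
        simpa using h2
      refine hlim.congr' ?_
      filter_upwards [hpos] with l hl
      have h1 := key l hl (φ - B l φ)
      rw [hBe l hl φ, ← mul_assoc, inv_mul_cancel₀ hl.ne', one_mul] at h1
      simp only [scaledMatrix, if_true]
      rw [hcol l hl, map_neg, inner_neg_right, mul_neg]
      change _ = -(l⁻¹ * inner ℝ (v j) (I l (φ - B l φ)))
      rw [h1]; ring
    · simp only [if_true, one_mul, Matrix.updateRow_self, Function.update_of_ne hj]
      have hlim : Tendsto (fun l => inner ℝ g (B l (T (v j)))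
          - inner ℝ g ((B l * T) (Q (I l ((1 - B l * T) (v j)))))) (𝓝[>] 0)
          (𝓝 (inner ℝ g (T (v j)) - inner ℝ g (T (Q (I₀ ((1 - T) (v j))))))) := by
        have h1 := tendsto_clm_apply hK ((Q.continuous.tendsto _).comp
          (tendsto_clm_apply hIlim (h1K (v j))))
        exact ((tendsto_const_nhds (x := g)).inner (𝕜 := ℝ) (hB0 _)).sub
          ((tendsto_const_nhds (x := g)).inner (𝕜 := ℝ) h1)
      refine hlim.congr' ?_
      filter_upwards [hpos] with l hl
      have h1 := key l hl ((1 - B l * T) (v j))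
      have h2 : inner ℝ (v i) ((1 - B l * T) (v j)) = l * inner ℝ g (B l (T (v j))) := by
        have hne : inner ℝ (v i) (v j) = 0 := hv.orthonormal.2 (Ne.symm hj)
        rw [← hBe l hl, inner_sub_right, sub_apply, inner_sub_right, one_apply_eq_self, hne,
          ← hTsym, hTe, hne, mul_apply_eq_comp]
      rw [h2, ← mul_assoc, inv_mul_cancel₀ hl.ne', one_mul] at h1
      simp only [scaledMatrix, if_true, if_neg hj]
      exact h1.symm
  · rw [Matrix.updateRow_ne hi]
    by_cases hj : j = i₀
    · subst hj
      rw [Matrix.one_apply_ne hi, mul_zero]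
      have hlim : Tendsto (fun l => -inner ℝ (v i) (I l (φ - B l φ))) (𝓝[>] 0) (𝓝 0) := by
        simpa using ((tendsto_const_nhds (x := v i)).inner (𝕜 := ℝ) hIφ).neg
      refine hlim.congr' ?_
      filter_upwards [hpos] with l hl
      simp only [scaledMatrix, if_true, if_neg hi, one_mul]
      rw [hcol l hl, map_neg, inner_neg_right]
    · simp only [if_neg hi]
      have hlim := (tendsto_const_nhds (x := v i)).inner (𝕜 := ℝ)
          (tendsto_clm_apply hIlim (h1K (v j)))
      have hval : inner ℝ (v i) (I₀ ((1 - T) (v j)))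
          = (1 - μ i) * (1 : Matrix (Fin m) (Fin m) ℝ) i j := by
        rw [sub_apply, one_apply_eq_self, hv.apply_eq, map_sub, map_smul, hIv, inner_sub_right,
          inner_smul_right, orthonormal_iff_ite.mp hv.orthonormal, Matrix.one_apply]
        by_cases hij : i = j
        · subst hij; simp
        · simp [hij]
      rw [hval] at hlim
      refine hlim.congr fun l => ?_
      simp only [scaledMatrix, if_neg hi, if_neg hj, one_mul]
      rfl

omit [NormedAddCommGroup H] [InnerProductSpace ℝ H] [CompleteSpace H] in
theorem tendsto_matrix_det {ι : Type*} {l : Filter ι} {A : ι → Matrix (Fin m) (Fin m) ℝ}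
    {A₀ : Matrix (Fin m) (Fin m) ℝ} (hA : Tendsto A l (𝓝 A₀)) :
    Tendsto (fun i => (A i).det) l (𝓝 A₀.det) :=
  ((continuous_id (X := Matrix (Fin m) (Fin m) ℝ)).matrix_det.tendsto A₀).comp hA

/-- The determinant d(l) tends to 1 at infinity, and its rescaling has a limit at 0⁺ of sign
opposite to that in `hsign`; hence d changes sign on the connected half line. -/
theorem exists_fixed_of_sign (hTs : (T : H →ₗ[ℝ] H).IsSymmetric) (hT : IsCompactOperator T)
    (hv : IsEigenfamily T v μ)
    (hQ : ∀ x, (∀ i, inner ℝ (v i) x = 0) → ‖T x‖ ≤ 1 / 2 * ‖x‖)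
    {i₀ : Fin m} (hμ₀ : μ i₀ = 1) (hμ : ∀ i, i ≠ i₀ → μ i ≠ 1)
    {B : ℝ → H →L[ℝ] H} (hB1 : ∀ l > 0, ‖B l‖ ≤ 1) (hBc : ContinuousOn B (Ioi 0))
    (hB0 : ∀ x, Tendsto (fun l => B l x) (𝓝[>] 0) (𝓝 x))
    (hBinf : ∀ x, Tendsto (fun l => B l x) atTop (𝓝 0)) {g φ : H} (hφ : φ - T φ = -g)
    (hBe : ∀ l > 0, ∀ x, inner ℝ (v i₀) (x - B l x) = l * inner ℝ g (B l x))
    (hBg : ∀ l > 0, v i₀ - B l (v i₀) = -(l • B l g))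
    (hsign : 0 < (-1 : ℝ) ^ (Finset.univ.filter fun i => 1 < μ i).card * inner ℝ g φ) :
    ∃ l > 0, ∃ z ≠ 0, B l (T z) = z := by
  have hu : ∀ l > 0, IsUnit (1 - B l * T * complProj v) := fun l hl =>
    isUnit_one_sub_mul_complProj hQ (hB1 l hl)
  set d : ℝ → ℝ := fun l => (reducedMatrix v (B l * T)).det with hd
  have hdc : ContinuousOn d (Ioi 0) := by
    intro l hl
    have h1 : Tendsto (fun l => B l * T) (𝓝[Ioi 0] l) (𝓝 (B l * T)) := (hBc l hl).mul_const T
    exact tendsto_matrix_det (tendsto_reducedMatrix v h1 (hu l hl))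
  have hdinf : Tendsto d atTop (𝓝 1) := by
    have h1 : Tendsto (fun l => B l * T) atTop (𝓝 0) := by
      have := hT.tendsto_comp_of_strong (B₀ := 0) (C := 1)
        ((eventually_gt_atTop 0).mono fun l hl => hB1 l hl) (by simpa using hBinf)
      rwa [ContinuousLinearMap.zero_comp] at this
    have h2 := tendsto_reducedMatrix v h1 (by simp)
    rw [reducedMatrix_zero hv.orthonormal] at h2
    simpa using tendsto_matrix_det h2
  obtain ⟨b, hb⟩ := exists_tendsto_scaledMatrix hTs hT hv hQ hμ₀ hB1 hB0 hφ hBe hBg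
  have hdet : Tendsto (fun l => (scaledMatrix v (B l * T) i₀ φ l).det) (𝓝[>] 0)
      (𝓝 ((∏ i, (if i = i₀ then 1 else 1 - μ i)) * (-inner ℝ g φ))) := by
    convert tendsto_matrix_det hb using 2
    rw [Matrix.det_mul, Matrix.det_diagonal, ← Matrix.cramer_transpose_apply, Matrix.transpose_one,
      Matrix.cramer_one]
    simp
  have hneg : (∏ i, (if i = i₀ then 1 else 1 - μ i)) * (-inner ℝ g φ) < 0 := by
    have h1 := zero_lt_neg_one_pow_mul_prod_one_sub hμ₀ hμ
    have h2 := mul_pos h1 hsign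
    have h3 : ((-1 : ℝ) ^ (Finset.univ.filter fun i => 1 < μ i).card) ^ 2 = 1 := by
      rw [← pow_mul, mul_comm, pow_mul]; simp
    nlinarith
  have hev : ∀ᶠ l : ℝ in 𝓝[>] 0, 0 < l ∧ d l < 0 := by
    -- For l this small the factor l⁻¹(l⁻¹ − ⟨v, φ⟩) relating the rescaled determinant to d is
    -- positive, so the two have the same sign.
    have hinv : ∀ᶠ l : ℝ in 𝓝[>] 0, inner ℝ (v i₀) φ < l⁻¹ :=
      tendsto_inv_nhdsGT_zero.eventually_gt_atTop _
    filter_upwards [hdet.eventually_lt_const hneg, hinv, eventually_mem_nhdsWithin]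
      with l h1 h2 h3
    have h3' : 0 < l := h3
    refine ⟨h3', ?_⟩
    rw [det_scaledMatrix hv.orthonormal (hu l h3')] at h1
    have h4 : 0 < l⁻¹ * (l⁻¹ - inner ℝ (v i₀) φ) := mul_pos (inv_pos.mpr h3') (sub_pos.mpr h2)
    by_contra! h5
    have := mul_nonneg h4.le h5
    simp only [hd] at this
    linarith
  obtain ⟨l₁, hl₁, hd₁⟩ := hev.exists
  obtain ⟨l₂, hl₂, hd₂⟩ := ((eventually_gt_atTop 0).and
    (hdinf.eventually_const_lt (show (0 : ℝ) < 1 by norm_num))).exists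
  obtain ⟨l, hl, hdl⟩ := isPreconnected_Ioi.intermediate_value (show l₁ ∈ Ioi 0 from hl₁)
    (show l₂ ∈ Ioi 0 from hl₂) hdc ⟨hd₁.le, hd₂.le⟩
  obtain ⟨z, hz, hz'⟩ := exists_fixed_of_det_reducedMatrix_eq_zero hv.orthonormal (hu l hl) hdl
  exact ⟨l, hl, z, hz, hz'⟩

end GrowingMode

/-! ### Locating the eigenvalue 1 inside the eigenfamily. -/

section GrowingMode

variable {H : Type*} [NormedAddCommGroup H] [InnerProductSpace ℝ H] [CompleteSpace H] {m : ℕ}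
variable {T : H →L[ℝ] H} {v : Fin m → H} {μ : Fin m → ℝ}

/-- The component of e off the span is again fixed by T, which contracts by 1/2 there, so it
vanishes. Hence some member pairs nontrivially with e and has eigenvalue 1; by `hker` it is a
multiple of e, and a second such member would be parallel to it. -/
theorem IsEigenfamily.exists_eq_smul (hTs : (T : H →ₗ[ℝ] H).IsSymmetric)
    (hv : IsEigenfamily T v μ)
    (hQ : ∀ x, (∀ i, inner ℝ (v i) x = 0) → ‖T x‖ ≤ 1 / 2 * ‖x‖)
    {e : H} (he : T e = e) (he0 : e ≠ 0) (hker : ∀ x, T x = x → ∃ a : ℝ, x = a • e) :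
    ∃ i₀, ∃ a : ℝ, a ≠ 0 ∧ v i₀ = a • e ∧ μ i₀ = 1 ∧ ∀ i, i ≠ i₀ → μ i ≠ 1 := by
  have hTsym : ∀ a b, inner ℝ (T a) b = inner ℝ a (T b) := fun a b => hTs a b
  have hc : ∀ i, μ i * inner ℝ (v i) e = inner ℝ (v i) e := by
    intro i
    conv_rhs => rw [← he, ← hTsym, hv.apply_eq, inner_smul_left]
    simp
  have hsum := sub_complProj_eq_sum hv.orthonormal e
  have hT : T (complProj v e) = complProj v e := by
    have h1 : complProj v e = e - ∑ i, inner ℝ (v i) e • v i := by rw [← hsum]; abel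
    rw [h1, map_sub, map_sum, he]
    congr 1
    refine Finset.sum_congr rfl fun i _ => ?_
    rw [map_smul, hv.apply_eq, smul_smul, mul_comm, hc]
  have h0 : complProj v e = 0 := by
    have h1 := hQ _ fun i => inner_complProj v i e
    rw [hT] at h1
    have : ‖complProj v e‖ ≤ 0 := by linarith [norm_nonneg (complProj v e)]
    exact norm_le_zero_iff.mp this
  rw [h0, sub_zero] at hsum
  have hex : ∃ i, inner ℝ (v i) e ≠ 0 := by
    by_contra! hcon
    exact he0 (by rw [hsum]; simp [hcon])
  obtain ⟨i, hi⟩ := hex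
  have hone : ∀ j, μ j = 1 → ∃ a : ℝ, a ≠ 0 ∧ v j = a • e := by
    intro j hj
    obtain ⟨a, ha⟩ := hker (v j) (by rw [hv.apply_eq, hj, one_smul])
    refine ⟨a, ?_, ha⟩
    rintro rfl
    have := hv.orthonormal.1 j
    rw [ha] at this
    simp at this
  have hμi : μ i = 1 := by
    have := hc i
    exact mul_right_cancel₀ hi (by rw [this, one_mul])
  obtain ⟨a, ha0, ha⟩ := hone i hμi
  refine ⟨i, a, ha0, ha, hμi, fun j hji hj => ?_⟩
  obtain ⟨a', ha0', ha'⟩ := hone j hj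
  have : inner ℝ (v j) (v i) = 0 := hv.orthonormal.2 hji
  rw [ha, ha', inner_smul_left, inner_smul_right, real_inner_self_eq_norm_sq] at this
  simp [ha0, ha0', he0] at this

/-- The family contains a·e rather than e. The relations on g and φ are linear, so both are
multiplied by a, which changes ⟨g, φ⟩ only by the positive factor a². -/
theorem IsEigenfamily.exists_fixed (hTs : (T : H →ₗ[ℝ] H).IsSymmetric) (hT : IsCompactOperator T)
    (hv : IsEigenfamily T v μ)
    (hQ : ∀ x, (∀ i, inner ℝ (v i) x = 0) → ‖T x‖ ≤ 1 / 2 * ‖x‖)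
    {e : H} (he : T e = e) (he0 : e ≠ 0) (hker : ∀ x, T x = x → ∃ a : ℝ, x = a • e)
    {B : ℝ → H →L[ℝ] H} (hB1 : ∀ l > 0, ‖B l‖ ≤ 1) (hBc : ContinuousOn B (Ioi 0))
    (hB0 : ∀ x, Tendsto (fun l => B l x) (𝓝[>] 0) (𝓝 x))
    (hBinf : ∀ x, Tendsto (fun l => B l x) atTop (𝓝 0)) {g φ : H} (hφ : φ - T φ = -g)
    (hBe : ∀ l > 0, ∀ x, inner ℝ e (x - B l x) = l * inner ℝ g (B l x))
    (hBg : ∀ l > 0, e - B l e = -(l • B l g))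
    (hsign : 0 < (-1 : ℝ) ^ (Finset.univ.filter fun i => 1 < μ i).card * inner ℝ g φ) :
    ∃ l > 0, ∃ z ≠ 0, B l (T z) = z := by
  obtain ⟨i₀, a, ha0, ha, hμ₀, hμ⟩ := hv.exists_eq_smul hTs hQ he he0 hker
  refine exists_fixed_of_sign hTs hT hv hQ hμ₀ hμ hB1 hBc hB0 hBinf (g := a • g) (φ := a • φ) ?_ ?_
    ?_ ?_
  · rw [map_smul, ← smul_sub, hφ, smul_neg]
  · intro l hl x
    rw [ha, inner_smul_left, inner_smul_left, hBe l hl]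
    simp only [conj_trivial]
    ring
  · intro l hl
    rw [ha, map_smul, map_smul, ← smul_sub, hBg l hl, smul_neg, smul_comm]
  · rw [inner_smul_left, inner_smul_right]
    have : 0 < a ^ 2 := by positivity
    simp only [conj_trivial]
    nlinarith [mul_pos this hsign]

/-- Off the eigenvectors with eigenvalue above `1`, the form of `T` is at most the identity. -/
theorem IsEigenfamily.inner_le (hv : IsEigenfamily T v μ) (hTs : (T : H →ₗ[ℝ] H).IsSymmetric)
    (hQ : ∀ x, (∀ i, inner ℝ (v i) x = 0) → ‖T x‖ ≤ 1 / 2 * ‖x‖) {x : H}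
    (hx : ∀ i, 1 < μ i → inner ℝ (v i) x = 0) : inner ℝ (T x) x ≤ ‖x‖ ^ 2 := by
  have hTsym : ∀ a b, inner ℝ (T a) b = inner ℝ a (T b) := fun a b => hTs a b
  set y := complProj v x with hy
  have hyv : ∀ i, inner ℝ (v i) y = 0 := fun i => inner_complProj v i x
  set s := ∑ i, inner ℝ (v i) x • v i with hs
  have hxs : x = y + s := by
    have := sub_complProj_eq_sum hv.orthonormal x
    rw [hs, ← this]; abel
  have hsy : ∀ z, (∀ i, inner ℝ (v i) z = 0) → inner ℝ s z = 0 := by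
    intro z hz
    rw [hs, sum_inner]
    exact Finset.sum_eq_zero fun i _ => by rw [inner_smul_left, hz, mul_zero]
  have hTs' : T s = ∑ i, (inner ℝ (v i) x * μ i) • v i := by
    rw [hs, map_sum]
    refine Finset.sum_congr rfl fun i _ => ?_
    rw [map_smul, hv.apply_eq, smul_smul]
  have hTy : ∀ i, inner ℝ (v i) (T y) = 0 := by
    intro i
    rw [← hTsym, hv.apply_eq, inner_smul_left, hyv, mul_zero]
  have h1 : inner ℝ (T x) x = inner ℝ (T y) y + inner ℝ (T s) s := by
    rw [hxs, map_add, inner_add_left, inner_add_right, inner_add_right]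
    have e1 : inner ℝ (T y) s = 0 := by rw [real_inner_comm, hsy _ hTy]
    have e2 : inner ℝ (T s) y = 0 := by rw [hTsym, hsy _ hTy]
    rw [e1, e2]; ring
  have h2 : ‖x‖ ^ 2 = ‖y‖ ^ 2 + inner ℝ s s := by
    rw [← real_inner_self_eq_norm_sq, hxs, inner_add_left, inner_add_right, inner_add_right,
      hsy _ hyv, real_inner_comm s y, hsy _ hyv, real_inner_self_eq_norm_sq]
    ring
  have h3 : inner ℝ (T s) s ≤ inner ℝ s s := by
    rw [hTs', sum_inner]
    conv_rhs => rw [hs, sum_inner]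
    rw [← hs]
    refine Finset.sum_le_sum fun i _ => ?_
    have h4 : inner ℝ (v i) s = inner ℝ (v i) x := by
      rw [hs, hv.orthonormal.inner_right_fintype]
    rw [inner_smul_left, inner_smul_left, h4]
    simp only [conj_trivial]
    by_cases hi : 1 < μ i
    · rw [hx i hi]; simp
    · push Not at hi
      nlinarith [mul_self_nonneg (inner ℝ (v i) x)]
  have h4 : inner ℝ (T y) y ≤ ‖y‖ ^ 2 := by
    have := real_inner_le_norm (T y) y
    have h5 := hQ y hyv
    nlinarith [norm_nonneg y, norm_nonneg (T y)]
  linarith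

end GrowingMode

/-! ### The Birman–Schwinger count of negative eigenvalues. -/

section NegativeIndex

variable {H : Type*} [NormedAddCommGroup H] [InnerProductSpace ℂ H] [CompleteSpace H]

omit [CompleteSpace H] in
theorem symmetric_inverse {D : H →L[ℂ] H} (hD : (D : H →ₗ[ℂ] H).IsSymmetric) (hu : IsUnit D) :
    ∀ a b, inner ℂ (Ring.inverse D a) b = inner ℂ a (Ring.inverse D b) := by
  intro a b
  have h1 : ∀ x, D (Ring.inverse D x) = x := fun x => by
    rw [← mul_apply_eq_comp, Ring.mul_inverse_cancel _ hu, one_apply_eq_self]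
  have h2 : inner ℂ (D (Ring.inverse D a)) (Ring.inverse D b)
      = inner ℂ (Ring.inverse D a) (D (Ring.inverse D b)) := hD _ _
  rw [h1, h1] at h2
  exact h2.symm

/-- The operator `Z (1 - Z q Z)⁻¹ Z`; if `Z = (S + k)^{-1/2}` this is `(S + k - q)⁻¹`. -/
noncomputable def perturbedInverse (Z q : H →L[ℂ] H) : H →L[ℂ] H :=
  Z * Ring.inverse (1 - Z * q * Z) * Z

variable {P q Z : H →L[ℂ] H}

/-- The resolvent identity. It displays the inverse as Z², whose form is controlled, plus Z²q times
a bounded operator, which is compact in the application. -/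
theorem perturbedInverse_apply (hθ : ‖Z * q * Z‖ < 1) (f : H) :
    perturbedInverse Z q f = Z (Z f) + Z (Z (q (perturbedInverse Z q f))) := by
  have hu : IsUnit (1 - Z * q * Z) := isUnit_one_sub_of_norm_lt_one hθ
  set b := Ring.inverse (1 - Z * q * Z) (Z f) with hb
  have h1 : (1 - Z * q * Z) b = Z f := by
    rw [hb, ← mul_apply_eq_comp, Ring.mul_inverse_cancel _ hu, one_apply_eq_self]
  simp only [sub_apply, one_apply_eq_self, mul_apply_eq_comp] at h1
  have h2 : perturbedInverse Z q f = Z b := rfl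
  rw [h2, ← map_add]
  congr 1
  exact sub_eq_iff_eq_add.mp h1

/-- The difference r of the two sides satisfies r = ZZqr, so Zqr is fixed by the strict contraction
ZqZ and vanishes; then r vanishes too. -/
theorem eq_perturbedInverse (hθ : ‖Z * q * Z‖ < 1) {u y : H} (h : u = Z (Z (q u + y))) :
    u = perturbedInverse Z q y := by
  rw [← sub_eq_zero]
  set r := u - perturbedInverse Z q y with hr
  have h1 : r = Z (Z (q r)) := by
    have h2 := perturbedInverse_apply (Z := Z) hθ y
    have h3 : Z (Z (q r)) = Z (Z (q u + y)) - (Z (Z y) + Z (Z (q (perturbedInverse Z q y)))) := by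
      rw [hr]; simp only [map_sub, map_add]; abel
    rw [h3, ← h, ← h2]
  have h2 : Z (q r) = (Z * q * Z) (Z (q r)) := by
    conv_lhs => rw [h1]
    rfl
  have h3 : ‖Z (q r)‖ ≤ ‖Z * q * Z‖ * ‖Z (q r)‖ := by
    conv_lhs => rw [h2]
    exact ContinuousLinearMap.le_opNorm _ _
  have h4 : Z (q r) = 0 := by
    rw [← norm_le_zero_iff]
    nlinarith [norm_nonneg (Z (q r))]
  rw [h1, h4, map_zero]

theorem perturbedInverse_symmetric (hZ : (Z : H →ₗ[ℂ] H).IsSymmetric)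
    (hq : (q : H →ₗ[ℂ] H).IsSymmetric) (hθ : ‖Z * q * Z‖ < 1) :
    (perturbedInverse Z q : H →ₗ[ℂ] H).IsSymmetric := by
  have hZ' : ∀ a b, inner ℂ (Z a) b = inner ℂ a (Z b) := fun a b => hZ a b
  have hq' : ∀ a b, inner ℂ (q a) b = inner ℂ a (q b) := fun a b => hq a b
  have hD : ((1 - Z * q * Z : H →L[ℂ] H) : H →ₗ[ℂ] H).IsSymmetric := by
    intro a b
    simp only [ContinuousLinearMap.coe_coe, sub_apply, one_apply_eq_self, mul_apply_eq_comp,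
      inner_sub_left, inner_sub_right]
    rw [hZ', hq', hZ']
  intro a b
  simp only [perturbedInverse, ContinuousLinearMap.coe_coe, mul_apply_eq_comp]
  rw [hZ', symmetric_inverse hD (isUnit_one_sub_of_norm_lt_one hθ), hZ']

/-- With b = (1 − ZqZ)⁻¹Zf the form equals ⟨b, (1 − ZqZ)b⟩. -/
theorem perturbedInverse_nonneg (hZ : (Z : H →ₗ[ℂ] H).IsSymmetric)
    (hθ : ‖Z * q * Z‖ < 1) (f : H) : 0 ≤ RCLike.re (inner ℂ (perturbedInverse Z q f) f) := by
  have hu : IsUnit (1 - Z * q * Z) := isUnit_one_sub_of_norm_lt_one hθ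
  set b := Ring.inverse (1 - Z * q * Z) (Z f) with hb
  have h1 : (1 - Z * q * Z) b = Z f := by
    rw [hb, ← mul_apply_eq_comp, Ring.mul_inverse_cancel _ hu, one_apply_eq_self]
  have h2 : perturbedInverse Z q f = Z b := rfl
  have hZ' : ∀ a b, inner ℂ (Z a) b = inner ℂ a (Z b) := fun a b => hZ a b
  rw [h2, hZ', ← h1, sub_apply, one_apply_eq_self, inner_sub_right, map_sub, inner_self_eq_norm_sq]
  have h3 : RCLike.re (inner ℂ b ((Z * q * Z) b)) ≤ ‖b‖ * ‖(Z * q * Z) b‖ := re_inner_le_norm _ _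
  have h4 := (Z * q * Z).le_opNorm b
  have h5 : ‖b‖ * ‖(Z * q * Z) b‖ ≤ ‖b‖ * ‖b‖ := by
    refine mul_le_mul_of_nonneg_left ?_ (norm_nonneg _)
    nlinarith [norm_nonneg b]
  nlinarith

variable {E : ℝ → Submodule ℂ H} {k a : ℝ}

/-- The hypotheses speak of unbounded operators through bounded ones. With S = P⁻², `hE` is (S − q)u
= νu solved for u, and `hR` is S⁻¹ = (S + k)⁻¹(1 + kS⁻¹). Together they give (S + k − q)u = (ν +
k)u, to which the inverse applies. -/
theorem eq_smul_perturbedInverse_of_mem (hE : ∀ ν u, u ∈ E ν ↔ u = P (P (q u + (ν : ℂ) • u)))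
    (hR : ∀ f, P (P f) = Z (Z (f + (k : ℂ) • P (P f)))) (hθ : ‖Z * q * Z‖ < 1) {ν : ℝ} {u : H}
    (hu : u ∈ E ν) : u = ((ν + k : ℝ) : ℂ) • perturbedInverse Z q u := by
  rw [hE] at hu
  rw [← map_smul]
  apply eq_perturbedInverse hθ
  have h := hR (q u + (ν : ℂ) • u)
  rw [← hu] at h
  rw [Complex.ofReal_add, add_smul, ← add_assoc]
  exact h

/-- An eigenvalue M of (N + k)⁻¹ is an eigenvalue M⁻¹ − k of N. To return from (S + k)⁻¹ to S⁻¹, the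
discrepancy d satisfies d = kZZd, and ka < 1 forces d = 0. -/
theorem mem_of_perturbedInverse_eq_smul (hE : ∀ ν u, u ∈ E ν ↔ u = P (P (q u + (ν : ℂ) • u)))
    (hR : ∀ f, P (P f) = Z (Z (f + (k : ℂ) • P (P f)))) (hθ : ‖Z * q * Z‖ < 1)
    (hk : 0 < k) (ha0 : 0 ≤ a) (ha : a < k⁻¹) (hZa : ∀ x, ‖Z x‖ ^ 2 ≤ a * ‖x‖ ^ 2)
    {M : ℝ} (hM : M ≠ 0) {u : H} (hu : perturbedInverse Z q u = (M : ℂ) • u) :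
    u ∈ E (M⁻¹ - k) := by
  rw [hE]
  set f := q u + ((M⁻¹ - k : ℝ) : ℂ) • u with hf
  have hMc : (M : ℂ) ≠ 0 := by exact_mod_cast hM
  have h1 : u = Z (Z (f + (k : ℂ) • u)) := by
    have h2 := perturbedInverse_apply (Z := Z) hθ u
    rw [hu, ← map_add, ← map_add, map_smul] at h2
    have h3 : f + (k : ℂ) • u = (M : ℂ)⁻¹ • (u + (M : ℂ) • q u) := by
      rw [hf, smul_add, smul_smul, inv_mul_cancel₀ hMc, one_smul]
      push_cast
      rw [sub_smul]
      abel
    rw [h3, map_smul, map_smul, ← h2, smul_smul, inv_mul_cancel₀ hMc, one_smul]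
  have h2 := hR f
  set d := u - P (P f) with hd
  have h3 : d = (k : ℂ) • Z (Z d) := by
    have h4 : (k : ℂ) • Z (Z d) = Z (Z (f + (k : ℂ) • u)) - Z (Z (f + (k : ℂ) • P (P f))) := by
      rw [hd]; simp only [map_sub, map_add, map_smul, smul_sub]; abel
    rw [h4, ← h1, ← h2]
  have h4 : ‖Z (Z d)‖ ≤ a * ‖d‖ := by
    have h5 := hZa (Z d)
    have h6 := hZa d
    refine abs_le_of_sq_le_sq' ?_ (by positivity) |>.2
    nlinarith
  have h5 : ‖d‖ ≤ k * (a * ‖d‖) := by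
    conv_lhs => rw [h3, norm_smul, Complex.norm_real, Real.norm_of_nonneg hk.le]
    gcongr
  have h6 : k * a < 1 := by
    calc k * a < k * k⁻¹ := by gcongr
      _ = 1 := mul_inv_cancel₀ hk.ne'
  have h7 : d = 0 := by
    rw [← norm_le_zero_iff]
    nlinarith [norm_nonneg d]
  exact sub_eq_zero.mp h7

omit [CompleteSpace H] in
theorem inner_eq_zero_of_mem_of_ne (hP : (P : H →ₗ[ℂ] H).IsSymmetric)
    (hq : (q : H →ₗ[ℂ] H).IsSymmetric) (hE : ∀ ν u, u ∈ E ν ↔ u = P (P (q u + (ν : ℂ) • u)))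
    {ν ν' : ℝ} (hne : ν ≠ ν') {u u' : H} (hu : u ∈ E ν) (hu' : u' ∈ E ν') : inner ℂ u u' = 0 := by
  have hP' : ∀ a b, inner ℂ (P a) b = inner ℂ a (P b) := fun a b => hP a b
  have hq' : ∀ a b, inner ℂ (q a) b = inner ℂ a (q b) := fun a b => hq a b
  rw [hE] at hu hu'
  have h1 : inner ℂ (q u + (ν : ℂ) • u) u' = inner ℂ u (q u' + (ν' : ℂ) • u') := by
    conv_lhs => rw [hu', ← hP', ← hP', ← hu]
  rw [inner_add_left, inner_add_right, inner_smul_left, inner_smul_right, hq', Complex.conj_ofReal,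
    add_right_inj] at h1
  have h2 : ((ν : ℂ) - ν') * inner ℂ u u' = 0 := by rw [sub_mul, h1, sub_self]
  have h3 : (ν : ℂ) - ν' ≠ 0 := by
    rw [sub_ne_zero]; exact_mod_cast hne
  exact (mul_eq_zero.mp h2).resolve_left h3

omit [CompleteSpace H] in
/-- The form is negative on the span of the eigenvectors with negative eigenvalue. -/
theorem exists_form_neg_of_mem_iSup (hP : (P : H →ₗ[ℂ] H).IsSymmetric)
    (hq : (q : H →ₗ[ℂ] H).IsSymmetric) (hE : ∀ ν u, u ∈ E ν ↔ u = P (P (q u + (ν : ℂ) • u)))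
    {w : H} (hw : w ∈ (⨆ ν : {ν : ℝ // ν < 0}, E ν : Submodule ℂ H)) :
    ∃ f, w = P (P f) ∧ (0 ≤ RCLike.re (inner ℂ (f - q w) w) → w = 0) := by
  obtain ⟨u, hu, rfl⟩ := (Submodule.mem_iSup_iff_exists_finsupp _ _).mp hw
  have hsum : u.sum (fun _ x => x) = ∑ ν ∈ u.support, u ν := rfl
  rw [hsum]
  -- The witness is Sw, computed from Su = qu + νu on each eigenvector; then Sw − qw = ∑ νu_ν, and
  -- orthogonality of the eigenspaces makes the form a sum of negative terms.
  refine ⟨∑ ν ∈ u.support, (q (u ν) + ((ν : ℝ) : ℂ) • u ν), ?_, ?_⟩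
  · rw [map_sum, map_sum]
    exact Finset.sum_congr rfl fun ν _ => (hE ν _).mp (hu ν)
  · intro h0
    have h1 : ∑ ν ∈ u.support, (q (u ν) + ((ν : ℝ) : ℂ) • u ν) - q (∑ ν ∈ u.support, u ν)
        = ∑ ν ∈ u.support, ((ν : ℝ) : ℂ) • u ν := by
      rw [map_sum, ← Finset.sum_sub_distrib]
      exact Finset.sum_congr rfl fun ν _ => by abel
    have h2 : RCLike.re (inner ℂ (∑ ν ∈ u.support, ((ν : ℝ) : ℂ) • u ν) (∑ ν ∈ u.support, u ν))
        = ∑ ν ∈ u.support, (ν : ℝ) * ‖u ν‖ ^ 2 := by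
      rw [sum_inner, map_sum]
      refine Finset.sum_congr rfl fun ν hν => ?_
      rw [inner_sum, Finset.sum_eq_single ν, inner_smul_left, Complex.conj_ofReal]
      · have := inner_self_eq_norm_sq (𝕜 := ℂ) (u ν)
        rw [← this]
        simp
      · intro ν' _ hne
        rw [inner_smul_left, inner_eq_zero_of_mem_of_ne hP hq hE
          (fun h => hne (Subtype.ext h.symm)) (hu ν) (hu ν'), mul_zero]
      · exact fun h => absurd hν h
    rw [h1, h2] at h0
    have h3 : ∀ ν ∈ u.support, (ν : ℝ) * ‖u ν‖ ^ 2 ≤ 0 := fun ν _ =>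
      mul_nonpos_of_nonpos_of_nonneg ν.2.le (by positivity)
    have h4 := (Finset.sum_eq_zero_iff_of_nonpos h3).mp (le_antisymm (Finset.sum_nonpos h3) h0)
    refine Finset.sum_eq_zero fun ν hν => ?_
    have h5 := h4 ν hν
    rw [mul_eq_zero, or_iff_right ν.2.ne] at h5
    simpa using h5

/-- The form is nonnegative off the eigenvectors with negative eigenvalue. -/
theorem form_nonneg_of_orthogonal (hZ : (Z : H →ₗ[ℂ] H).IsSymmetric)
    (hq : (q : H →ₗ[ℂ] H).IsSymmetric) (hE : ∀ ν u, u ∈ E ν ↔ u = P (P (q u + (ν : ℂ) • u)))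
    (hR : ∀ f, P (P f) = Z (Z (f + (k : ℂ) • P (P f)))) (hθ : ‖Z * q * Z‖ < 1)
    (hk : 0 < k) (ha0 : 0 ≤ a) (ha : a < k⁻¹) (hZa : ∀ x, ‖Z x‖ ^ 2 ≤ a * ‖x‖ ^ 2)
    (hc : IsCompactOperator (Z * Z * q)) {f u : H} (hu : u = P (P f))
    (huW : u ∈ (⨆ ν : {ν : ℝ // ν < 0}, E ν : Submodule ℂ H).orthogonal) :
    0 ≤ RCLike.re (inner ℂ (f - q u) u) := by
  set W : Submodule ℂ H := ⨆ ν : {ν : ℝ // ν < 0}, E ν with hW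
  set X := perturbedInverse Z q with hX
  have hZ' : ∀ a b, inner ℂ (Z a) b = inner ℂ a (Z b) := fun a b => hZ a b
  have hXs := perturbedInverse_symmetric hZ hq hθ
  have hXs' : ∀ a b, inner ℂ (X a) b = inner ℂ a (X b) := fun a b => hXs a b
  have horth : ∀ x, x ∈ W.orthogonal ↔ ∀ ν < 0, ∀ w ∈ E ν, inner ℂ w x = 0 := by
    intro x
    rw [hW, Submodule.mem_orthogonal]
    constructor
    · intro h ν hν w hw
      exact h w (Submodule.mem_iSup_of_mem (⟨ν, hν⟩ : {ν : ℝ // ν < 0}) hw)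
    · intro h w hw
      induction hw using Submodule.iSup_induction' with
      | mem i x hx => exact h i i.2 x hx
      | zero => simp
      | add x y _ _ hx hy => rw [inner_add_left, hx, hy, add_zero]
  have hXE : ∀ ν, ∀ w ∈ E ν, w = ((ν + k : ℝ) : ℂ) • X w := fun ν w hw =>
    eq_smul_perturbedInverse_of_mem hE hR hθ hw
  have hXW : ∀ x ∈ W.orthogonal, X x ∈ W.orthogonal := by
    intro x hx
    rw [horth] at hx ⊢
    intro ν hν w hw
    have h1 := hXE ν w hw
    rw [← hXs']
    by_cases h0 : ν + k = 0
    · rw [h0] at h1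
      simp only [Complex.ofReal_zero, zero_smul] at h1
      rw [h1]; simp
    · have h2 : ((ν + k : ℝ) : ℂ) ≠ 0 := by exact_mod_cast h0
      have h3 := hx ν hν w hw
      rw [h1, inner_smul_left] at h3
      exact (mul_eq_zero.mp h3).resolve_left (by simpa using h2)
  -- With f = Su this is y = (N + k)u, so u = Xy.
  set y := f - q u + (k : ℂ) • u with hy
  have huy : u = X y := by
    apply eq_perturbedInverse hθ
    rw [hy]
    have h1 := hR f
    rw [← hu] at h1
    have h2 : q u + (f - q u + (k : ℂ) • u) = f + (k : ℂ) • u := by abel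
    rw [h2]
    exact h1
  have hyW : y ∈ W.orthogonal := by
    rw [horth] at huW ⊢
    intro ν hν w hw
    rw [hXE ν w hw, inner_smul_left, hXs', ← huy, huW ν hν w hw, mul_zero]
  -- If X exceeded k⁻¹ on the complement of W it would have an eigenvalue M > k⁻¹ there, hence N the
  -- eigenvalue M⁻¹ − k < 0 with an eigenvector orthogonal to all such eigenvectors.
  have hform : ∀ x ∈ W.orthogonal, RCLike.re (inner ℂ (X x) x) ≤ k⁻¹ * ‖x‖ ^ 2 := by
    intro x hx
    by_contra! hcon
    obtain ⟨M, hM, v, hv, hv0, hXv⟩ := exists_eigenvector_gt_of_form_gt (X := X) (Y := Z * Z)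
      (Z := Z * Z * q * X) hXs (fun x => by
        simpa only [mul_apply_eq_comp] using perturbedInverse_apply hθ x)
      (hc.comp_clm X) ha (fun x => by
        rw [mul_apply_eq_comp, hZ', inner_self_eq_norm_sq]; exact hZa x)
      (Submodule.isClosed_orthogonal _) hXW hx hcon
    have hM0 : 0 < M := (inv_pos.mpr hk).trans hM
    have h1 := mem_of_perturbedInverse_eq_smul hE hR hθ hk ha0 ha hZa hM0.ne' hXv
    have h2 : M⁻¹ - k < 0 := by
      rw [sub_neg]
      exact inv_lt_of_inv_lt₀ hk hM
    have h3 := (horth v).mp hv _ h2 v h1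
    exact hv0 (inner_self_eq_zero.mp h3)
  -- The bound k‖Xy‖² ≤ ⟨Xy, y⟩ reads k‖u‖² ≤ ⟨Nu, u⟩ + k‖u‖².
  have hfin := norm_sq_le_mul_re_inner_of_nonneg hXs hXW
    (fun x _ => perturbedInverse_nonneg hZ hθ x) (inv_pos.mpr hk) hform hyW
  rw [← hX, ← huy, le_inv_mul_iff₀ hk] at hfin
  have h1 : RCLike.re (inner ℂ u y) = RCLike.re (inner ℂ (f - q u) u) + k * ‖u‖ ^ 2 := by
    rw [hy, inner_add_right, inner_smul_right, map_add]
    congr 1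
    · rw [← inner_conj_symm, RCLike.conj_re]
    · have := inner_self_eq_norm_sq (𝕜 := ℂ) u
      rw [← this]
      simp
  rw [h1] at hfin
  linarith

/-- A Birman-Schwinger principle: with `N = P⁻² - q` and `E ν` its eigenspaces, the number of negative
eigenvalues of `N` is the number of eigenvalues above `1` of `P q P`. -/
theorem finrank_iSup_eigenspaces_eq_card (hP : (P : H →ₗ[ℂ] H).IsSymmetric)
    (hZ : (Z : H →ₗ[ℂ] H).IsSymmetric)
    (hq : (q : H →ₗ[ℂ] H).IsSymmetric) (hE : ∀ ν u, u ∈ E ν ↔ u = P (P (q u + (ν : ℂ) • u)))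
    (hR : ∀ f, P (P f) = Z (Z (f + (k : ℂ) • P (P f)))) (hθ : ‖Z * q * Z‖ < 1)
    (hk : 0 < k) (ha0 : 0 ≤ a) (ha : a < k⁻¹) (hZa : ∀ x, ‖Z x‖ ^ 2 ≤ a * ‖x‖ ^ 2)
    (hc : IsCompactOperator (Z * Z * q)) {ι : Type*} [Fintype ι] {e : ι → H} {μ : ι → ℝ}
    (he : Orthonormal ℂ e) (heT : ∀ i, P (q (P (e i))) = (μ i : ℂ) • e i) (hμ : ∀ i, 1 < μ i)
    (hle : ∀ x, (∀ i, inner ℂ (e i) x = 0) → RCLike.re (inner ℂ (P (q (P x))) x) ≤ ‖x‖ ^ 2) :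
    Module.finrank ℂ (⨆ ν : {ν : ℝ // ν < 0}, E ν : Submodule ℂ H) = Fintype.card ι := by
  classical
  set W : Submodule ℂ H := ⨆ ν : {ν : ℝ // ν < 0}, E ν with hW
  have hP' : ∀ a b, inner ℂ (P a) b = inner ℂ a (P b) := fun a b => hP a b
  have hμc : ∀ i, (μ i : ℂ) ≠ 0 := fun i => by
    have := hμ i
    exact_mod_cast (by linarith : μ i ≠ 0)
  have hform : ∀ f, RCLike.re (inner ℂ (f - q (P (P f))) (P (P f)))
      = ‖P f‖ ^ 2 - RCLike.re (inner ℂ (P (q (P (P f)))) (P f)) := by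
    intro f
    rw [inner_sub_left, map_sub, ← hP', inner_self_eq_norm_sq, hP' (q (P (P f)))]
  -- Upper bound for dim W. If w = P(Pf) in W is killed by L, then Pf is orthogonal to every `e i`,
  -- so the form of N at w is nonnegative; on W this forces w = 0.
  let L : W →ₗ[ℂ] (ι → ℂ) := LinearMap.pi fun i =>
    ((innerSL ℂ (q (P (e i)))) : H →ₗ[ℂ] ℂ) ∘ₗ W.subtype
  have hL : Function.Injective L := by
    rw [← LinearMap.ker_eq_bot, LinearMap.ker_eq_bot']
    rintro ⟨w, hw⟩ h0
    have h1 : ∀ i, inner ℂ (q (P (e i))) w = 0 := fun i => congrFun h0 i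
    obtain ⟨f, hf, hf'⟩ := exists_form_neg_of_mem_iSup hP hq hE hw
    have h2 : ∀ i, inner ℂ (e i) (P f) = 0 := by
      intro i
      have h3 : inner ℂ ((μ i : ℂ) • e i) (P f) = 0 := by rw [← heT, hP', ← hf, h1]
      rw [inner_smul_left, mul_eq_zero] at h3
      exact h3.resolve_left (by simpa using hμc i)
    have h3 := hle _ h2
    have h4 := hform f
    rw [← hf] at h4
    rw [← hf] at h3
    exact Subtype.ext (hf' (by rw [h4]; linarith))
  have hfd : FiniteDimensional ℂ W := FiniteDimensional.of_injective L hL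
  refine le_antisymm ?_ ?_
  · simpa using LinearMap.finrank_le_finrank_of_injective hL
  · let F : (ι → ℂ) →ₗ[ℂ] H := Fintype.linearCombination ℂ fun i => P (e i)
    let G : (ι → ℂ) →ₗ[ℂ] W := (W.orthogonalProjectionOnto : H →ₗ[ℂ] W) ∘ₗ F
    have hG : Function.Injective G := by
      rw [← LinearMap.ker_eq_bot, LinearMap.ker_eq_bot']
      intro c hc0
      have h1 : F c ∈ W.orthogonal := by
        rw [← Submodule.orthogonalProjectionOnto_eq_zero_iff]
        exact hc0
      set ζ : H := ∑ i, c i • e i with hζ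
      have hFc : F c = P ζ := by
        rw [hζ, map_sum]
        simp only [F, Fintype.linearCombination_apply, map_smul]
      -- Each `e i` equals μᵢ⁻¹ P q P eᵢ, so ζ lies in the range of P and Pζ in the range of P²,
      -- where the form is available.
      set f : H := q (P (∑ i, (c i * (μ i : ℂ)⁻¹) • e i)) with hf
      have hPf : P f = ζ := by
        rw [hf, hζ]
        simp only [map_sum, map_smul, heT, smul_smul]
        exact Finset.sum_congr rfl fun i _ => by rw [mul_assoc, inv_mul_cancel₀ (hμc i), mul_one]
      have h2 := form_nonneg_of_orthogonal hZ hq hE hR hθ hk ha0 ha hZa hc (f := f) (u := F c)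
        (by rw [hFc, hPf]) h1
      rw [hFc, ← hPf, hform, hPf] at h2
      have h3 : ‖ζ‖ ^ 2 = ∑ i, ‖c i‖ ^ 2 := by
        rw [← inner_self_eq_norm_sq (𝕜 := ℂ), hζ, he.inner_sum, map_sum]
        refine Finset.sum_congr rfl fun i _ => ?_
        rw [mul_comm, RCLike.mul_conj]
        norm_cast
      have h4 : RCLike.re (inner ℂ (P (q (P ζ))) ζ) = ∑ i, μ i * ‖c i‖ ^ 2 := by
        have h5 : P (q (P ζ)) = ∑ i, (c i * (μ i : ℂ)) • e i := by
          rw [hζ]; simp only [map_sum, map_smul, heT, smul_smul]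
        rw [h5, hζ, he.inner_sum, map_sum]
        refine Finset.sum_congr rfl fun i _ => ?_
        have h6 : (starRingEnd ℂ) (c i * (μ i : ℂ)) * c i = ((μ i * ‖c i‖ ^ 2 : ℝ) : ℂ) := by
          rw [map_mul, Complex.conj_ofReal, mul_right_comm, mul_comm _ (c i), RCLike.mul_conj]
          push_cast
          exact mul_comm _ _
        rw [h6]
        exact Complex.ofReal_re _
      rw [h3, h4, ← Finset.sum_sub_distrib] at h2
      have h5 : ∀ i ∈ Finset.univ, ‖c i‖ ^ 2 - μ i * ‖c i‖ ^ 2 ≤ 0 := fun i _ => by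
        nlinarith [hμ i, sq_nonneg ‖c i‖]
      have h6 := (Finset.sum_eq_zero_iff_of_nonpos h5).mp
        (le_antisymm (Finset.sum_nonpos h5) h2)
      ext i
      have h7 := h6 i (Finset.mem_univ i)
      have h8 : (1 - μ i) * ‖c i‖ ^ 2 = 0 := by linarith
      rw [mul_eq_zero, or_iff_right (by linarith [hμ i] : 1 - μ i ≠ 0)] at h8
      simpa using h8
    simpa using LinearMap.finrank_le_finrank_of_injective hG

end NegativeIndex

noncomputable section

/-! ### Bounded multiplication operators and Fourier multipliers on L². -/

section Multiplication

/-- Multiplication by an essentially bounded function on `L²` (and `0` for other functions). -/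
def bmul (m : ℝ → ℂ) : L2C →L[ℂ] L2C :=
  open Classical in
  if h : MemLp m ∞ (volume : Measure ℝ) then
    (ContinuousLinearMap.lsmul ℂ ℂ).holderL volume ∞ 2 2 (h.toLp m) else 0

theorem coeFn_bmul {m : ℝ → ℂ} (h : MemLp m ∞ volume) (u : L2C) :
    bmul m u =ᵐ[volume] fun x => m x * u x := by
  rw [bmul, dif_pos h]
  refine ((ContinuousLinearMap.lsmul ℂ ℂ).coeFn_holder (r := 2) (h.toLp m) u).trans ?_
  filter_upwards [h.coeFn_toLp] with x hx
  simp [hx]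

theorem memLp_top_of_bound' {m : ℝ → ℂ} (hm : Continuous m) {C : ℝ} (hC : ∀ x, ‖m x‖ ≤ C) :
    MemLp m ∞ (volume : Measure ℝ) :=
  memLp_top_of_bound hm.aestronglyMeasurable C (Eventually.of_forall hC)

theorem bmul_bmul {m n : ℝ → ℂ} (hm : MemLp m ∞ volume) (hn : MemLp n ∞ volume)
    (hmn : MemLp (fun x => m x * n x) ∞ volume) (u : L2C) :
    bmul m (bmul n u) = bmul (fun x => m x * n x) u := by
  refine Lp.ext ?_
  filter_upwards [coeFn_bmul hm (bmul n u), coeFn_bmul hn u, coeFn_bmul hmn u] with x h1 h2 h3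
  rw [h1, h2, h3, mul_assoc]

theorem bmul_one (u : L2C) : bmul (fun _ => 1) u = u := by
  refine Lp.ext ?_
  filter_upwards [coeFn_bmul (m := fun _ => 1)
    (memLp_top_of_bound' continuous_const (C := 1) (by simp)) u] with x h1
  rw [h1, one_mul]

theorem norm_bmul_le {m : ℝ → ℂ} (h : MemLp m ∞ volume) {C : ℝ} (hC : ∀ᵐ x, ‖m x‖ ≤ C)
    (u : L2C) : ‖bmul m u‖ ≤ C * ‖u‖ := by
  refine Lp.norm_le_mul_norm_of_ae_le_mul ?_
  filter_upwards [coeFn_bmul h u, hC] with x h1 h2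
  rw [h1, norm_mul]
  gcongr

theorem inner_bmul_left {m : ℝ → ℂ} (h : MemLp m ∞ volume) (h' : MemLp (fun x => star (m x)) ∞ volume)
    (u v : L2C) : inner ℂ (bmul m u) v = inner ℂ u (bmul (fun x => star (m x)) v) := by
  rw [L2.inner_def, L2.inner_def]
  refine integral_congr_ae ?_
  filter_upwards [coeFn_bmul h u, coeFn_bmul h' v] with x h1 h2
  rw [h1, h2]
  simp only [RCLike.inner_apply, map_mul, RCLike.star_def]
  ring

theorem memLp_top_star {m : ℝ → ℂ} (h : MemLp m ∞ (volume : Measure ℝ)) :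
    MemLp (fun x => star (m x)) ∞ volume := h.star

theorem memLp_top_mul {m n : ℝ → ℂ} (hm : MemLp m ∞ (volume : Measure ℝ))
    (hn : MemLp n ∞ volume) : MemLp (fun x => m x * n x) ∞ volume := hn.mul hm

/-- The Fourier transform on `L²`. -/
abbrev FT : L2C ≃ₗᵢ[ℂ] L2C := Lp.fourierTransformₗᵢ ℝ ℂ

/-- The Fourier multiplier with essentially bounded symbol `m` (in the variable of `𝓕`). -/
def fmul (m : ℝ → ℂ) : L2C →L[ℂ] L2C :=
  (FT.symm.toContinuousLinearEquiv : L2C →L[ℂ] L2C) ∘L bmul m ∘L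
    (FT.toContinuousLinearEquiv : L2C →L[ℂ] L2C)

theorem fmul_apply (m : ℝ → ℂ) (u : L2C) : fmul m u = FT.symm (bmul m (FT u)) := rfl

theorem FT_fmul (m : ℝ → ℂ) (u : L2C) : FT (fmul m u) = bmul m (FT u) := by
  rw [fmul_apply, LinearIsometryEquiv.apply_symm_apply]

theorem coeFn_FT_fmul {m : ℝ → ℂ} (h : MemLp m ∞ volume) (u : L2C) :
    FT (fmul m u) =ᵐ[volume] fun x => m x * FT u x := by
  rw [FT_fmul]; exact coeFn_bmul h _

theorem fmul_fmul {m n : ℝ → ℂ} (hm : MemLp m ∞ volume) (hn : MemLp n ∞ volume) (u : L2C) :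
    fmul m (fmul n u) = fmul (fun x => m x * n x) u := by
  rw [fmul_apply, FT_fmul, bmul_bmul hm hn (memLp_top_mul hm hn), fmul_apply]

theorem norm_fmul_le {m : ℝ → ℂ} (h : MemLp m ∞ volume) {C : ℝ} (hC : ∀ᵐ x, ‖m x‖ ≤ C)
    (u : L2C) : ‖fmul m u‖ ≤ C * ‖u‖ := by
  rw [fmul_apply, LinearIsometryEquiv.norm_map]
  exact (norm_bmul_le h hC _).trans_eq (by rw [LinearIsometryEquiv.norm_map])

theorem inner_fmul_left {m : ℝ → ℂ} (h : MemLp m ∞ volume) (u v : L2C) :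
    inner ℂ (fmul m u) v = inner ℂ u (fmul (fun x => star (m x)) v) := by
  rw [← FT.inner_map_map, FT_fmul, inner_bmul_left h (memLp_top_star h), ← FT_fmul,
    FT.inner_map_map]

theorem L2C_ext_FT {u v : L2C} (h : FT u =ᵐ[volume] FT v) : u = v :=
  FT.injective (Lp.ext h)

end Multiplication

/-! ### The L² Fourier transform as an integral. -/

section FourierIntegral

theorem ae_eq_of_schwartz_integral_eq {f g : ℝ → ℂ} (hf : LocallyIntegrable f)
    (hg : LocallyIntegrable g) (h : ∀ φ : 𝓢(ℝ, ℂ), ∫ x, φ x • f x = ∫ x, φ x • g x) :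
    f =ᵐ[volume] g := by
  refine ae_eq_of_integral_contDiff_smul_eq hf hg fun φ hφ hc => ?_
  have hg₁ : HasCompactSupport (Complex.ofRealCLM ∘ φ) := hc.comp_left rfl
  have hg₂ : ContDiff ℝ ∞ (Complex.ofRealCLM ∘ φ) := by fun_prop
  simpa using h (hg₁.toSchwartzMap hg₂)

theorem continuous_fourier_of_integrable {f : ℝ → ℂ} (hf : Integrable f) : Continuous (𝓕 f) :=
  VectorFourier.fourierIntegral_continuous Real.continuous_fourierChar continuous_inner hf

theorem continuous_fourierInv_of_integrable {f : ℝ → ℂ} (hf : Integrable f) :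
    Continuous (𝓕⁻ f) := by
  have : 𝓕⁻ f = fun x => 𝓕 f (-x) := funext fun x => Real.fourierInv_eq_fourier_neg f x
  rw [this]
  exact (continuous_fourier_of_integrable hf).comp continuous_neg

theorem locallyIntegrable_L2C (u : L2C) : LocallyIntegrable u :=
  (Lp.memLp u).locallyIntegrable (by norm_num)

/-- Both sides are tested against Schwartz functions: the L² transform by its compatibility with
tempered distributions, the integral by the exchange formula ∫ φ̂ f = ∫ φ f̂. -/
theorem FT_toLp_ae_eq {f : ℝ → ℂ} (h1 : Integrable f) (h2 : MemLp f 2) :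
    FT (h2.toLp f) =ᵐ[volume] 𝓕 f := by
  refine ae_eq_of_schwartz_integral_eq (locallyIntegrable_L2C _)
    (continuous_fourier_of_integrable h1).locallyIntegrable fun φ => ?_
  have e1 : (Lp.toTemperedDistribution (FT (h2.toLp f)) : 𝓢'(ℝ, ℂ)) φ
      = Lp.toTemperedDistribution (h2.toLp f) (𝓕 φ) := by
    rw [← TemperedDistribution.fourier_apply, Lp.fourier_toTemperedDistribution_eq]
    rfl
  rw [Lp.toTemperedDistribution_apply, Lp.toTemperedDistribution_apply] at e1
  rw [e1]
  have e2 : ∫ x, (𝓕 φ) x • h2.toLp f x = ∫ x, (𝓕 (φ : ℝ → ℂ)) x • f x := by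
    refine integral_congr_ae ?_
    filter_upwards [h2.coeFn_toLp] with x hx
    rw [hx, SchwartzMap.fourier_coe]
  rw [e2]
  exact VectorFourier.integral_fourierIntegral_smul_eq_flip (L := innerₗ ℝ)
    Real.continuous_fourierChar continuous_inner φ.integrable h1 |>.trans (by
      rw [flip_innerₗ]; rfl)

theorem FT_symm_toLp_ae_eq {f : ℝ → ℂ} (h1 : Integrable f) (h2 : MemLp f 2) :
    FT.symm (h2.toLp f) =ᵐ[volume] 𝓕⁻ f := by
  refine ae_eq_of_schwartz_integral_eq (locallyIntegrable_L2C _)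
    (continuous_fourierInv_of_integrable h1).locallyIntegrable fun φ => ?_
  have e1 : (Lp.toTemperedDistribution (FT.symm (h2.toLp f)) : 𝓢'(ℝ, ℂ)) φ
      = Lp.toTemperedDistribution (h2.toLp f) (𝓕⁻ φ) := by
    rw [← TemperedDistribution.fourierInv_apply, Lp.fourierInv_toTemperedDistribution_eq]
    rfl
  rw [Lp.toTemperedDistribution_apply, Lp.toTemperedDistribution_apply] at e1
  rw [e1]
  have e2 : ∫ x, (𝓕⁻ φ) x • h2.toLp f x = ∫ x, (𝓕⁻ (φ : ℝ → ℂ)) x • f x := by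
    refine integral_congr_ae ?_
    filter_upwards [h2.coeFn_toLp] with x hx
    rw [hx, SchwartzMap.fourierInv_coe]
  rw [e2]
  exact VectorFourier.integral_fourierIntegral_smul_eq_flip (L := -innerₗ ℝ)
    Real.continuous_fourierChar continuous_inner.neg φ.integrable h1 |>.trans (by
      have : (-innerₗ ℝ).flip = -innerₗ ℝ := by
        ext; simp
      rw [this]; rfl)

end FourierIntegral

end

noncomputable section

/-! ### Conjugation, and real operators inside complex L². -/

section Reality

/-- Complex conjugation on `L²`. -/
def conjL : L2C →L[ℝ] L2C := (Complex.conjCLE : ℂ →L[ℝ] ℂ).compLpL 2 volume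

/-- The real part, as a map `L²(ℝ; ℂ) → L²(ℝ; ℝ)`. -/
def reL : L2C →L[ℝ] L2R := Complex.reCLM.compLpL 2 volume

/-- `complexify` as a continuous linear map. -/
def complexifyL : L2R →L[ℝ] L2C := Complex.ofRealCLM.compLpL 2 volume

theorem coeFn_conjL (u : L2C) : conjL u =ᵐ[volume] fun x => star (u x) :=
  (ContinuousLinearMap.coeFn_compLpL _ _).trans (Eventually.of_forall fun _ => rfl)

theorem coeFn_reL (u : L2C) : reL u =ᵐ[volume] fun x => (u x).re :=
  (ContinuousLinearMap.coeFn_compLpL _ _).trans (Eventually.of_forall fun _ => rfl)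

theorem coeFn_complexify (u : L2R) : complexify u =ᵐ[volume] fun x => (u x : ℂ) :=
  (ContinuousLinearMap.coeFn_compLpL _ _).trans (Eventually.of_forall fun _ => rfl)

theorem reL_complexify (u : L2R) : reL (complexify u) = u := by
  refine Lp.ext ?_
  filter_upwards [coeFn_reL (complexify u), coeFn_complexify u] with x h1 h2
  rw [h1, h2, Complex.ofReal_re]

theorem complexify_injective : Function.Injective complexify :=
  Function.LeftInverse.injective reL_complexify

theorem conjL_complexify (u : L2R) : conjL (complexify u) = complexify u := by
  refine Lp.ext ?_
  filter_upwards [coeFn_conjL (complexify u), coeFn_complexify u] with x h1 h2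
  rw [h1, h2]; simp

theorem complexify_reL {u : L2C} (h : conjL u = u) : complexify (reL u) = u := by
  refine Lp.ext ?_
  have h0 := coeFn_conjL u
  rw [h] at h0
  filter_upwards [coeFn_complexify (reL u), coeFn_reL u, h0] with x h1 h2 h3
  rw [h1, h2]
  exact (Complex.conj_eq_iff_re.mp h3.symm)

theorem inner_complexify (u v : L2R) :
    inner ℂ (complexify u) (complexify v) = ((inner ℝ u v : ℝ) : ℂ) := by
  rw [L2.inner_def, L2.inner_def]
  refine Eq.trans ?_ (integral_ofReal (𝕜 := ℂ))
  refine integral_congr_ae ?_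
  filter_upwards [coeFn_complexify u, coeFn_complexify v] with x h1 h2
  rw [h1, h2]
  simp

theorem norm_complexify (u : L2R) : ‖complexify u‖ = ‖u‖ := by
  have h := inner_complexify u u
  rw [inner_self_eq_norm_sq_to_K, real_inner_self_eq_norm_sq] at h
  have h' : ‖complexify u‖ ^ 2 = ‖u‖ ^ 2 := Complex.ofReal_injective (by
    push_cast at h ⊢; exact h)
  exact (sq_eq_sq₀ (norm_nonneg _) (norm_nonneg _)).mp h'

theorem complexify_sub (u v : L2R) : complexify (u - v) = complexify u - complexify v :=
  complexifyL.map_sub u v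

theorem complexify_neg (u : L2R) : complexify (-u) = -complexify u :=
  complexifyL.map_neg u

theorem complexify_zero : complexify 0 = 0 := complexifyL.map_zero

theorem complexify_smul (a : ℝ) (u : L2R) : complexify (a • u) = (a : ℂ) • complexify u := by
  rw [Complex.coe_smul]; exact complexifyL.map_smul a u

/-- The imaginary part is expressed as Im z = −Re(iz), so `reL` alone suffices. -/
theorem eq_complexify_add (z : L2C) :
    z = complexify (reL z) + Complex.I • complexify (-reL (Complex.I • z)) := by
  refine Lp.ext ?_
  filter_upwards [coeFn_complexify (reL z), coeFn_reL z, coeFn_reL (Complex.I • z),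
    Lp.coeFn_neg (reL (Complex.I • z)), coeFn_complexify (-reL (Complex.I • z)),
    Lp.coeFn_smul Complex.I z,
    Lp.coeFn_smul Complex.I (complexify (-reL (Complex.I • z))),
    Lp.coeFn_add (complexify (reL z)) (Complex.I • complexify (-reL (Complex.I • z)))]
    with x h1 h2 h3 h4 h5 h6 h7 h8
  rw [h8, Pi.add_apply, h7, Pi.smul_apply, h5, h4, Pi.neg_apply, h3, h6, h1, h2]
  apply Complex.ext <;> simp

/-- The real operator induced by an operator which commutes with conjugation. -/
def realOp (A : L2C →L[ℂ] L2C) : L2R →L[ℝ] L2R :=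
  reL ∘L (A.restrictScalars ℝ) ∘L complexifyL

theorem complexify_realOp {A : L2C →L[ℂ] L2C} (hA : ∀ u, conjL (A u) = A (conjL u)) (u : L2R) :
    complexify (realOp A u) = A (complexify u) := by
  have h : conjL (A (complexify u)) = A (complexify u) := by rw [hA, conjL_complexify]
  exact complexify_reL h

theorem norm_realOp_le {A : L2C →L[ℂ] L2C} (hA : ∀ u, conjL (A u) = A (conjL u)) {C : ℝ} (hC0 : 0 ≤ C)
    (hC : ∀ u, ‖A u‖ ≤ C * ‖u‖) : ‖realOp A‖ ≤ C := by
  refine ContinuousLinearMap.opNorm_le_bound _ hC0 fun u => ?_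
  rw [← norm_complexify, complexify_realOp hA, ← norm_complexify u]
  exact hC _

/-- Reflection on `L²`. -/
def reflL : L2C →ₗᵢ[ℂ] L2C :=
  Lp.compMeasurePreservingₗᵢ ℂ (fun x : ℝ => -x) (Measure.measurePreserving_neg volume)

theorem coeFn_reflL (u : L2C) : reflL u =ᵐ[volume] fun x => u (-x) :=
  Lp.coeFn_compMeasurePreserving u (Measure.measurePreserving_neg volume)

theorem ae_neg {p : ℝ → Prop} (h : ∀ᵐ x : ℝ, p x) : ∀ᵐ x : ℝ, p (-x) :=
  (Measure.measurePreserving_neg (volume : Measure ℝ)).quasiMeasurePreserving.ae h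

theorem fourier_star (f : ℝ → ℂ) (ξ : ℝ) : 𝓕 (fun x => star (f x)) ξ = star (𝓕 f (-ξ)) := by
  rw [Real.fourier_eq, Real.fourier_eq, RCLike.star_def, ← integral_conj]
  refine integral_congr_ae (Eventually.of_forall fun x => ?_)
  simp only [Circle.smul_def, smul_eq_mul, map_mul]
  congr 1
  rw [← Circle.coe_inv_eq_conj, ← AddChar.map_neg_eq_inv]
  simp

/-- Both sides are continuous in u, so it suffices to treat Schwartz functions, for which the
integral formula applies. -/
theorem FT_conjL (u : L2C) : FT (conjL u) = reflL (conjL (FT u)) := by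
  refine DenseRange.induction_on (p := fun u => FT (conjL u) = reflL (conjL (FT u)))
    (SchwartzMap.denseRange_toLpCLM (E := ℝ) (F := ℂ) (μ := (volume : Measure ℝ)) (p := 2)
      ENNReal.ofNat_ne_top) u ?_ fun f => ?_
  · exact isClosed_eq (FT.continuous.comp conjL.continuous)
      (reflL.continuous.comp (conjL.continuous.comp FT.continuous))
  · change FT (conjL (f.toLp 2)) = reflL (conjL (FT (f.toLp 2)))
    have h1 : Integrable (fun x => star (f x)) :=
      (Complex.conjCLE : ℂ →L[ℝ] ℂ).integrable_comp f.integrable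
    have h2 : MemLp (fun x => star (f x)) 2 := (f.memLp 2 volume).star
    have h3 : conjL (f.toLp 2) = h2.toLp _ := by
      refine Lp.ext ?_
      filter_upwards [coeFn_conjL (f.toLp 2), f.coeFn_toLp 2 volume, h2.coeFn_toLp] with x a b c
      rw [a, b, c]
    have h4 : f.toLp 2 = (f.memLp 2 volume).toLp f := rfl
    have h5 := FT_toLp_ae_eq f.integrable (f.memLp 2 volume)
    rw [← h4] at h5
    refine Lp.ext ?_
    rw [h3]
    filter_upwards [FT_toLp_ae_eq h1 h2, coeFn_reflL (conjL (FT (f.toLp 2))),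
      ae_neg (coeFn_conjL (FT (f.toLp 2))), ae_neg h5] with x a b c d
    rw [a, b, c, d, fourier_star]

/-- Hermitian symbols are those whose multipliers preserve real functions. For the wave this is
where evenness of β enters. -/
theorem conjL_fmul {m : ℝ → ℂ} (hm : MemLp m ∞ volume) (hs : ∀ x, m (-x) = star (m x)) (u : L2C) :
    conjL (fmul m u) = fmul m (conjL u) := by
  apply L2C_ext_FT
  rw [FT_conjL]
  have h1 := coeFn_FT_fmul hm (conjL u)
  rw [FT_conjL] at h1
  filter_upwards [h1, coeFn_reflL (conjL (FT (fmul m u))), ae_neg (coeFn_conjL (FT (fmul m u))),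
    ae_neg (coeFn_FT_fmul hm u), coeFn_reflL (conjL (FT u)), ae_neg (coeFn_conjL (FT u))]
    with x h1 h2 h3 h4 h5 h6
  rw [h1, h2, h3, h4, h5, h6, star_mul', hs, star_star]

theorem conjL_bmul_ofReal {m : ℝ → ℝ} (hm : MemLp (fun x => (m x : ℂ)) ∞ volume) (u : L2C) :
    conjL (bmul (fun x => (m x : ℂ)) u) = bmul (fun x => (m x : ℂ)) (conjL u) := by
  refine Lp.ext ?_
  filter_upwards [coeFn_conjL (bmul (fun x => (m x : ℂ)) u), coeFn_bmul hm u, coeFn_conjL u,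
    coeFn_bmul hm (conjL u)] with x h1 h2 h3 h4
  rw [h1, h2, h4, h3]
  simp

end Reality
end

noncomputable section

/-! ### Compactness of q(x)m(D) for q and m vanishing at infinity. -/

section Compactness

theorem integral_norm_mul_norm_le (k h : L2C) :
    Integrable (fun x => ‖k x‖ * ‖h x‖) ∧ ∫ x, ‖k x‖ * ‖h x‖ ≤ ‖k‖ * ‖h‖ := by
  have hk : MemLp (fun x => ‖k x‖) 2 volume := (Lp.memLp k).norm
  have hh : MemLp (fun x => ‖h x‖) 2 volume := (Lp.memLp h).norm
  refine ⟨hk.integrable_mul hh, ?_⟩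
  have h1 := real_inner_le_norm (hh.toLp _) (hk.toLp _)
  rw [L2.inner_def, Lp.norm_toLp, Lp.norm_toLp, eLpNorm_norm, eLpNorm_norm, mul_comm] at h1
  rw [Lp.norm_def, Lp.norm_def]
  refine le_of_eq_of_le (integral_congr_ae ?_) h1
  filter_upwards [hk.coeFn_toLp, hh.coeFn_toLp] with x a b
  rw [a, b]
  simp

/-- Cauchy–Schwarz against the indicator of the interval. -/
theorem integrable_of_eq_zero_off {B : ℝ} {h : L2C}
    (hB : ∀ᵐ x, x ∉ Icc (-B) B → h x = 0) :
    Integrable h ∧ ∫ x, ‖h x‖ ≤ ‖(indicatorConstLp 2 (measurableSet_Icc (a := -B) (b := B))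
      (by simp) (1 : ℂ) : L2C)‖ * ‖h‖ := by
  set k : L2C := indicatorConstLp 2 (measurableSet_Icc (a := -B) (b := B)) (by simp) (1 : ℂ)
  have e : (fun x => ‖k x‖ * ‖h x‖) =ᵐ[volume] fun x => ‖h x‖ := by
    filter_upwards [hB, (indicatorConstLp_coeFn : k =ᵐ[volume] _)] with x h1 h2
    by_cases hx : x ∈ Icc (-B) B
    · rw [h2, indicator_of_mem hx, norm_one, one_mul]
    · rw [h1 hx, norm_zero, mul_zero]
  obtain ⟨h1, h2⟩ := integral_norm_mul_norm_le k h
  rw [integral_congr_ae e] at h2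
  exact ⟨(integrable_norm_iff (Lp.aestronglyMeasurable h)).mp (h1.congr e), h2⟩

/-- The condition 2A ≤ N keeps the ratio of consecutive tail terms below 1/2, so the tail is at most
twice its first term. -/
theorem norm_exp_sub_sum_le {z : ℂ} {A : ℝ} (hz : ‖z‖ ≤ A) {N : ℕ} (hN : 2 * A ≤ N) :
    ‖Complex.exp z - ∑ n ∈ Finset.range N, z ^ n / n.factorial‖ ≤ A ^ N / N.factorial * 2 := by
  refine (Complex.exp_bound' ?_).trans ?_
  · rw [div_le_div_iff₀ (by positivity) (by norm_num)]
    push_cast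
    linarith
  · gcongr

/-- For x and ξ in [−B, B] the kernel e^{2πixξ} is the uniform limit of its Taylor polynomials,
which are finite sums of products of a function of x and a function of ξ. The operator is thus a
norm limit of operators of finite rank. -/
theorem isCompactOperator_bmul_fmul_of_support {q m : ℝ → ℂ} (hq : MemLp q ∞ volume)
    (hm : MemLp m ∞ volume) {B : ℝ} (hB : 0 ≤ B) (hqB : ∀ x, x ∉ Icc (-B) B → q x = 0)
    (hmB : ∀ x, x ∉ Icc (-B) B → m x = 0) {C : ℝ} (hqC : ∀ᵐ x, ‖q x‖ ≤ C)
    (hmC : ∀ᵐ x, ‖m x‖ ≤ C) :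
    IsCompactOperator (bmul q ∘L fmul m) := by
  set k : L2C := indicatorConstLp 2 (measurableSet_Icc (a := -B) (b := B)) (by simp) (1 : ℂ) with hk
  have hkc : k =ᵐ[volume] _ := indicatorConstLp_coeFn
  have hC0 : 0 ≤ C := by
    obtain ⟨x, hx⟩ := hqC.exists
    exact (norm_nonneg _).trans hx
  have hbx : ∀ n : ℕ, ∀ a : ℂ, MemLp (fun x : ℝ => (Icc (-B) B).indicator (fun x => (a * x) ^ n) x) ∞ volume := by
    intro n a
    refine memLp_top_of_bound ?_ ((‖a‖ * B) ^ n) (Eventually.of_forall fun x => ?_)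
    · exact (Measurable.indicator (by fun_prop) measurableSet_Icc).aestronglyMeasurable
    · rw [indicator_apply]
      split_ifs with hx
      · rw [norm_pow, norm_mul]
        have : ‖(x : ℂ)‖ ≤ B := by
          rw [Complex.norm_real, Real.norm_eq_abs, abs_le]; exact hx
        gcongr
      · rw [norm_zero]; positivity
  -- The n-th Taylor term: `g n` is ξⁿ and `b n` is q(x)(2πix)ⁿ/n!, both cut off to [−B, B].
  let g : ℕ → L2C := fun n => bmul ((Icc (-B) B).indicator fun x => ((1 : ℂ) * x) ^ n) k
  let b : ℕ → L2C := fun n => ((n.factorial : ℂ)⁻¹) •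
    bmul q (bmul ((Icc (-B) B).indicator fun x => ((2 * Real.pi * Complex.I) * x) ^ n) k)
  let K : ℕ → L2C →L[ℂ] L2C := fun N => ∑ n ∈ Finset.range N,
    ((innerSL ℂ (g n)).smulRight (b n)) ∘L (bmul m ∘L (FT.toContinuousLinearEquiv : L2C →L[ℂ] L2C))
  have hK : ∀ N, IsCompactOperator (K N) := by
    intro N
    change K N ∈ compactOperator (RingHom.id ℂ) L2C L2C
    refine Submodule.sum_mem _ fun n _ => ?_
    have : IsCompactOperator ((ContinuousLinearMap.toSpanSingleton ℂ (b n)) ∘L (innerSL ℂ (g n))) :=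
      (isCompactOperator_of_locallyCompactSpace_rng
        (ContinuousLinearMap.toSpanSingleton ℂ (b n))).comp_clm (innerSL ℂ (g n))
    exact this.comp_clm _
  have hg : ∀ h : L2C, (∀ᵐ x, x ∉ Icc (-B) B → h x = 0) → ∀ n,
      inner ℂ (g n) h = ∫ ξ : ℝ, (ξ : ℂ) ^ n * h ξ := by
    intro h hh n
    rw [L2.inner_def]
    refine integral_congr_ae ?_
    filter_upwards [coeFn_bmul (hbx n 1) k, hkc, hh] with x h1 h2 h3
    rw [h1, h2]
    by_cases hx : x ∈ Icc (-B) B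
    · simp [indicator_of_mem hx, mul_comm]
    · simp [h3 hx]
  have herr : ∀ N : ℕ, 2 * (2 * Real.pi * B * B) ≤ N → ∀ u,
      ‖(bmul q ∘L fmul m) u - K N u‖ ≤
        (C * ((2 * Real.pi * B * B) ^ N / N.factorial * 2) * (‖k‖ * C) * ‖k‖) * ‖u‖ := by
    intro N hN u
    set h := bmul m (FT u) with hh
    have hhB : ∀ᵐ x, x ∉ Icc (-B) B → h x = 0 := by
      filter_upwards [coeFn_bmul hm (FT u)] with x h1 hx
      rw [hh, h1, hmB x hx, zero_mul]
    obtain ⟨hi, hin⟩ := integrable_of_eq_zero_off hhB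
    rw [← hk] at hin
    have hhn : ‖h‖ ≤ C * ‖u‖ :=
      (norm_bmul_le hm hmC (FT u)).trans_eq (by rw [LinearIsometryEquiv.norm_map])
    have hF : FT.symm h =ᵐ[volume] 𝓕⁻ (h : ℝ → ℂ) := by
      have := FT_symm_toLp_ae_eq hi (Lp.memLp h)
      rwa [Lp.toLp_coeFn] at this
    have hKu : K N u =ᵐ[volume] fun x => ∑ n ∈ Finset.range N,
        (∫ ξ : ℝ, (ξ : ℂ) ^ n * h ξ) * ((n.factorial : ℂ)⁻¹ * (q x * ((2 * Real.pi * Complex.I) * x) ^ n)) := by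
      have e : K N u = ∑ n ∈ Finset.range N, (∫ ξ : ℝ, (ξ : ℂ) ^ n * h ξ) • b n := by
        simp only [K, sum_apply]
        exact Finset.sum_congr rfl fun n _ => congrArg (· • b n) (hg h hhB n)
      have e2 : ∀ n, ((∫ ξ : ℝ, (ξ : ℂ) ^ n * h ξ) • b n : L2C) =ᵐ[volume] fun x =>
          (∫ ξ : ℝ, (ξ : ℂ) ^ n * h ξ) *
            ((n.factorial : ℂ)⁻¹ * (q x * ((2 * Real.pi * Complex.I) * x) ^ n)) := by
        intro n
        filter_upwards [Lp.coeFn_smul (∫ ξ : ℝ, (ξ : ℂ) ^ n * h ξ) (b n),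
          Lp.coeFn_smul ((n.factorial : ℂ)⁻¹) (bmul q (bmul ((Icc (-B) B).indicator fun x =>
            ((2 * Real.pi * Complex.I) * x) ^ n) k)),
          coeFn_bmul hq (bmul ((Icc (-B) B).indicator fun x : ℝ =>
            ((2 * Real.pi * Complex.I) * x) ^ n) k),
          coeFn_bmul (hbx n (2 * Real.pi * Complex.I)) k, hkc] with x h1 h2 h3 h4 h5
        rw [h1, Pi.smul_apply, h2, Pi.smul_apply, h3, h4, h5]
        by_cases hx : x ∈ Icc (-B) B
        · simp [indicator_of_mem hx]
        · simp [hqB x hx]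
      rw [e]
      refine (Lp.coeFn_finsetSum _ _).trans ?_
      filter_upwards [eventually_countable_forall.mpr e2] with x hx
      simp [hx]
    have key : ∀ᵐ x, ‖((bmul q ∘L fmul m) u - K N u : L2C) x‖
        ≤ (C * ((2 * Real.pi * B * B) ^ N / N.factorial * 2) * (‖k‖ * ‖h‖)) * ‖k x‖ := by
      filter_upwards [Lp.coeFn_sub ((bmul q ∘L fmul m) u) (K N u), hKu, coeFn_bmul hq (fmul m u),
        hF, hkc, hqC] with x h1 h2 h3 h4 h5 h6
      rw [h1, Pi.sub_apply, h2, ContinuousLinearMap.comp_apply, h3, fmul_apply, h4, h5]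
      by_cases hx : x ∈ Icc (-B) B
      · rw [indicator_of_mem hx, norm_one, mul_one]
        have hpow : ∀ n : ℕ, Integrable fun ξ : ℝ => (ξ : ℂ) ^ n * h ξ := by
          intro n
          refine (hi.norm.const_mul (B ^ n)).mono' ?_ ?_
          · exact (Continuous.aestronglyMeasurable (by fun_prop)).mul hi.1
          · filter_upwards [hhB] with ξ h7
            by_cases hξ : ξ ∈ Icc (-B) B
            · rw [norm_mul, norm_pow, Complex.norm_real, Real.norm_eq_abs]
              have a2 : |ξ| ≤ B := abs_le.mpr hξ
              gcongr
            · rw [h7 hξ]; simp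
        have e1 : q x * 𝓕⁻ (h : ℝ → ℂ) x - ∑ n ∈ Finset.range N, (∫ ξ : ℝ, (ξ : ℂ) ^ n * h ξ) *
              ((n.factorial : ℂ)⁻¹ * (q x * ((2 * Real.pi * Complex.I) * x) ^ n))
            = q x * ∫ ξ : ℝ, (Complex.exp (2 * Real.pi * Complex.I * x * ξ) - ∑ n ∈ Finset.range N,
              (2 * Real.pi * Complex.I * x * ξ) ^ n / n.factorial) * h ξ := by
          have e0 : 𝓕⁻ (h : ℝ → ℂ) x =
              ∫ ξ : ℝ, Complex.exp (2 * Real.pi * Complex.I * x * ξ) * h ξ := by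
            rw [Real.fourierInv_eq']
            refine integral_congr_ae (Eventually.of_forall fun ξ => ?_)
            simp only [smul_eq_mul]
            congr 2
            simp only [RCLike.inner_apply, conj_trivial, Complex.ofReal_mul]
            push_cast
            ring
          have i1 : Integrable fun ξ : ℝ => Complex.exp (2 * Real.pi * Complex.I * x * ξ) * h ξ := by
            refine hi.norm.mono' ((Continuous.aestronglyMeasurable (by fun_prop)).mul hi.1) ?_
            refine Eventually.of_forall fun ξ => ?_
            have : 2 * (Real.pi : ℂ) * Complex.I * x * ξ = ((2 * Real.pi * x * ξ : ℝ) : ℂ) * Complex.I := by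
              push_cast; ring
            rw [norm_mul, this, Complex.norm_exp_ofReal_mul_I, one_mul]
          simp only [sub_mul, Finset.sum_mul]
          rw [integral_sub i1, integral_finsetSum, e0, mul_sub, Finset.mul_sum]
          · congr 1
            refine Finset.sum_congr rfl fun n _ => ?_
            have : ∀ ξ : ℝ, (2 * (Real.pi : ℂ) * Complex.I * x * ξ) ^ n / n.factorial * h ξ
              = ((n.factorial : ℂ)⁻¹ * (2 * Real.pi * Complex.I * x) ^ n) * ((ξ : ℂ) ^ n * h ξ) := by
              intro ξ; ring
            simp only [this]
            rw [integral_const_mul]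
            ring
          · intro n _
            refine ((hpow n).const_mul ((n.factorial : ℂ)⁻¹ * (2 * Real.pi * Complex.I * x) ^ n)).congr ?_
            refine Eventually.of_forall fun ξ => ?_
            simp only
            ring
          · refine integrable_finsetSum _ fun n _ => ?_
            refine ((hpow n).const_mul ((n.factorial : ℂ)⁻¹ * (2 * Real.pi * Complex.I * x) ^ n)).congr ?_
            refine Eventually.of_forall fun ξ => ?_
            simp only
            ring
        rw [e1, norm_mul, mul_assoc C]
        refine mul_le_mul h6 ?_ (norm_nonneg _) hC0
        refine (norm_integral_le_of_norm_le (hi.norm.const_mul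
          ((2 * Real.pi * B * B) ^ N / N.factorial * 2)) ?_).trans ?_
        · filter_upwards [hhB] with ξ h7
          by_cases hξ : ξ ∈ Icc (-B) B
          · rw [norm_mul]
            gcongr
            refine norm_exp_sub_sum_le ?_ hN
            have a1 : |x| ≤ B := abs_le.mpr hx
            have a2 : |ξ| ≤ B := abs_le.mpr hξ
            have : ‖2 * (Real.pi : ℂ) * Complex.I * x * ξ‖ = 2 * Real.pi * |x| * |ξ| := by
              simp [abs_of_pos Real.pi_pos]
            rw [this]
            have := Real.pi_pos
            gcongr
          · rw [h7 hξ]; simp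
        · rw [integral_const_mul]
          gcongr
      · rw [hqB x hx, indicator_of_notMem hx]
        simp
    refine (Lp.norm_le_mul_norm_of_ae_le_mul key).trans ?_
    have : 0 ≤ C * ((2 * Real.pi * B * B) ^ N / N.factorial * 2) := by
      have := Real.pi_pos; positivity
    calc _ ≤ C * ((2 * Real.pi * B * B) ^ N / N.factorial * 2) * (‖k‖ * (C * ‖u‖)) * ‖k‖ := by gcongr
      _ = _ := by ring
  have hlim : Tendsto (fun N : ℕ => C * ((2 * Real.pi * B * B) ^ N / N.factorial * 2) * (‖k‖ * C) * ‖k‖)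
      atTop (𝓝 0) := by
    have := FloorSemiring.tendsto_pow_div_factorial_atTop (2 * Real.pi * B * B)
    simpa using (((this.mul_const 2).const_mul C).mul_const (‖k‖ * C)).mul_const ‖k‖
  refine isCompactOperator_of_tendsto (F := K) (l := atTop) ?_ (Eventually.of_forall hK)
  rw [tendsto_iff_norm_sub_tendsto_zero]
  refine squeeze_zero' (Eventually.of_forall fun _ => norm_nonneg _) ?_ hlim
  filter_upwards [eventually_ge_atTop ⌈2 * (2 * Real.pi * B * B)⌉₊] with N hN
  have := Real.pi_pos
  rw [norm_sub_rev]
  refine ContinuousLinearMap.opNorm_le_bound _ (by positivity) fun u => ?_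
  exact herr N (Nat.ceil_le.mp hN) u

theorem bmul_sub {m n : ℝ → ℂ} (hm : MemLp m ∞ volume) (hn : MemLp n ∞ volume) :
    bmul m - bmul n = bmul (fun x => m x - n x) := by
  ext1 u
  refine Lp.ext ?_
  filter_upwards [coeFn_bmul hm u, coeFn_bmul hn u, coeFn_bmul (hm.sub hn) u,
    Lp.coeFn_sub (bmul m u) (bmul n u)] with x h1 h2 h3 h4
  rw [sub_apply, h4, Pi.sub_apply, h1, h2]
  exact (sub_mul _ _ _).symm.trans h3.symm

theorem exists_ae_norm_le {m : ℝ → ℂ} (hm : MemLp m ∞ volume) : ∃ C : ℝ, ∀ᵐ x, ‖m x‖ ≤ C := by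
  refine ⟨(eLpNorm m ∞ volume).toReal, ?_⟩
  filter_upwards [ae_le_eLpNormEssSup (f := m) (μ := (volume : Measure ℝ))] with x hx
  rw [← eLpNorm_exponent_top] at hx
  have := ENNReal.toReal_mono hm.2.ne hx
  rwa [toReal_enorm] at this

theorem bmul_congr {m n : ℝ → ℂ} (h : m =ᵐ[volume] n) : bmul m = bmul n := by
  by_cases hm : MemLp m ∞ volume
  · ext1 u
    refine Lp.ext ?_
    filter_upwards [coeFn_bmul hm u, coeFn_bmul (hm.ae_eq h) u, h] with x h1 h2 h3
    rw [h1, h2, h3]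
  · rw [bmul, bmul, dif_neg hm, dif_neg fun h' => hm (h'.ae_eq h.symm)]

theorem tendsto_bmul_indicator {m : ℝ → ℂ} (hm : MemLp m ∞ volume)
    (h0 : Tendsto m (cocompact ℝ) (𝓝 0)) :
    Tendsto (fun n : ℕ => bmul ((Icc (-n : ℝ) n).indicator m)) atTop (𝓝 (bmul m)) := by
  rw [Metric.tendsto_atTop]
  intro ε hε
  have h1 : ∀ᶠ x in cocompact ℝ, ‖m x‖ ≤ ε / 2 := by
    have := (tendsto_zero_iff_norm_tendsto_zero.mp h0).eventually (gt_mem_nhds (half_pos hε))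
    exact this.mono fun x hx => hx.le
  obtain ⟨K, hK, hKm⟩ := mem_cocompact.mp h1
  obtain ⟨B, hB⟩ := hK.isBounded.subset_closedBall 0
  refine ⟨⌈B⌉₊, fun n hn => ?_⟩
  have hmn := MemLp.indicator (measurableSet_Icc (a := (-n : ℝ)) (b := n)) hm
  rw [dist_eq_norm, bmul_sub hmn hm]
  refine lt_of_le_of_lt (ContinuousLinearMap.opNorm_le_bound _ (half_pos hε).le fun u => ?_)
    (half_lt_self hε)
  refine norm_bmul_le (hmn.sub hm) (Eventually.of_forall fun x => ?_) u
  by_cases hx : x ∈ Icc (-n : ℝ) n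
  · rw [Pi.sub_apply, indicator_of_mem hx, sub_self, norm_zero]; positivity
  · rw [Pi.sub_apply, indicator_of_notMem hx, zero_sub, norm_neg]
    refine hKm fun hxK => hx ?_
    have := hB hxK
    rw [Metric.mem_closedBall, dist_zero_right, Real.norm_eq_abs] at this
    exact abs_le.mp (this.trans (Nat.ceil_le.mp hn))

theorem tendsto_clm_comp {ι : Type*} {l : Filter ι} {A B : ι → L2C →L[ℂ] L2C} {A' B' : L2C →L[ℂ] L2C}
    (hA : Tendsto A l (𝓝 A')) (hB : Tendsto B l (𝓝 B')) :
    Tendsto (fun i => A i ∘L B i) l (𝓝 (A' ∘L B')) :=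
  ((isBoundedBilinearMap_comp (𝕜 := ℂ) (E := L2C) (F := L2C) (G := L2C)).continuous.tendsto
    (A', B')).comp (hA.prodMk_nhds hB)

/-- Cutting q and m off to [−n, n] changes both operators by an amount tending to 0 in norm, and
norm limits of compact operators are compact. -/
theorem isCompactOperator_bmul_fmul {q m : ℝ → ℂ} (hq : MemLp q ∞ volume)
    (hm : MemLp m ∞ volume) (hq0 : Tendsto q (cocompact ℝ) (𝓝 0))
    (hm0 : Tendsto m (cocompact ℝ) (𝓝 0)) : IsCompactOperator (bmul q ∘L fmul m) := by
  have h1 : Tendsto (fun n : ℕ => bmul ((Icc (-n : ℝ) n).indicator q) ∘L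
      fmul ((Icc (-n : ℝ) n).indicator m)) atTop (𝓝 (bmul q ∘L fmul m)) :=
    tendsto_clm_comp (tendsto_bmul_indicator hq hq0) (tendsto_clm_comp tendsto_const_nhds
      (tendsto_clm_comp (tendsto_bmul_indicator hm hm0) tendsto_const_nhds))
  refine isCompactOperator_of_tendsto h1 (Eventually.of_forall fun n => ?_)
  obtain ⟨C₁, hC₁⟩ := exists_ae_norm_le hq
  obtain ⟨C₂, hC₂⟩ := exists_ae_norm_le hm
  refine isCompactOperator_bmul_fmul_of_support (hq.indicator measurableSet_Icc)
    (hm.indicator measurableSet_Icc) (Nat.cast_nonneg n) (fun x hx => indicator_of_notMem hx _)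
    (fun x hx => indicator_of_notMem hx _) (C := max C₁ C₂) ?_ ?_
  · filter_upwards [hC₁] with x hx
    exact (norm_indicator_le_norm_self _ _).trans (hx.trans (le_max_left _ _))
  · filter_upwards [hC₂] with x hx
    exact (norm_indicator_le_norm_self _ _).trans (hx.trans (le_max_right _ _))

/-- Because ‖Bx‖² = ⟨ABx, x⟩ ≤ ‖ABx‖‖x‖, total boundedness of the image of the unit ball under AB
passes to B. -/
theorem IsCompactOperator.of_adjoint {H : Type*} [NormedAddCommGroup H] [InnerProductSpace ℂ H]
    [CompleteSpace H] {A B : H →L[ℂ] H} (hA : IsCompactOperator A)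
    (hAB : ∀ x y, inner ℂ (A x) y = inner ℂ x (B y)) : IsCompactOperator B := by
  have hAB' : IsCompactOperator (A ∘L B) := hA.comp_clm B
  have h1 : TotallyBounded ((A ∘L B) '' Metric.closedBall 0 1) :=
    (hAB'.image_closedBall_subset_compact (σ₁₂ := RingHom.id ℂ) (f := (A ∘L B : H →ₗ[ℂ] H)) 1).elim
      fun K hK => hK.1.totallyBounded.subset hK.2
  have h2 : TotallyBounded (B '' Metric.closedBall 0 1) := by
    rw [Metric.totallyBounded_iff]
    intro ε hε
    -- Points of the unit ball are at most 2 apart, so closeness ε²/2 under AB gives ‖B(x − x')‖² <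
    -- ε².
    obtain ⟨t, ht, htf, hcov⟩ := Metric.finite_approx_of_totallyBounded h1 (ε ^ 2 / 2) (by positivity)
    choose! g hg using fun y (hy : y ∈ t) => ht hy
    refine ⟨B '' (g '' t), (htf.image g).image B, ?_⟩
    rintro _ ⟨x, hx, rfl⟩
    obtain ⟨y, hy, hxy⟩ := mem_iUnion₂.mp (hcov (mem_image_of_mem _ hx))
    refine mem_iUnion₂.mpr ⟨B (g y), mem_image_of_mem _ (mem_image_of_mem _ hy), ?_⟩
    rw [Metric.mem_ball, dist_eq_norm] at hxy ⊢
    rw [← (hg y hy).2, ← map_sub, ContinuousLinearMap.comp_apply] at hxy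
    have hn : ‖x - g y‖ ≤ 2 := by
      have a := mem_closedBall_zero_iff.mp hx
      have b := mem_closedBall_zero_iff.mp (hg y hy).1
      linarith [norm_sub_le x (g y)]
    have h3 : ‖B (x - g y)‖ ^ 2 ≤ ‖A (B (x - g y))‖ * ‖x - g y‖ := by
      have e := hAB (B (x - g y)) (x - g y)
      have : (‖B (x - g y)‖ ^ 2 : ℝ) = RCLike.re (inner ℂ (A (B (x - g y))) (x - g y)) := by
        rw [e, inner_self_eq_norm_sq]
      rw [this]
      exact re_inner_le_norm _ _
    rw [← map_sub]
    have h4 : ‖B (x - g y)‖ ^ 2 < ε ^ 2 := by nlinarith [norm_nonneg (A (B (x - g y)))]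
    exact lt_of_pow_lt_pow_left₀ 2 hε.le h4
  have h3 : IsCompact (closure (B '' Metric.closedBall 0 1)) :=
    h2.closure.isCompact_of_isClosed isClosed_closure
  exact ⟨_, h3, Filter.mem_of_superset (Metric.closedBall_mem_nhds 0 one_pos)
    fun x hx => subset_closure (mem_image_of_mem _ hx)⟩

end Compactness
end

noncomputable section

/-! ### Sobolev membership and weak derivatives on the Fourier side. -/

section Distributions

theorem toTemperedDistribution_L2C_injective {u v : L2C} (h : (u : 𝓢'(ℝ, ℂ)) = (v : 𝓢'(ℝ, ℂ))) :
    u = v := by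
  have := LinearMap.ker_eq_bot.mp
    (Lp.ker_toTemperedDistributionCLM_eq_bot (F := ℂ) (μ := (volume : Measure ℝ)) (p := 2))
  exact this h

theorem fourier_L2C (u : L2C) : 𝓕 (u : 𝓢'(ℝ, ℂ)) = (FT u : 𝓢'(ℝ, ℂ)) :=
  Lp.fourier_toTemperedDistribution_eq u

theorem smulLeftCLM_eq_iff {m : ℝ → ℂ} (hm : m.HasTemperateGrowth) (u h : L2C) :
    TemperedDistribution.smulLeftCLM ℂ m (u : 𝓢'(ℝ, ℂ)) = (h : 𝓢'(ℝ, ℂ)) ↔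
      h =ᵐ[volume] fun x => m x * u x := by
  have hc : Continuous m := hm.1.continuous
  have e : ∀ φ : 𝓢(ℝ, ℂ), TemperedDistribution.smulLeftCLM ℂ m (u : 𝓢'(ℝ, ℂ)) φ
      = ∫ x, φ x • (m x * u x) := by
    intro φ
    rw [TemperedDistribution.smulLeftCLM_apply_apply, Lp.toTemperedDistribution_apply]
    refine integral_congr_ae (Eventually.of_forall fun x => ?_)
    simp only [SchwartzMap.smulLeftCLM_apply_apply hm, smul_eq_mul]
    ring
  constructor
  · intro h1
    refine ae_eq_of_schwartz_integral_eq (locallyIntegrable_L2C h) ?_ fun φ => ?_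
    · exact (locallyIntegrable_L2C u).continuous_mul hc
    · rw [← e, h1, Lp.toTemperedDistribution_apply]
  · intro h1
    ext φ
    rw [e, Lp.toTemperedDistribution_apply]
    refine integral_congr_ae ?_
    filter_upwards [h1] with x hx
    rw [hx]

/-- The symbol `(1 + ξ²)^{s/2}` of the Bessel potential. -/
def japanese (s : ℝ) (x : ℝ) : ℝ := (1 + ‖x‖ ^ 2) ^ (s / 2)

theorem japanese_hasTemperateGrowth (s : ℝ) :
    (fun x => (japanese s x : ℂ)).HasTemperateGrowth := by
  unfold japanese
  fun_prop

theorem besselPotential_eq_iff (s : ℝ) (u g : L2C) :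
    TemperedDistribution.besselPotential ℝ ℂ s (u : 𝓢'(ℝ, ℂ)) = (g : 𝓢'(ℝ, ℂ)) ↔
      FT g =ᵐ[volume] fun x => (japanese s x : ℂ) * FT u x := by
  rw [← smulLeftCLM_eq_iff (japanese_hasTemperateGrowth s), ← fourier_L2C, ← fourier_L2C]
  constructor
  · intro h
    rw [← h, TemperedDistribution.fourier_besselPotential_eq_smulLeftCLM_fourier_apply]
    rfl
  · intro h
    have h2 := TemperedDistribution.fourier_besselPotential_eq_smulLeftCLM_fourier_apply
      s (u : 𝓢'(ℝ, ℂ))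
    have h3 : 𝓕 (TemperedDistribution.besselPotential ℝ ℂ s (u : 𝓢'(ℝ, ℂ))) = 𝓕 (g : 𝓢'(ℝ, ℂ)) :=
      h2.trans h
    exact (FourierTransform.fourierEquiv ℂ 𝓢'(ℝ, ℂ)).injective h3

theorem inH_iff (s : ℝ) (u : L2C) :
    InH s u ↔ MemLp (fun x => (japanese s x : ℂ) * FT u x) 2 volume := by
  constructor
  · rintro ⟨g, hg⟩
    exact (Lp.memLp (FT g)).ae_eq ((besselPotential_eq_iff s u g).mp hg)
  · intro h
    refine ⟨FT.symm (h.toLp _), (besselPotential_eq_iff s u _).mpr ?_⟩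
    rw [LinearIsometryEquiv.apply_symm_apply]
    exact h.coeFn_toLp

/-- `v ∈ L²` is the weak derivative of `u ∈ L²`. -/
def HasWeakDeriv (u v : L2C) : Prop :=
  ∀ᵐ x : ℝ, FT v x = 2 * Real.pi * Complex.I * x * FT u x

/-- Passing between the symbol 2πiξ and the distributional derivative links the Hilbert space
argument with the theorem's formulation. -/
theorem hasWeakDeriv_iff (u v : L2C) :
    HasWeakDeriv u v ↔ (v : 𝓢'(ℝ, ℂ)) = ∂_{(1 : ℝ)} (u : 𝓢'(ℝ, ℂ)) := by
  have hm : (fun x : ℝ => 2 * Real.pi * Complex.I * ((inner ℝ x 1 : ℝ) : ℂ)).HasTemperateGrowth := by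
    fun_prop
  have hm' : (fun x : ℝ => ((inner ℝ x 1 : ℝ) : ℂ)).HasTemperateGrowth := by fun_prop
  have h1 := smulLeftCLM_eq_iff hm (FT u) (FT v)
  have h2 : TemperedDistribution.smulLeftCLM ℂ
      (fun x : ℝ => 2 * Real.pi * Complex.I * ((inner ℝ x 1 : ℝ) : ℂ)) (FT u : 𝓢'(ℝ, ℂ))
      = 𝓕 (∂_{(1 : ℝ)} (u : 𝓢'(ℝ, ℂ))) := by
    rw [TemperedDistribution.fourier_lineDerivOp_eq, fourier_L2C,
      ← smul_apply, ← TemperedDistribution.smulLeftCLM_smul hm']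
    rfl
  have h3 : HasWeakDeriv u v ↔ FT v =ᵐ[volume] fun x : ℝ =>
      2 * Real.pi * Complex.I * ((inner ℝ x 1 : ℝ) : ℂ) * FT u x := by
    simp [HasWeakDeriv, EventuallyEq]
  rw [h3, ← h1, h2, ← fourier_L2C]
  constructor
  · intro h
    have := congrArg (𝓕⁻ ·) h
    simpa using this.symm
  · intro h
    rw [h]

theorem HasWeakDeriv.unique {u v w : L2C} (h : HasWeakDeriv u v) (h' : HasWeakDeriv u w) : v = w :=
  toTemperedDistribution_L2C_injective
    (((hasWeakDeriv_iff u v).mp h).trans ((hasWeakDeriv_iff u w).mp h').symm)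

end Distributions

/-! ### Strong convergence of multipliers. -/

section StrongConvergence

theorem norm_sq_L2C (u : L2C) : ‖u‖ ^ 2 = ∫ x, ‖u x‖ ^ 2 := by
  have h : inner ℂ u u = ((‖u‖ : ℂ) ^ 2) := inner_self_eq_norm_sq_to_K u
  rw [L2.inner_def] at h
  refine Complex.ofReal_injective ?_
  push_cast
  rw [← h]
  refine Eq.trans ?_ (integral_ofReal (𝕜 := ℂ))
  refine integral_congr_ae (Eventually.of_forall fun x => ?_)
  simp only [inner_self_eq_norm_sq_to_K]
  norm_cast

/-- Dominated convergence for |(mᵢ − m')u|² with majorant (2C)²|u|². The convergence is only strong,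
which suffices next to a compact operator. -/
theorem tendsto_bmul_of_dominated {ι : Type*} {l : Filter ι} [l.IsCountablyGenerated]
    {m : ι → ℝ → ℂ} {m' : ℝ → ℂ} (hm : ∀ᶠ i in l, MemLp (m i) ∞ volume)
    (hm' : MemLp m' ∞ volume) {C : ℝ}
    (hC : ∀ᶠ i in l, ∀ᵐ x, ‖m i x‖ ≤ C) (hC' : ∀ᵐ x, ‖m' x‖ ≤ C)
    (hlim : ∀ᵐ x, Tendsto (fun i => m i x) l (𝓝 (m' x))) (u : L2C) :
    Tendsto (fun i => bmul (m i) u) l (𝓝 (bmul m' u)) := by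
  rw [tendsto_iff_norm_sub_tendsto_zero]
  have h2 : Tendsto (fun i => ∫ x, ‖(m i x - m' x) * u x‖ ^ 2) l (𝓝 (∫ _ : ℝ, (0 : ℝ))) := by
    refine tendsto_integral_filter_of_dominated_convergence
      (fun x => (2 * C) ^ 2 * ‖u x‖ ^ 2) ?_ ?_ ?_ ?_
    · filter_upwards [hm] with i hi
      exact (((hi.1.sub hm'.1).mul (Lp.aestronglyMeasurable u)).norm.pow 2)
    · filter_upwards [hC] with i hi
      filter_upwards [hi, hC'] with x h1 h2
      rw [norm_pow, norm_norm, norm_mul, mul_pow]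
      have : ‖m i x - m' x‖ ≤ 2 * C := (norm_sub_le _ _).trans (by linarith)
      gcongr
    · exact ((Lp.memLp u).integrable_norm_pow (by norm_num)).const_mul _
    · filter_upwards [hlim] with x hx
      have : Tendsto (fun i => ‖(m i x - m' x) * u x‖ ^ 2) l (𝓝 (‖(m' x - m' x) * u x‖ ^ 2)) :=
        (((hx.sub_const _).mul_const _).norm.pow 2)
      simpa using this
  have h3 : Tendsto (fun i => ‖bmul (m i) u - bmul m' u‖ ^ 2) l (𝓝 0) := by
    rw [integral_zero] at h2
    refine h2.congr' ?_
    filter_upwards [hm] with i hi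
    rw [norm_sq_L2C]
    refine integral_congr_ae ?_
    filter_upwards [coeFn_bmul hi u, coeFn_bmul hm' u, Lp.coeFn_sub (bmul (m i) u) (bmul m' u)]
      with x h1 h2 h3
    rw [h3, Pi.sub_apply, h1, h2, sub_mul]
  have := h3.sqrt
  simpa using this

theorem tendsto_fmul_of_dominated {ι : Type*} {l : Filter ι} [l.IsCountablyGenerated]
    {m : ι → ℝ → ℂ} {m' : ℝ → ℂ} (hm : ∀ᶠ i in l, MemLp (m i) ∞ volume)
    (hm' : MemLp m' ∞ volume) {C : ℝ}
    (hC : ∀ᶠ i in l, ∀ᵐ x, ‖m i x‖ ≤ C) (hC' : ∀ᵐ x, ‖m' x‖ ≤ C)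
    (hlim : ∀ᵐ x, Tendsto (fun i => m i x) l (𝓝 (m' x))) (u : L2C) :
    Tendsto (fun i => fmul (m i) u) l (𝓝 (fmul m' u)) :=
  (FT.symm.continuous.tendsto _).comp (tendsto_bmul_of_dominated hm hm' hC hC' hlim (FT u))

end StrongConvergence

/-! ### Translations and difference quotients. -/

section Translation

/-- Translation `u ↦ u(· + h)` on `L²`. -/
def shift (h : ℝ) : L2C →ₗᵢ[ℂ] L2C :=
  Lp.compMeasurePreservingₗᵢ ℂ (fun x : ℝ => x + h) (measurePreserving_add_right volume h)

theorem coeFn_shift (h : ℝ) (u : L2C) : shift h u =ᵐ[volume] fun x => u (x + h) :=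
  Lp.coeFn_compMeasurePreserving u (measurePreserving_add_right volume h)

theorem ae_add_right (h : ℝ) {p : ℝ → Prop} (hp : ∀ᵐ x : ℝ, p x) : ∀ᵐ x : ℝ, p (x + h) :=
  (measurePreserving_add_right (volume : Measure ℝ) h).quasiMeasurePreserving.ae hp

/-- The symbol of translation by `h`. -/
def shiftSymbol (h x : ℝ) : ℂ := Complex.exp (2 * Real.pi * Complex.I * h * x)

theorem norm_shiftSymbol (h x : ℝ) : ‖shiftSymbol h x‖ = 1 := by
  have : 2 * (Real.pi : ℂ) * Complex.I * h * x = ((2 * Real.pi * h * x : ℝ) : ℂ) * Complex.I := by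
    push_cast; ring
  rw [shiftSymbol, this, Complex.norm_exp_ofReal_mul_I]

theorem memLp_shiftSymbol (h : ℝ) : MemLp (shiftSymbol h) ∞ volume :=
  memLp_top_of_bound' (by unfold shiftSymbol; fun_prop) (C := 1) fun x => (norm_shiftSymbol h x).le

theorem fourier_comp_add (f : ℝ → ℂ) (h ξ : ℝ) :
    𝓕 (fun x => f (x + h)) ξ = shiftSymbol h ξ * 𝓕 f ξ := by
  rw [Real.fourier_eq', Real.fourier_eq', ← integral_const_mul]
  rw [← integral_add_right_eq_self (fun x => shiftSymbol h ξ * _) h]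
  refine integral_congr_ae (Eventually.of_forall fun x => ?_)
  simp only [smul_eq_mul, shiftSymbol, ← mul_assoc, ← Complex.exp_add]
  congr 2
  simp only [RCLike.inner_apply, conj_trivial]
  push_cast
  ring

/-- On Schwartz functions this is a substitution in the Fourier integral; density and continuity
give the rest. -/
theorem shift_eq_fmul (h : ℝ) (u : L2C) : shift h u = fmul (shiftSymbol h) u := by
  refine DenseRange.induction_on (p := fun u => shift h u = fmul (shiftSymbol h) u)
    (SchwartzMap.denseRange_toLpCLM (E := ℝ) (F := ℂ) (μ := (volume : Measure ℝ)) (p := 2)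
      ENNReal.ofNat_ne_top) u ?_ fun f => ?_
  · exact isClosed_eq (shift h).continuous (fmul _).continuous
  · change shift h (f.toLp 2) = fmul (shiftSymbol h) (f.toLp 2)
    have h1 : Integrable (fun x => f (x + h)) := f.integrable.comp_add_right h
    have h2 : MemLp (fun x => f (x + h)) 2 :=
      (f.memLp 2 volume).comp_measurePreserving (measurePreserving_add_right volume h)
    have h3 : shift h (f.toLp 2) = h2.toLp _ := by
      refine Lp.ext ?_
      filter_upwards [coeFn_shift h (f.toLp 2), ae_add_right h (f.coeFn_toLp 2 volume),
        h2.coeFn_toLp] with x a b c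
      rw [a, b, c]
    have h4 : f.toLp 2 = (f.memLp 2 volume).toLp f := rfl
    have h5 := FT_toLp_ae_eq f.integrable (f.memLp 2 volume)
    rw [← h4] at h5
    apply L2C_ext_FT
    rw [h3]
    filter_upwards [FT_toLp_ae_eq h1 h2, coeFn_FT_fmul (memLp_shiftSymbol h) (f.toLp 2), h5]
      with x a b c
    rw [a, b, c, fourier_comp_add]

/-- The difference quotient of `u ∈ L²`. -/
def diffQuot (h : ℝ) (u : L2C) : L2C := ((h : ℂ)⁻¹) • (shift h u - u)

theorem norm_shiftSymbol_sub_one_le (h x : ℝ) : ‖shiftSymbol h x - 1‖ ≤ 2 * Real.pi * |h| * |x| := by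
  have : 2 * (Real.pi : ℂ) * Complex.I * h * x = Complex.I * ((2 * Real.pi * h * x : ℝ) : ℂ) := by
    push_cast; ring
  rw [shiftSymbol, this]
  refine (Real.norm_exp_I_mul_ofReal_sub_one_le).trans ?_
  rw [Real.norm_eq_abs, abs_mul, abs_mul, abs_of_pos Real.two_pi_pos]

theorem tendsto_shiftSymbol_quot (x : ℝ) :
    Tendsto (fun h : ℝ => (h : ℂ)⁻¹ * (shiftSymbol h x - 1)) (𝓝[≠] 0)
      (𝓝 (2 * Real.pi * Complex.I * x)) := by
  have h1 : HasDerivAt (fun h : ℝ => shiftSymbol h x) (2 * Real.pi * Complex.I * x) 0 := by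
    have : HasDerivAt (fun z : ℂ => Complex.exp (2 * Real.pi * Complex.I * z * x))
        (2 * Real.pi * Complex.I * x) ((0 : ℝ) : ℂ) := by
      have h2 : HasDerivAt (fun z : ℂ => 2 * Real.pi * Complex.I * z * x)
          (2 * Real.pi * Complex.I * x) ((0 : ℝ) : ℂ) := by
        simpa using ((hasDerivAt_id ((0 : ℝ) : ℂ)).const_mul (2 * Real.pi * Complex.I)).mul_const (x : ℂ)
      simpa using h2.cexp
    exact this.comp_ofReal
  have h2 := hasDerivAt_iff_tendsto_slope_zero.mp h1
  refine h2.congr fun h => ?_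
  simp [shiftSymbol]

/-- The damped symbol of the difference quotient. -/
def quotSymbol (h x : ℝ) : ℂ := (1 + |x| : ℂ)⁻¹ * ((h : ℂ)⁻¹ * (shiftSymbol h x - 1))

theorem norm_quotSymbol_le (h x : ℝ) : ‖quotSymbol h x‖ ≤ 2 * Real.pi := by
  rcases eq_or_ne h 0 with rfl | hh
  · simp [quotSymbol, Real.pi_pos.le]
  have h1 := norm_shiftSymbol_sub_one_le h x
  have e : ‖(1 + |x| : ℂ)‖ = 1 + |x| := by
    rw [show (1 + |x| : ℂ) = ((1 + |x| : ℝ) : ℂ) by push_cast; rfl, Complex.norm_real,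
      Real.norm_of_nonneg (by positivity)]
  rw [quotSymbol, norm_mul, norm_mul, norm_inv, norm_inv, e, Complex.norm_real, Real.norm_eq_abs]
  have hp : 0 < |h| := abs_pos.mpr hh
  calc _ ≤ (1 + |x|)⁻¹ * (|h|⁻¹ * (2 * Real.pi * |h| * |x|)) := by gcongr
    _ = 2 * Real.pi * (|x| / (1 + |x|)) := by field_simp
    _ ≤ 2 * Real.pi * 1 := by
        have := Real.pi_pos
        gcongr
        rw [div_le_one (by positivity)]
        linarith
    _ = _ := mul_one _

theorem memLp_quotSymbol (h : ℝ) : MemLp (quotSymbol h) ∞ volume := by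
  refine memLp_top_of_bound' ?_ (norm_quotSymbol_le h)
  unfold quotSymbol shiftSymbol
  have : ∀ x : ℝ, (1 + |x| : ℂ) ≠ 0 := fun x => by
    have : (1 + |x| : ℝ) ≠ 0 := by positivity
    exact_mod_cast this
  have h2 : Continuous fun x : ℝ => (1 + |x| : ℂ) :=
    continuous_const.add (Complex.continuous_ofReal.comp continuous_abs)
  exact (h2.inv₀ this).mul (by fun_prop)

end Translation
end

noncomputable section

/-! ### Weak derivatives as L² limits of difference quotients. -/

section WeakDerivative

theorem coeFn_diffQuot (h : ℝ) (u : L2C) :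
    diffQuot h u =ᵐ[volume] fun x => (h : ℂ)⁻¹ * (u (x + h) - u x) := by
  filter_upwards [Lp.coeFn_smul ((h : ℂ)⁻¹) (shift h u - u), Lp.coeFn_sub (shift h u) u,
    coeFn_shift h u] with x h1 h2 h3
  rw [diffQuot, h1, Pi.smul_apply, h2, Pi.sub_apply, h3, smul_eq_mul]

theorem coeFn_FT_diffQuot (h : ℝ) (u : L2C) :
    FT (diffQuot h u) =ᵐ[volume] fun x => (h : ℂ)⁻¹ * (shiftSymbol h x - 1) * FT u x := by
  rw [diffQuot, map_smul, map_sub, shift_eq_fmul]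
  filter_upwards [Lp.coeFn_smul ((h : ℂ)⁻¹) (FT (fmul (shiftSymbol h) u) - FT u),
    Lp.coeFn_sub (FT (fmul (shiftSymbol h) u)) (FT u), coeFn_FT_fmul (memLp_shiftSymbol h) u]
    with x h1 h2 h3
  rw [h1, Pi.smul_apply, h2, Pi.sub_apply, h3, smul_eq_mul]
  ring

theorem ae_ne_zero : ∀ᵐ x : ℝ, x ≠ 0 := by
  rw [ae_iff]; simp

/-- The symbol of the difference quotient divided by 2πiξ is bounded by 1 and tends to 1 off ξ = 0,
so the quotients of u are strongly convergent multipliers applied to v. -/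
theorem HasWeakDeriv.tendsto_diffQuot {u v : L2C} (huv : HasWeakDeriv u v) :
    Tendsto (fun h => diffQuot h u) (𝓝[≠] 0) (𝓝 v) := by
  let k : ℝ → ℝ → ℂ := fun h x => (h : ℂ)⁻¹ * (shiftSymbol h x - 1) / (2 * Real.pi * Complex.I * x)
  have hb : ∀ h x, ‖k h x‖ ≤ 1 := by
    intro h x
    have h1 := norm_shiftSymbol_sub_one_le h x
    have h2 : ‖2 * (Real.pi : ℂ) * Complex.I * x‖ = 2 * Real.pi * |x| := by
      simp [abs_of_pos Real.pi_pos]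
    simp only [k, norm_div, norm_mul, norm_inv, h2, Complex.norm_real, Real.norm_eq_abs]
    refine div_le_one_of_le₀ ?_ (by have := Real.pi_pos; positivity)
    rcases eq_or_ne h 0 with rfl | hh
    · have := Real.pi_pos; simp; positivity
    · have : 0 < |h| := abs_pos.mpr hh
      rw [inv_mul_le_iff₀ this]
      linarith
  have hm : ∀ h, MemLp (k h) ∞ volume := fun h => by
    refine memLp_top_of_bound ?_ 1 (Eventually.of_forall (hb h))
    refine Measurable.aestronglyMeasurable ?_
    simp only [k, shiftSymbol]
    fun_prop
  have e : ∀ h, diffQuot h u = fmul (k h) v := by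
    intro h
    apply L2C_ext_FT
    filter_upwards [coeFn_FT_diffQuot h u, coeFn_FT_fmul (hm h) v, huv, ae_ne_zero] with x h1 h2 h3 h4
    rw [h1, h2, h3]
    have : 2 * (Real.pi : ℂ) * Complex.I * x ≠ 0 := by
      simp [Real.pi_ne_zero, h4]
    simp only [k]
    rw [← mul_assoc, div_mul_cancel₀ _ this]
  simp only [e]
  have h1 : v = fmul (fun _ => 1) v := by
    rw [fmul_apply, bmul_one, LinearIsometryEquiv.symm_apply_apply]
  nth_rewrite 2 [h1]
  refine tendsto_fmul_of_dominated (Eventually.of_forall hm)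
    (memLp_top_of_bound' continuous_const (C := 1) (by simp)) (C := 1)
    (Eventually.of_forall fun h => Eventually.of_forall (hb h)) (by simp) ?_ v
  filter_upwards [ae_ne_zero] with x hx
  have : 2 * (Real.pi : ℂ) * Complex.I * x ≠ 0 := by
    simp [Real.pi_ne_zero, hx]
  have := (tendsto_shiftSymbol_quot x).div_const (2 * Real.pi * Complex.I * x)
  rwa [div_self (by assumption)] at this

theorem one_add_abs_ne_zero (x : ℝ) : (1 + |x| : ℂ) ≠ 0 := by
  have : (1 + |x| : ℝ) ≠ 0 := by positivity
  exact_mod_cast this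

theorem continuous_inv_one_add_abs : Continuous fun x : ℝ => (1 + |x| : ℂ)⁻¹ :=
  (continuous_const.add (Complex.continuous_ofReal.comp continuous_abs)).inv₀ one_add_abs_ne_zero

theorem norm_one_add_abs (x : ℝ) : ‖(1 + |x| : ℂ)‖ = 1 + |x| := by
  rw [show (1 + |x| : ℂ) = ((1 + |x| : ℝ) : ℂ) by push_cast; rfl, Complex.norm_real,
    Real.norm_of_nonneg (by positivity)]

/-- The symbols of the difference quotients are not uniformly bounded, so the limit is taken after
damping by (1 + |ξ|)⁻¹. That factor never vanishes and is cancelled at the end. -/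
theorem hasWeakDeriv_of_tendsto {u v : L2C}
    (h : Tendsto (fun h => diffQuot h u) (𝓝[≠] 0) (𝓝 v)) : HasWeakDeriv u v := by
  let ρ : ℝ → ℂ := fun x => (1 + |x| : ℂ)⁻¹
  let κ : ℝ → ℂ := fun x => (1 + |x| : ℂ)⁻¹ * (2 * Real.pi * Complex.I * x)
  have hρ : MemLp ρ ∞ volume := by
    refine memLp_top_of_bound' continuous_inv_one_add_abs (C := 1) fun x => ?_
    rw [norm_inv, norm_one_add_abs]
    exact inv_le_one_of_one_le₀ (by linarith [abs_nonneg x])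
  have hlim : ∀ x, Tendsto (fun h : ℝ => quotSymbol h x) (𝓝[≠] 0) (𝓝 (κ x)) := fun x =>
    (tendsto_shiftSymbol_quot x).const_mul _
  have hκb : ∀ x, ‖κ x‖ ≤ 2 * Real.pi := fun x =>
    le_of_tendsto (hlim x).norm (Eventually.of_forall fun h => norm_quotSymbol_le h x)
  have hκ : MemLp κ ∞ volume :=
    memLp_top_of_bound' (continuous_inv_one_add_abs.mul (by fun_prop)) hκb
  have h1 : Tendsto (fun h => fmul ρ (diffQuot h u)) (𝓝[≠] 0) (𝓝 (fmul ρ v)) :=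
    ((fmul ρ).continuous.tendsto v).comp h
  have h2 : Tendsto (fun h => fmul (quotSymbol h) u) (𝓝[≠] 0) (𝓝 (fmul κ u)) :=
    tendsto_fmul_of_dominated (Eventually.of_forall memLp_quotSymbol) hκ
      (Eventually.of_forall fun h => Eventually.of_forall (norm_quotSymbol_le h))
      (Eventually.of_forall hκb) (Eventually.of_forall hlim) u
  have e : ∀ h, fmul ρ (diffQuot h u) = fmul (quotSymbol h) u := by
    intro h
    apply L2C_ext_FT
    filter_upwards [coeFn_FT_fmul hρ (diffQuot h u), coeFn_FT_fmul (memLp_quotSymbol h) u,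
      coeFn_FT_diffQuot h u] with x h1 h2 h3
    rw [h1, h2, h3, quotSymbol]
    ring
  simp only [e] at h1
  have h3 := tendsto_nhds_unique h1 h2
  have h4 := coeFn_FT_fmul hρ v
  rw [h3] at h4
  filter_upwards [h4, coeFn_FT_fmul hκ u] with x h5 h6
  rw [h5] at h6
  have := one_add_abs_ne_zero x
  simp only [ρ, κ, mul_assoc] at h6
  have h7 := mul_left_cancel₀ (inv_ne_zero this) h6
  rw [h7]
  ring

/-- Common core of the product and chain rules: the error in the difference quotient is at most ε(h)
times that of u, which stays bounded in L² while ε(h) → 0. -/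
theorem hasWeakDeriv_of_remainder {p u u' w w' : L2C} {q r : ℝ → ℂ} (hq : MemLp q ∞ volume)
    (hr : MemLp r ∞ volume) (hu : HasWeakDeriv u u') (hw : HasWeakDeriv w w') {ε : ℝ → ℝ}
    (hε : Tendsto ε (𝓝[≠] 0) (𝓝 0))
    (hrem : ∀ h, ∀ᵐ x, ‖p (x + h) - p x - (q x * (u (x + h) - u x) + r x * (w (x + h) - w x))‖
      ≤ ε h * ‖u (x + h) - u x‖) :
    HasWeakDeriv p (bmul q u' + bmul r w') := by
  refine hasWeakDeriv_of_tendsto ?_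
  have h1 : Tendsto (fun h => bmul q (diffQuot h u) + bmul r (diffQuot h w)) (𝓝[≠] 0)
      (𝓝 (bmul q u' + bmul r w')) :=
    (((bmul q).continuous.tendsto _).comp hu.tendsto_diffQuot).add
      (((bmul r).continuous.tendsto _).comp hw.tendsto_diffQuot)
  have h2 : Tendsto (fun h => diffQuot h p - (bmul q (diffQuot h u) + bmul r (diffQuot h w)))
      (𝓝[≠] 0) (𝓝 0) := by
    have h3 : Tendsto (fun h => ε h * ‖diffQuot h u‖) (𝓝[≠] 0) (𝓝 0) := by
      simpa using hε.mul hu.tendsto_diffQuot.norm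
    refine squeeze_zero_norm (fun h => ?_) h3
    refine Lp.norm_le_mul_norm_of_ae_le_mul ?_
    filter_upwards [hrem h, coeFn_diffQuot h p, coeFn_diffQuot h u, coeFn_diffQuot h w,
      coeFn_bmul hq (diffQuot h u), coeFn_bmul hr (diffQuot h w),
      Lp.coeFn_sub (diffQuot h p) (bmul q (diffQuot h u) + bmul r (diffQuot h w)),
      Lp.coeFn_add (bmul q (diffQuot h u)) (bmul r (diffQuot h w))] with x h0 h1 h2 h3 h4 h5 h6 h7
    rw [h6, Pi.sub_apply, h7, Pi.add_apply, h4, h5, h1, h2, h3]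
    have : (h : ℂ)⁻¹ * (p (x + h) - p x) - (q x * ((h : ℂ)⁻¹ * (u (x + h) - u x))
        + r x * ((h : ℂ)⁻¹ * (w (x + h) - w x))) = (h : ℂ)⁻¹ *
        (p (x + h) - p x - (q x * (u (x + h) - u x) + r x * (w (x + h) - w x))) := by ring
    rw [this, norm_mul, norm_mul, mul_left_comm]
    gcongr
  simpa using h2.add h1

/-- The transform of u is (1 + iξ)⁻¹ times û + v̂/(2π), a product of two L² functions and so
integrable; inversion and the Riemann–Lebesgue lemma finish. -/
theorem HasWeakDeriv.exists_continuous {u v : L2C} (huv : HasWeakDeriv u v) :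
    ∃ U : ℝ → ℂ, Continuous U ∧ Tendsto U (cocompact ℝ) (𝓝 0) ∧ u =ᵐ[volume] U := by
  have hne : ∀ x : ℝ, (1 + Complex.I * x : ℂ) ≠ 0 := fun x h => by
    have := congrArg Complex.re h
    simp at this
  have h1 : MemLp (fun x : ℝ => (1 + Complex.I * x : ℂ)⁻¹) 2 volume := by
    have hc : Continuous fun x : ℝ => (1 + Complex.I * x : ℂ)⁻¹ := Continuous.inv₀ (by fun_prop) hne
    rw [memLp_two_iff_integrable_sq_norm hc.aestronglyMeasurable]
    refine integrable_inv_one_add_sq.congr (Eventually.of_forall fun x => ?_)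
    simp only
    rw [norm_inv, inv_pow, ← Complex.normSq_eq_norm_sq, Complex.normSq_apply]
    simp [sq]
  have h2 : Integrable (FT u) := by
    have h3 := h1.integrable_mul ((Lp.memLp (FT u)).add
      ((Lp.memLp (FT v)).const_mul (2 * Real.pi : ℂ)⁻¹))
    refine h3.congr ?_
    filter_upwards [huv] with x hx
    rw [Pi.mul_apply, Pi.add_apply, hx]
    have := hne x
    have h4 : (Real.pi : ℂ) ≠ 0 := by exact_mod_cast Real.pi_ne_zero
    field_simp
  have h3 := FT_symm_toLp_ae_eq h2 (Lp.memLp (FT u))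
  rw [Lp.toLp_coeFn, LinearIsometryEquiv.symm_apply_apply] at h3
  refine ⟨_, continuous_fourierInv_of_integrable h2, ?_, h3⟩
  have h4 : 𝓕⁻ (FT u : ℝ → ℂ) = fun x => 𝓕 (FT u : ℝ → ℂ) (-x) :=
    funext fun x => Real.fourierInv_eq_fourier_neg _ x
  rw [h4]
  exact (Real.zero_at_infty_fourier _).comp (Homeomorph.neg ℝ).isClosedEmbedding.tendsto_cocompact

end WeakDerivative
end

noncomputable section

/-! ### Product and chain rules for weak derivatives. -/

section SobolevCalculus

/-- `v` is the weak derivative of `g`, both being square integrable functions. -/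
def HasWeakDerivFun (g v : ℝ → ℂ) : Prop :=
  ∃ (hg : MemLp g 2 volume) (hv : MemLp v 2 volume), HasWeakDeriv (hg.toLp g) (hv.toLp v)

theorem hasWeakDerivFun_coe {u v : L2C} : HasWeakDerivFun u v ↔ HasWeakDeriv u v := by
  constructor
  · rintro ⟨h1, h2, h3⟩
    rwa [Lp.toLp_coeFn, Lp.toLp_coeFn] at h3
  · intro h
    refine ⟨Lp.memLp u, Lp.memLp v, ?_⟩
    rwa [Lp.toLp_coeFn, Lp.toLp_coeFn]

theorem HasWeakDerivFun.congr_ae {g g' v v' : ℝ → ℂ} (h : HasWeakDerivFun g v)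
    (hg : g =ᵐ[volume] g') (hv : v =ᵐ[volume] v') : HasWeakDerivFun g' v' := by
  obtain ⟨h1, h2, h3⟩ := h
  refine ⟨h1.ae_eq hg, h2.ae_eq hv, ?_⟩
  rwa [← (MemLp.toLp_eq_toLp_iff h1 (h1.ae_eq hg)).mpr hg,
    ← (MemLp.toLp_eq_toLp_iff h2 (h2.ae_eq hv)).mpr hv]

theorem HasWeakDerivFun.exists_continuous {g v : ℝ → ℂ} (h : HasWeakDerivFun g v) :
    ∃ U : ℝ → ℂ, Continuous U ∧ Tendsto U (cocompact ℝ) (𝓝 0) ∧ g =ᵐ[volume] U := by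
  obtain ⟨h1, h2, h3⟩ := h
  obtain ⟨U, hU, hU0, hu⟩ := h3.exists_continuous
  exact ⟨U, hU, hU0, h1.coeFn_toLp.symm.trans hu⟩

theorem exists_bound_of_tendsto_cocompact {U : ℝ → ℂ} (hU : Continuous U)
    (h0 : Tendsto U (cocompact ℝ) (𝓝 0)) : ∃ C : ℝ, 0 ≤ C ∧ ∀ x, ‖U x‖ ≤ C := by
  let V : ZeroAtInftyContinuousMap ℝ ℂ := ⟨⟨U, hU⟩, h0⟩
  obtain ⟨C, hC⟩ := (ZeroAtInftyContinuousMap.isBounded_range V).exists_norm_le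
  exact ⟨C, (norm_nonneg _).trans (hC (U 0) ⟨0, rfl⟩), fun x => hC (U x) ⟨x, rfl⟩⟩

theorem exists_modulus {U : ℝ → ℂ} (hU : Continuous U) (h0 : Tendsto U (cocompact ℝ) (𝓝 0)) :
    ∃ ε : ℝ → ℝ, Tendsto ε (𝓝[≠] 0) (𝓝 0) ∧ ∀ h x, ‖U (x + h) - U x‖ ≤ ε h := by
  obtain ⟨C, hC0, hC⟩ := exists_bound_of_tendsto_cocompact hU h0
  have hbdd : ∀ h, BddAbove (range fun x => ‖U (x + h) - U x‖) := fun h => by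
    refine ⟨2 * C, ?_⟩
    rintro _ ⟨x, rfl⟩
    have := norm_sub_le (U (x + h)) (U x)
    simp only
    linarith [hC (x + h), hC x]
  refine ⟨fun h => ⨆ x, ‖U (x + h) - U x‖, ?_, fun h x => le_ciSup (hbdd h) x⟩
  refine Tendsto.mono_left ?_ nhdsWithin_le_nhds
  rw [Metric.tendsto_nhds]
  intro δ hδ
  have huc := hU.uniformContinuous_of_tendsto_cocompact h0
  obtain ⟨η, hη, huη⟩ := Metric.uniformContinuous_iff.mp huc (δ / 2) (by positivity)
  filter_upwards [Metric.ball_mem_nhds (0 : ℝ) hη] with h hh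
  have h1 : ⨆ x, ‖U (x + h) - U x‖ ≤ δ / 2 := ciSup_le fun x => by
    rw [← dist_eq_norm]
    refine (huη ?_).le
    rw [Real.dist_eq]
    simpa [Real.norm_eq_abs] using hh
  have h2 : 0 ≤ ⨆ x, ‖U (x + h) - U x‖ := Real.iSup_nonneg fun x => norm_nonneg _
  rw [Real.dist_eq, sub_zero, abs_of_nonneg h2]
  linarith

theorem HasWeakDerivFun.memLp_top {g v : ℝ → ℂ} (h : HasWeakDerivFun g v) : MemLp g ∞ volume := by
  obtain ⟨U, hU, hU0, hu⟩ := h.exists_continuous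
  obtain ⟨C, -, hC⟩ := exists_bound_of_tendsto_cocompact hU hU0
  exact (memLp_top_of_bound' hU hC).ae_eq hu.symm

theorem memLp_two_mul {q g : ℝ → ℂ} (hq : MemLp q ∞ volume) (hg : MemLp g 2 volume) :
    MemLp (fun x => q x * g x) 2 volume := hg.mul hq

/-- The remainder is the product of the increments of u and w, and the increment of w is uniformly
small by uniform continuity of its representative. -/
theorem HasWeakDerivFun.mul {u u' w w' : ℝ → ℂ} (hu : HasWeakDerivFun u u')
    (hw : HasWeakDerivFun w w') :
    HasWeakDerivFun (fun x => u x * w x) (fun x => w x * u' x + u x * w' x) := by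
  obtain ⟨W, hWc, hW0, hWe⟩ := hw.exists_continuous
  obtain ⟨ε, hε, hεb⟩ := exists_modulus hWc hW0
  have hub := hu.memLp_top
  have hwb := hw.memLp_top
  obtain ⟨hu1, hu2, hu3⟩ := hu
  obtain ⟨hw1, hw2, hw3⟩ := hw
  have hp := memLp_two_mul hub hw1
  have h1 := hasWeakDeriv_of_remainder (p := hp.toLp _) hwb hub hu3 hw3 hε (fun h => by
    filter_upwards [hp.coeFn_toLp, ae_add_right h hp.coeFn_toLp, hu1.coeFn_toLp,
      ae_add_right h hu1.coeFn_toLp, hw1.coeFn_toLp, ae_add_right h hw1.coeFn_toLp, hWe,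
      ae_add_right h hWe] with x a1 a2 a3 a4 a5 a6 a7 a8
    rw [a1, a2, a3, a4, a5, a6]
    have : u (x + h) * w (x + h) - u x * w x - (w x * (u (x + h) - u x) + u x * (w (x + h) - w x))
      = (w (x + h) - w x) * (u (x + h) - u x) := by ring
    rw [this, norm_mul]
    have := hεb h x
    rw [← a7, ← a8] at this
    gcongr)
  refine (hasWeakDerivFun_coe.mpr h1).congr_ae hp.coeFn_toLp ?_
  filter_upwards [Lp.coeFn_add (bmul w (hu2.toLp _)) (bmul u (hw2.toLp _)),
    coeFn_bmul hwb (hu2.toLp _), coeFn_bmul hub (hw2.toLp _), hu2.coeFn_toLp, hw2.coeFn_toLp]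
    with x a1 a2 a3 a4 a5
  rw [a1, Pi.add_apply, a2, a3, a4, a5]

theorem exists_taylor_bound {F : ℝ → ℝ} (hF : ContDiff ℝ ∞ F) (M : ℝ) :
    ∃ C : ℝ, 0 ≤ C ∧ (∀ a ∈ Icc (-M) M, |deriv F a| ≤ C) ∧ ∀ a ∈ Icc (-M) M, ∀ b ∈ Icc (-M) M,
      |F b - F a| ≤ C * |b - a| ∧ |F b - F a - deriv F a * (b - a)| ≤ C * |b - a| * |b - a| := by
  have hF1 : ContDiff ℝ ∞ (deriv F) := (contDiff_infty_iff_deriv.mp hF).2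
  have hF2 : ContDiff ℝ ∞ (deriv (deriv F)) := (contDiff_infty_iff_deriv.mp hF1).2
  obtain ⟨C₁, hC₁⟩ := isCompact_Icc.exists_bound_of_continuousOn (s := Icc (-M) M)
    hF1.continuous.continuousOn
  obtain ⟨C₂, hC₂⟩ := isCompact_Icc.exists_bound_of_continuousOn (s := Icc (-M) M)
    hF2.continuous.continuousOn
  have hd : Differentiable ℝ F := hF.differentiable (by simp)
  have hd1 : Differentiable ℝ (deriv F) := hF1.differentiable (by simp)
  refine ⟨max 0 (max C₁ C₂), le_max_left _ _, fun a ha => (hC₁ a ha).trans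
    ((le_max_left _ _).trans (le_max_right _ _)), fun a ha b hb => ⟨?_, ?_⟩⟩
  · refine ((convex_Icc (-M) M).norm_image_sub_le_of_norm_deriv_le (fun x _ => hd x) hC₁ ha hb).trans ?_
    exact mul_le_mul_of_nonneg_right ((le_max_left _ _).trans (le_max_right _ _)) (norm_nonneg _)
  · set C := max 0 (max C₁ C₂)
    have hsub : uIcc a b ⊆ Icc (-M) M := uIcc_subset_Icc ha hb
    have h1 : ∀ x ∈ uIcc a b, ‖deriv (fun y => F y - deriv F a * y) x‖ ≤ C * |b - a| := by
      intro x hx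
      have e : deriv (fun y => F y - deriv F a * y) x = deriv F x - deriv F a := by
        rw [deriv_fun_sub (hd x) (by fun_prop)]
        simp
      rw [e]
      refine ((convex_Icc (-M) M).norm_image_sub_le_of_norm_deriv_le (fun x _ => hd1 x) hC₂ ha
        (hsub hx)).trans ?_
      have h3 : ‖x - a‖ ≤ |b - a| := by
        rw [Real.norm_eq_abs]
        exact abs_sub_left_of_mem_uIcc hx
      exact mul_le_mul ((le_max_right _ _).trans (le_max_right _ _)) h3 (norm_nonneg _)
        (le_max_left _ _)
    have h2 := (convex_uIcc a b).norm_image_sub_le_of_norm_deriv_le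
      (f := fun y => F y - deriv F a * y) (fun x _ => by fun_prop) h1 left_mem_uIcc right_mem_uIcc
    rw [Real.norm_eq_abs, Real.norm_eq_abs] at h2
    refine le_of_eq_of_le (congrArg _ ?_) h2
    ring

/-- The values of g stay in a bounded interval, where the Taylor remainder is at most C times the
squared increment; one of the two factors is uniformly small. The condition F(0) = 0 keeps F(g)
square integrable. -/
theorem HasWeakDerivFun.comp {g : ℝ → ℝ} {v : ℝ → ℂ} {F : ℝ → ℝ} (hF : ContDiff ℝ ∞ F)
    (hF0 : F 0 = 0) (h : HasWeakDerivFun (fun x => (g x : ℂ)) v) :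
    HasWeakDerivFun (fun x => (F (g x) : ℂ)) (fun x => ((deriv F (g x) : ℝ) : ℂ) * v x) := by
  obtain ⟨U, hU, hU0, hUe⟩ := h.exists_continuous
  obtain ⟨M, hM0, hM⟩ := exists_bound_of_tendsto_cocompact hU hU0
  obtain ⟨ε, hε, hεb⟩ := exists_modulus hU hU0
  obtain ⟨C, hC0, hC1, hC2⟩ := exists_taylor_bound hF M
  obtain ⟨h1, h2, h3⟩ := h
  have hgM : ∀ᵐ x, g x ∈ Icc (-M) M := by
    filter_upwards [hUe] with x hx
    have := hM x
    rw [← hx, Complex.norm_real, Real.norm_eq_abs] at this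
    exact abs_le.mp this
  have hgm : AEStronglyMeasurable g volume := by
    have := Complex.continuous_re.comp_aestronglyMeasurable h1.1
    simpa using this
  have hp : MemLp (fun x => (F (g x) : ℂ)) 2 volume := by
    refine h1.of_le_mul (c := C) (Complex.continuous_ofReal.comp_aestronglyMeasurable
      (hF.continuous.comp_aestronglyMeasurable hgm)) ?_
    filter_upwards [hgM] with x hx
    have := (hC2 0 ⟨by linarith, hM0⟩ (g x) hx).1
    simpa [hF0] using this
  have hq : MemLp (fun x => ((deriv F (g x) : ℝ) : ℂ)) ∞ volume := by
    refine memLp_top_of_bound (Complex.continuous_ofReal.comp_aestronglyMeasurable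
      ((hF.continuous_deriv (by simp)).comp_aestronglyMeasurable hgm)) C ?_
    filter_upwards [hgM] with x hx
    rw [Complex.norm_real]
    exact hC1 _ hx
  -- The chain rule has a single leading term, so the second coefficient of the remainder lemma is
  -- taken to be 0.
  have h0 : MemLp (fun _ : ℝ => (0 : ℂ)) ∞ volume := memLp_top_const 0
  have hCε : Tendsto (fun h => C * ε h) (𝓝[≠] 0) (𝓝 0) := by simpa using hε.const_mul C
  have key := hasWeakDeriv_of_remainder (p := hp.toLp _) hq h0 h3 h3 hCε (fun h => by
    filter_upwards [hp.coeFn_toLp, ae_add_right h hp.coeFn_toLp, h1.coeFn_toLp,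
      ae_add_right h h1.coeFn_toLp, hgM, ae_add_right h hgM, hUe,
      ae_add_right h hUe] with x a1 a2 a3 a4 a5 a6 a7 a8
    rw [a1, a2, a3, a4]
    have e1 := (hC2 _ a5 _ a6).2
    have e2 := hεb h x
    rw [← a7, ← a8, ← Complex.ofReal_sub, Complex.norm_real, Real.norm_eq_abs] at e2
    have e3 : (F (g (x + h)) : ℂ) - F (g x) - (((deriv F (g x) : ℝ) : ℂ) * ((g (x + h) : ℂ) - g x)
        + 0 * ((g (x + h) : ℂ) - g x))
      = ((F (g (x + h)) - F (g x) - deriv F (g x) * (g (x + h) - g x) : ℝ) : ℂ) := by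
      push_cast; ring
    rw [e3, ← Complex.ofReal_sub, Complex.norm_real, Complex.norm_real, Real.norm_eq_abs,
      Real.norm_eq_abs]
    refine e1.trans ?_
    gcongr)
  refine (hasWeakDerivFun_coe.mpr key).congr_ae hp.coeFn_toLp ?_
  filter_upwards [Lp.coeFn_add (bmul (fun x => ((deriv F (g x) : ℝ) : ℂ)) (h2.toLp _))
    (bmul (fun _ => 0) (h2.toLp _)), coeFn_bmul hq (h2.toLp _), coeFn_bmul h0 (h2.toLp _),
    h2.coeFn_toLp] with x a1 a2 a3 a4
  rw [a1, Pi.add_apply, a2, a3, a4]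
  simp

end SobolevCalculus
end

noncomputable section

/-! ### Integer Sobolev spaces as ranges of (1 + iξ)⁻ᵏ. -/

section HigherSobolev

theorem HasWeakDeriv.add {u u' w w' : L2C} (hu : HasWeakDeriv u u') (hw : HasWeakDeriv w w') :
    HasWeakDeriv (u + w) (u' + w') := by
  rw [HasWeakDeriv, map_add, map_add]
  filter_upwards [hu, hw, Lp.coeFn_add (FT u) (FT w), Lp.coeFn_add (FT u') (FT w')] with x a b c d
  rw [c, d, Pi.add_apply, Pi.add_apply, a, b]
  ring

theorem HasWeakDeriv.const_smul {u u' : L2C} (hu : HasWeakDeriv u u') (a : ℂ) :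
    HasWeakDeriv (a • u) (a • u') := by
  rw [HasWeakDeriv, map_smul, map_smul]
  filter_upwards [hu, Lp.coeFn_smul a (FT u), Lp.coeFn_smul a (FT u')] with x h c d
  rw [c, d, Pi.smul_apply, Pi.smul_apply, h, smul_eq_mul, smul_eq_mul]
  ring

theorem HasWeakDerivFun.add {u u' w w' : ℝ → ℂ} (hu : HasWeakDerivFun u u')
    (hw : HasWeakDerivFun w w') : HasWeakDerivFun (fun x => u x + w x) (fun x => u' x + w' x) := by
  obtain ⟨a, b, h⟩ := hu
  obtain ⟨a', b', h'⟩ := hw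
  exact ⟨a.add a', b.add b', h.add h'⟩

theorem HasWeakDerivFun.const_mul {u u' : ℝ → ℂ} (hu : HasWeakDerivFun u u') (a : ℂ) :
    HasWeakDerivFun (fun x => a * u x) (fun x => a * u' x) := by
  obtain ⟨h1, h2, h⟩ := hu
  exact ⟨h1.const_mul a, h2.const_mul a, h.const_smul a⟩

/-- `g` and its first `k` weak derivatives are square integrable. -/
def MemH : ℕ → (ℝ → ℂ) → Prop
  | 0, g => MemLp g 2 volume
  | k + 1, g => ∃ v, HasWeakDerivFun g v ∧ MemH k v

theorem MemH.memLp {k : ℕ} {g : ℝ → ℂ} (h : MemH k g) : MemLp g 2 volume := by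
  cases k with
  | zero => exact h
  | succ k => exact h.choose_spec.1.choose

theorem MemH.of_succ {k : ℕ} {g : ℝ → ℂ} (h : MemH (k + 1) g) : MemH k g := by
  induction k generalizing g with
  | zero => exact h.memLp
  | succ k ih =>
    obtain ⟨v, hv, hk⟩ := h
    exact ⟨v, hv, ih hk⟩

theorem MemH.congr_ae {k : ℕ} {g g' : ℝ → ℂ} (h : MemH k g) (e : g =ᵐ[volume] g') : MemH k g' := by
  cases k with
  | zero => exact MemLp.ae_eq e h
  | succ k =>
    obtain ⟨v, hv, hk⟩ := h
    exact ⟨v, hv.congr_ae e (ae_eq_refl v), hk⟩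

theorem MemH.add {k : ℕ} {g g' : ℝ → ℂ} (h : MemH k g) (h' : MemH k g') :
    MemH k (fun x => g x + g' x) := by
  induction k generalizing g g' with
  | zero => exact MemLp.add h h'
  | succ k ih =>
    obtain ⟨v, hv, hk⟩ := h
    obtain ⟨v', hv', hk'⟩ := h'
    exact ⟨_, hv.add hv', ih hk hk'⟩

theorem MemH.const_mul {k : ℕ} {g : ℝ → ℂ} (h : MemH k g) (a : ℂ) :
    MemH k (fun x => a * g x) := by
  induction k generalizing g with
  | zero => exact MemLp.const_mul h a
  | succ k ih =>
    obtain ⟨v, hv, hk⟩ := h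
    exact ⟨_, hv.const_mul a, ih hk⟩

/-- The order is at least 1 because L² is not closed under products. In the induction the derivative
wu' + uw' is a sum of products of one order less. -/
theorem MemH.mul {k : ℕ} {g g' : ℝ → ℂ} (h : MemH (k + 1) g) (h' : MemH (k + 1) g') :
    MemH (k + 1) (fun x => g x * g' x) := by
  induction k generalizing g g' with
  | zero =>
    obtain ⟨v, hv, -⟩ := h
    obtain ⟨v', hv', -⟩ := h'
    exact ⟨_, hv.mul hv', (hv.mul hv').choose_spec.1⟩
  | succ k ih =>
    have hg := h.of_succ
    have hg' := h'.of_succ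
    obtain ⟨v, hv, hk⟩ := h
    obtain ⟨v', hv', hk'⟩ := h'
    exact ⟨_, hv.mul hv', (ih hg' hk).add (ih hg hk')⟩

theorem MemH.comp {k : ℕ} {g : ℝ → ℝ} {F : ℝ → ℝ} (hF : ContDiff ℝ ∞ F) (hF0 : F 0 = 0)
    (h : MemH (k + 1) (fun x => (g x : ℂ))) : MemH (k + 1) (fun x => (F (g x) : ℂ)) := by
  induction k generalizing F with
  | zero =>
    obtain ⟨v, hv, -⟩ := h
    exact ⟨_, hv.comp hF hF0, (hv.comp hF hF0).choose_spec.1⟩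
  | succ k ih =>
    have hg := h.of_succ
    obtain ⟨v, hv, hk⟩ := h
    -- Subtracting F'(0) restores the vanishing at 0 needed by the induction; the subtracted part
    -- contributes a constant multiple of v.
    have hF1 : ContDiff ℝ ∞ (fun y => deriv F y - deriv F 0) :=
      ((contDiff_infty_iff_deriv.mp hF).2).sub contDiff_const
    refine ⟨_, hv.comp hF hF0, ?_⟩
    refine (((ih hF1 (sub_self _) hg).mul hk).add (hk.const_mul (deriv F 0 : ℝ))).congr_ae ?_
    refine Eventually.of_forall fun x => ?_
    simp only
    push_cast
    ring

/-- The symbol `(1 + iξ)⁻¹`. -/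
def rhoSymbol (x : ℝ) : ℂ := (1 + Complex.I * x)⁻¹

theorem one_add_I_mul_ne_zero (x : ℝ) : (1 + Complex.I * x : ℂ) ≠ 0 := fun h => by
  have := congrArg Complex.re h
  simp at this

theorem rhoSymbol_ne_zero (x : ℝ) : rhoSymbol x ≠ 0 := inv_ne_zero (one_add_I_mul_ne_zero x)

theorem continuous_rhoSymbol : Continuous rhoSymbol :=
  Continuous.inv₀ (by fun_prop) one_add_I_mul_ne_zero

theorem norm_one_add_I_mul (x : ℝ) : ‖(1 + Complex.I * x : ℂ)‖ = (1 + ‖x‖ ^ 2) ^ (1 / 2 : ℝ) := by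
  rw [← Real.sqrt_eq_rpow, ← Real.sqrt_sq (norm_nonneg (1 + Complex.I * x : ℂ)),
    ← Complex.normSq_eq_norm_sq, Complex.normSq_apply]
  simp [sq]

theorem norm_rhoSymbol_le (x : ℝ) : ‖rhoSymbol x‖ ≤ 1 := by
  rw [rhoSymbol, norm_inv, norm_one_add_I_mul]
  exact inv_le_one_of_one_le₀ (Real.one_le_rpow (by nlinarith [norm_nonneg x]) (by norm_num))

theorem memLp_rhoSymbol_pow (k : ℕ) : MemLp (fun x => rhoSymbol x ^ k) ∞ volume :=
  memLp_top_of_bound' (continuous_rhoSymbol.pow k) (C := 1) fun x => by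
    rw [norm_pow]
    exact pow_le_one₀ (norm_nonneg _) (norm_rhoSymbol_le x)

theorem memLp_derivSymbol :
    MemLp (fun x : ℝ => 2 * Real.pi * Complex.I * x * rhoSymbol x) ∞ volume := by
  have h := norm_rhoSymbol_le
  refine memLp_top_of_bound' (Continuous.mul (by fun_prop) continuous_rhoSymbol)
    (C := 2 * Real.pi * 2) fun x => ?_
  have e : 2 * Real.pi * Complex.I * x * rhoSymbol x = 2 * Real.pi * (1 - rhoSymbol x) := by
    have := one_add_I_mul_ne_zero x
    rw [rhoSymbol]
    field_simp
    ring
  rw [e, norm_mul, norm_mul, Complex.norm_real, Complex.norm_two, Real.norm_of_nonneg Real.pi_pos.le]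
  have := Real.pi_pos
  gcongr
  refine (norm_sub_le _ _).trans ?_
  rw [norm_one]
  linarith [h x]

/-- One step of the induction writes u = ρ(D)(u + u'/(2π)) with ρ = (1 + iξ)⁻¹, both u and u' being
in the range of ρᵏ. -/
theorem memH_iff {k : ℕ} {u : L2C} : MemH k u ↔ ∃ y, u = fmul (fun x => rhoSymbol x ^ k) y := by
  induction k generalizing u with
  | zero =>
    refine ⟨fun _ => ⟨u, ?_⟩, fun _ => Lp.memLp u⟩
    simp only [pow_zero]
    rw [fmul_apply, bmul_one, LinearIsometryEquiv.symm_apply_apply]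
  | succ k ih =>
    have hk := memLp_rhoSymbol_pow k
    have hk1 := memLp_rhoSymbol_pow (k + 1)
    constructor
    · intro h
      have hu := h.of_succ
      obtain ⟨v, hv, hkv⟩ := h
      obtain ⟨h1, h2, h3⟩ := hv
      rw [Lp.toLp_coeFn] at h3
      obtain ⟨y₁, hy₁⟩ := ih.mp hu
      obtain ⟨y₂, hy₂⟩ := ih.mp (hkv.congr_ae h2.coeFn_toLp.symm)
      refine ⟨y₁ + (2 * Real.pi : ℂ)⁻¹ • y₂, ?_⟩
      apply L2C_ext_FT
      have e1 := coeFn_FT_fmul hk y₁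
      have e2 := coeFn_FT_fmul hk y₂
      rw [← hy₁] at e1
      rw [← hy₂] at e2
      have e3 := coeFn_FT_fmul hk1 (y₁ + (2 * Real.pi : ℂ)⁻¹ • y₂)
      rw [map_add FT, map_smul FT] at e3
      filter_upwards [e1, e2, e3, h3, Lp.coeFn_add (FT y₁) ((2 * Real.pi : ℂ)⁻¹ • FT y₂),
        Lp.coeFn_smul (2 * Real.pi : ℂ)⁻¹ (FT y₂)] with x e1 e2 e3 e4 e5 e6
      rw [e3, e5, Pi.add_apply, e6, Pi.smul_apply, smul_eq_mul, pow_succ]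
      have h4 : (Real.pi : ℂ) ≠ 0 := by exact_mod_cast Real.pi_ne_zero
      have h5 : rhoSymbol x * (FT u x + (2 * Real.pi : ℂ)⁻¹ * FT (h2.toLp v) x) = FT u x := by
        rw [e4, rhoSymbol]
        have := one_add_I_mul_ne_zero x
        field_simp
      rw [e1, e2] at h5
      rw [e1]
      linear_combination -h5
    · rintro ⟨y, hy⟩
      have h1 : HasWeakDeriv u (fmul (fun x => rhoSymbol x ^ k)
          (fmul (fun x : ℝ => 2 * Real.pi * Complex.I * x * rhoSymbol x) y)) := by
        filter_upwards [coeFn_FT_fmul hk (fmul (fun x : ℝ => 2 * Real.pi * Complex.I * x * rhoSymbol x) y),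
          coeFn_FT_fmul memLp_derivSymbol y, coeFn_FT_fmul hk1 y] with x a b c
        rw [hy, a, b, c, pow_succ]
        ring
      exact ⟨_, hasWeakDerivFun_coe.mpr h1, ih.mpr ⟨_, rfl⟩⟩

theorem inH_of_memH {k : ℕ} {u : L2C} (h : MemH k u) {s : ℝ} (hs : s ≤ k) : InH s u := by
  obtain ⟨y, hy⟩ := memH_iff.mp h
  rw [inH_iff]
  have hj : Continuous fun x => (japanese s x : ℂ) := (japanese_hasTemperateGrowth s).1.continuous
  refine (Lp.memLp (FT y)).of_le_mul (c := 1) (hj.aestronglyMeasurable.mul (Lp.aestronglyMeasurable _)) ?_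
  filter_upwards [coeFn_FT_fmul (memLp_rhoSymbol_pow k) y] with x hx
  rw [hy, hx, ← mul_assoc, norm_mul]
  gcongr
  rw [norm_mul, Complex.norm_real, norm_pow, rhoSymbol, norm_inv, norm_one_add_I_mul, japanese,
    Real.norm_of_nonneg (by positivity), inv_pow, ← Real.rpow_mul_natCast (by positivity),
    ← div_eq_mul_inv]
  refine div_le_one_of_le₀ (Real.rpow_le_rpow_of_exponent_le ?_ ?_) (by positivity)
  · nlinarith [norm_nonneg x]
  · linarith

end HigherSobolev

/-! ### Regularity of solutions of v = m(D)(q v). -/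

section Regularity

/-- Multiplication by q preserves the range of J, and J is injective, so J⁻¹qJ is defined on all of
L². Its graph is closed, hence it is bounded. -/
theorem exists_conj_of_memH {q : ℝ → ℂ} (hq : MemLp q ∞ volume) {k : ℕ}
    (hqk : ∀ g, MemH k g → MemH k (fun x => q x * g x)) :
    ∃ Q : L2C →L[ℂ] L2C, ∀ y, bmul q (fmul (fun x => rhoSymbol x ^ k) y)
      = fmul (fun x => rhoSymbol x ^ k) (Q y) := by
  set J := fmul (fun x => rhoSymbol x ^ k) with hJ
  have hJi : Function.Injective J := by
    intro a b hab
    apply L2C_ext_FT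
    have h1 := coeFn_FT_fmul (memLp_rhoSymbol_pow k) a
    have h2 := coeFn_FT_fmul (memLp_rhoSymbol_pow k) b
    rw [← hJ] at h1 h2
    rw [hab] at h1
    filter_upwards [h1, h2] with x e1 e2
    rw [e1] at e2
    exact mul_left_cancel₀ (pow_ne_zero k (rhoSymbol_ne_zero x)) e2
  have hex : ∀ y, ∃ z, bmul q (J y) = J z := fun y => by
    refine memH_iff.mp ((hqk _ (memH_iff.mpr ⟨y, rfl⟩)).congr_ae ?_)
    exact (coeFn_bmul hq _).symm
  choose Q hQ using hex
  let Ql : L2C →ₗ[ℂ] L2C :=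
    { toFun := Q
      map_add' := fun a b => hJi (by rw [← hQ, map_add, map_add, map_add, hQ, hQ])
      map_smul' := fun a b => hJi (by
        rw [RingHom.id_apply, ← hQ, map_smul, map_smul, map_smul, hQ]) }
  refine ⟨ContinuousLinearMap.ofSeqClosedGraph (g := Ql) fun u x y hu hy => hJi ?_, hQ⟩
  have h1 : Tendsto (fun n => J (Q (u n))) atTop (𝓝 (J y)) := (J.continuous.tendsto y).comp hy
  have h2 : Tendsto (fun n => bmul q (J (u n))) atTop (𝓝 (bmul q (J x))) :=
    ((bmul q).continuous.tendsto _).comp ((J.continuous.tendsto x).comp hu)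
  simp only [hQ] at h2
  exact tendsto_nhds_unique h1 h2

/-- Split m into low frequencies, whose contribution lies in the range of J, and a remainder K of
small norm. Conjugated by J, the fixed point equation is solved by a y in L² since KQ is a
contraction; as Kq is a contraction on L² as well, v and Jy coincide. -/
theorem memH_of_fixed {q m : ℝ → ℂ} (hq : MemLp q ∞ volume) (hm : MemLp m ∞ volume)
    (hm0 : Tendsto m (cocompact ℝ) (𝓝 0)) {k : ℕ}
    (hqk : ∀ g, MemH k g → MemH k (fun x => q x * g x)) {v : L2C} (hv : v = fmul m (bmul q v)) :
    MemH k v := by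
  obtain ⟨Q, hQ⟩ := exists_conj_of_memH hq hqk
  have hlim : Tendsto (fun n : ℕ => fmul ((Icc (-n : ℝ) n).indicator m)) atTop (𝓝 (fmul m)) :=
    tendsto_clm_comp tendsto_const_nhds
      (tendsto_clm_comp (tendsto_bmul_indicator hm hm0) tendsto_const_nhds)
  -- Using the sum of the two norms lets a single cutoff n make both K∘Q and K∘q contractions.
  have hlim' : Tendsto (fun n : ℕ => ‖fmul m - fmul ((Icc (-n : ℝ) n).indicator m)‖
      * (‖Q‖ + ‖bmul q‖)) atTop (𝓝 0) := by
    have := (tendsto_const_nhds (x := fmul m)).sub hlim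
    simpa using this.norm.mul_const (‖Q‖ + ‖bmul q‖)
  obtain ⟨n, hn⟩ := (hlim'.eventually (gt_mem_nhds one_pos)).exists
  set mn := (Icc (-n : ℝ) n).indicator m with hmn
  have hmn_mem : MemLp mn ∞ volume := hm.indicator measurableSet_Icc
  set K := fmul m - fmul mn with hK
  have hKQ : ‖K ∘L Q‖ < 1 := by
    refine (ContinuousLinearMap.opNorm_comp_le _ _).trans_lt (lt_of_le_of_lt ?_ hn)
    gcongr
    exact le_add_of_nonneg_right (norm_nonneg _)
  have hKq : ‖K ∘L bmul q‖ < 1 := by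
    refine (ContinuousLinearMap.opNorm_comp_le _ _).trans_lt (lt_of_le_of_lt ?_ hn)
    gcongr
    exact le_add_of_nonneg_left (norm_nonneg _)
  set J := fmul (fun x => rhoSymbol x ^ k) with hJ
  have hJm : ∀ {a : ℝ → ℂ}, MemLp a ∞ volume → ∀ u, fmul a (J u) = J (fmul a u) := by
    intro a ha u
    rw [hJ, fmul_fmul ha (memLp_rhoSymbol_pow k), fmul_fmul (memLp_rhoSymbol_pow k) ha]
    simp only [mul_comm]
  have hJK : ∀ u, K (J u) = J (K u) := fun u => by
    rw [hK, sub_apply, sub_apply, map_sub, hJm hm, hJm hmn_mem]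
  -- the low frequency part is smooth
  have hlow : ∃ y₀, fmul mn (bmul q v) = J y₀ := by
    have hb : MemLp (fun x : ℝ => mn x * (1 + Complex.I * x) ^ k) ∞ volume := by
      have h1 : MemLp ((Icc (-n : ℝ) n).indicator fun x : ℝ => (1 + Complex.I * x) ^ k) ∞ volume := by
        have hc : Continuous fun x : ℝ => (1 + Complex.I * x) ^ k := by fun_prop
        obtain ⟨C, hC⟩ := isCompact_Icc.exists_bound_of_continuousOn (s := Icc (-n : ℝ) n)
          hc.continuousOn
        refine memLp_top_of_bound (hc.aestronglyMeasurable.indicator measurableSet_Icc) (max C 0)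
          (Eventually.of_forall fun x => ?_)
        by_cases hx : x ∈ Icc (-n : ℝ) n
        · rw [indicator_of_mem hx]; exact (hC x hx).trans (le_max_left _ _)
        · rw [indicator_of_notMem hx, norm_zero]; exact le_max_right _ _
      refine (memLp_top_mul hm h1).ae_eq (Eventually.of_forall fun x => ?_)
      by_cases hx : x ∈ Icc (-n : ℝ) n
      · simp [mn, indicator_of_mem hx]
      · simp [mn, indicator_of_notMem hx]
    refine ⟨fmul (fun x : ℝ => mn x * (1 + Complex.I * x) ^ k) (bmul q v), ?_⟩
    rw [hJ, fmul_fmul (memLp_rhoSymbol_pow k) hb]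
    congr 2
    ext x
    have := pow_ne_zero k (one_add_I_mul_ne_zero x)
    rw [rhoSymbol, inv_pow]
    field_simp
  obtain ⟨y₀, hy₀⟩ := hlow
  obtain ⟨V, hV⟩ := (isUnit_one_sub_of_norm_lt_one hKQ).exists_right_inv
  have hy : V y₀ - K (Q (V y₀)) = y₀ := congrArg (fun A : L2C →L[ℂ] L2C => A y₀) hV
  set y := V y₀
  have hvJ : v - J y = (K ∘L bmul q) (v - J y) := by
    have h1 : v = K (bmul q v) + J y₀ := by
      rw [← hy₀, hK, sub_apply, sub_add_cancel]
      exact hv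
    have h2 : J y = K (bmul q (J y)) + J y₀ := by
      rw [hQ, hJK, ← map_add]
      congr 1
      rw [← hy]
      abel
    rw [ContinuousLinearMap.comp_apply, map_sub, map_sub]
    nth_rewrite 1 [h1]
    nth_rewrite 1 [h2]
    abel
  have hz : v - J y = 0 := by
    by_contra hne
    have h1 : ‖v - J y‖ ≤ ‖K ∘L bmul q‖ * ‖v - J y‖ := by
      conv_lhs => rw [hvJ]
      exact ContinuousLinearMap.le_opNorm _ _
    nlinarith [norm_pos_iff.mpr hne]
  rw [memH_iff]
  exact ⟨y, sub_eq_zero.mp hz⟩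

end Regularity
end

noncomputable section

/-! ### The linearized operator: eigenvalue equations without domains, growth of the symbol. -/

section Operators

theorem mem_mulOp_domain {m : ℝ → ℝ} {u : L2C} :
    u ∈ (mulOp m).domain ↔ MemLp (fun x => (m x : ℂ) * u x) 2 volume := Iff.rfl

theorem coeFn_mulOp {m : ℝ → ℝ} {u : L2C} (h : u ∈ (mulOp m).domain) :
    mulOp m ⟨u, h⟩ =ᵐ[volume] fun x => (m x : ℂ) * u x :=
  MemLp.coeFn_toLp (mem_mulOp_domain.mp h)

theorem mem_multiplierOp_domain {β : ℝ → ℝ} {u : L2C} :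
    u ∈ (multiplierOp β).domain ↔
      MemLp (fun ξ => (β (2 * Real.pi * ξ) : ℂ) * FT u ξ) 2 volume := Iff.rfl

theorem coeFn_FT_multiplierOp {β : ℝ → ℝ} {u : L2C} (h : u ∈ (multiplierOp β).domain) :
    FT (multiplierOp β ⟨u, h⟩) =ᵐ[volume] fun ξ => (β (2 * Real.pi * ξ) : ℂ) * FT u ξ := by
  have e : multiplierOp β ⟨u, h⟩ =
      FT.symm (MemLp.toLp _ (mem_multiplierOp_domain.mp h)) := rfl
  rw [e, LinearIsometryEquiv.apply_symm_apply]
  exact MemLp.coeFn_toLp _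

theorem mem_eigenspaceOf {T : L2C →ₗ.[ℂ] L2C} {μ : ℝ} {u : L2C} :
    u ∈ eigenspaceOf T μ ↔ ∃ h : u ∈ T.domain, T ⟨u, h⟩ = (μ : ℂ) • u := by
  rw [eigenspaceOf, Submodule.mem_map]
  constructor
  · rintro ⟨⟨y, hy⟩, h1, rfl⟩
    refine ⟨hy, ?_⟩
    rw [LinearMap.mem_ker, LinearMap.sub_apply, sub_eq_zero] at h1
    exact h1
  · rintro ⟨h, h1⟩
    refine ⟨⟨u, h⟩, ?_, rfl⟩
    rw [LinearMap.mem_ker, LinearMap.sub_apply, sub_eq_zero]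
    exact h1

/-- The symbol of `M + c - f'(0)` in the variable of `𝓕`. -/
def waveSymbol (β f : ℝ → ℝ) (c ξ : ℝ) : ℝ := β (2 * Real.pi * ξ) + c - deriv f 0

/-- The localized part `f'(ψ) - f'(0)` of the potential. -/
def wavePotential (f : ℝ → ℝ) (ψ : L2R) (x : ℝ) : ℝ := deriv f (ψ x) - deriv f 0

variable {β f : ℝ → ℝ} {c δ : ℝ} {ψ : L2R}

theorem memLp_top_deriv (hq : MemLp (fun x => (wavePotential f ψ x : ℂ)) ∞ volume) (a b : ℝ) :
    MemLp (fun x => ((a + b * deriv f (ψ x) : ℝ) : ℂ)) ∞ volume := by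
  have h1 := ((memLp_top_const (μ := (volume : Measure ℝ)) ((a + b * deriv f 0 : ℝ) : ℂ)).add
    (hq.const_mul (b : ℂ)))
  refine h1.ae_eq (Eventually.of_forall fun x => ?_)
  simp only [wavePotential, Pi.add_apply]
  push_cast
  ring

theorem mem_mulOp_domain_of_memLp_top {m : ℝ → ℝ} (hm : MemLp (fun x => (m x : ℂ)) ∞ volume)
    (u : L2C) : u ∈ (mulOp m).domain :=
  memLp_two_mul hm (Lp.memLp u)

theorem memLp_top_linOp (hq : MemLp (fun x => (wavePotential f ψ x : ℂ)) ∞ volume) :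
    MemLp (fun x => ((c - deriv f (ψ x) : ℝ) : ℂ)) ∞ volume := by
  refine (memLp_top_deriv hq c (-1)).ae_eq (Eventually.of_forall fun x => ?_)
  simp only
  congr 1
  ring

theorem mem_linOp_domain (hq : MemLp (fun x => (wavePotential f ψ x : ℂ)) ∞ volume) {u : L2C} :
    u ∈ (linOp β f c ψ).domain ↔ u ∈ (multiplierOp β).domain :=
  ⟨fun h => h.1, fun h => ⟨h, mem_mulOp_domain_of_memLp_top (memLp_top_linOp hq) u⟩⟩

theorem mem_multiplierOp_domain_iff {u : L2C} :
    u ∈ (multiplierOp β).domain ↔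
      MemLp (fun ξ => (waveSymbol β f c ξ : ℂ) * FT u ξ) 2 volume := by
  rw [mem_multiplierOp_domain]
  have h1 := (Lp.memLp (FT u)).const_mul ((c - deriv f 0 : ℝ) : ℂ)
  constructor
  · intro h
    refine (h.add h1).ae_eq (Eventually.of_forall fun x => ?_)
    simp only [Pi.add_apply, waveSymbol]
    push_cast
    ring
  · intro h
    refine (h.sub h1).ae_eq (Eventually.of_forall fun x => ?_)
    simp only [Pi.sub_apply, waveSymbol]
    push_cast
    ring

theorem waveSymbol_continuous (hβ : Continuous β) : Continuous (waveSymbol β f c) := by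
  unfold waveSymbol
  fun_prop

theorem memLp_top_real {m : ℝ → ℝ} (hm : Continuous m) {C : ℝ} (hC : ∀ x, |m x| ≤ C) :
    MemLp (fun x => (m x : ℂ)) ∞ (volume : Measure ℝ) :=
  memLp_top_of_bound' (Complex.continuous_ofReal.comp hm) (C := C) fun x => by
    rw [Complex.norm_real]; exact hC x

theorem memLp_top_inv_waveSymbol (hβ : Continuous β) (hδ : 0 < δ)
    (hs : ∀ ξ, δ ≤ waveSymbol β f c ξ) :
    MemLp (fun ξ => (((waveSymbol β f c ξ)⁻¹ : ℝ) : ℂ)) ∞ volume := by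
  have h0 : ∀ ξ, 0 < waveSymbol β f c ξ := fun ξ => hδ.trans_le (hs ξ)
  refine memLp_top_real ((waveSymbol_continuous hβ).inv₀ fun ξ => (h0 ξ).ne') (C := δ⁻¹) fun ξ => ?_
  rw [abs_of_pos (inv_pos.mpr (h0 ξ))]
  exact inv_anti₀ hδ (hs ξ)

/-- Applying S⁻¹ replaces the unbounded operator by bounded ones. Conversely, any solution of the
fixed point equation lies in the range of S⁻¹, hence in the domain. -/
theorem mem_eigenspaceOf_linOp (hβ : Continuous β) (hδ : 0 < δ)
    (hs : ∀ ξ, δ ≤ waveSymbol β f c ξ)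
    (hq : MemLp (fun x => (wavePotential f ψ x : ℂ)) ∞ volume) (μ : ℝ) (u : L2C) :
    u ∈ eigenspaceOf (linOp β f c ψ) μ ↔
      u = fmul (fun ξ => (((waveSymbol β f c ξ)⁻¹ : ℝ) : ℂ))
        (bmul (fun x => (wavePotential f ψ x : ℂ)) u + (μ : ℂ) • u) := by
  have hR := memLp_top_inv_waveSymbol hβ hδ hs
  have h0 : ∀ ξ, (waveSymbol β f c ξ : ℂ) ≠ 0 := fun ξ => by
    exact_mod_cast (hδ.trans_le (hs ξ)).ne'
  rw [mem_eigenspaceOf]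
  set y := bmul (fun x => (wavePotential f ψ x : ℂ)) u + (μ : ℂ) • u with hy
  have hmain : ∀ h : u ∈ (linOp β f c ψ).domain, (linOp β f c ψ ⟨u, h⟩ = (μ : ℂ) • u ↔
      FT y =ᵐ[volume] fun ξ => (waveSymbol β f c ξ : ℂ) * FT u ξ) := by
    intro h
    have e1 : linOp β f c ψ ⟨u, h⟩ = multiplierOp β ⟨u, h.1⟩
      + mulOp (fun x => c - deriv f (ψ x)) ⟨u, h.2⟩ := LinearPMap.add_apply _ _ _
    have e2 : (mulOp (fun x => c - deriv f (ψ x)) ⟨u, h.2⟩ : L2C)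
        = ((c - deriv f 0 : ℝ) : ℂ) • u - bmul (fun x => (wavePotential f ψ x : ℂ)) u := by
      refine Lp.ext ?_
      filter_upwards [coeFn_mulOp h.2, Lp.coeFn_sub (((c - deriv f 0 : ℝ) : ℂ) • u)
        (bmul (fun x => (wavePotential f ψ x : ℂ)) u), Lp.coeFn_smul ((c - deriv f 0 : ℝ) : ℂ) u,
        coeFn_bmul hq u] with x a b d e
      rw [a, b, Pi.sub_apply, d, Pi.smul_apply, e, wavePotential, smul_eq_mul]
      push_cast
      ring
    have e3 : linOp β f c ψ ⟨u, h⟩ = (μ : ℂ) • u ↔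
        y = multiplierOp β ⟨u, h.1⟩ + ((c - deriv f 0 : ℝ) : ℂ) • u := by
      rw [e1, e2, hy]
      constructor
      · intro h'; rw [← h']; abel
      · intro h'
        have : (μ : ℂ) • u = multiplierOp β ⟨u, h.1⟩ + ((c - deriv f 0 : ℝ) : ℂ) • u
          - bmul (fun x => (wavePotential f ψ x : ℂ)) u := by rw [← h']; abel
        rw [this]; abel
    have e4 : FT (multiplierOp β ⟨u, h.1⟩ + ((c - deriv f 0 : ℝ) : ℂ) • u) =ᵐ[volume]
        fun ξ => (waveSymbol β f c ξ : ℂ) * FT u ξ := by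
      rw [map_add, map_smul]
      filter_upwards [Lp.coeFn_add (FT (multiplierOp β ⟨u, h.1⟩)) (((c - deriv f 0 : ℝ) : ℂ) • FT u),
        Lp.coeFn_smul ((c - deriv f 0 : ℝ) : ℂ) (FT u), coeFn_FT_multiplierOp h.1] with x a b d
      rw [a, Pi.add_apply, b, Pi.smul_apply, d, waveSymbol, smul_eq_mul]
      push_cast
      ring
    rw [e3]
    exact ⟨fun h => by rw [h]; exact e4, fun h => L2C_ext_FT (h.trans e4.symm)⟩
  have hfix : u = fmul (fun ξ => (((waveSymbol β f c ξ)⁻¹ : ℝ) : ℂ)) y ↔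
      FT y =ᵐ[volume] fun ξ => (waveSymbol β f c ξ : ℂ) * FT u ξ := by
    have h1 := coeFn_FT_fmul hR y
    constructor
    · intro h
      rw [← h] at h1
      filter_upwards [h1] with ξ a
      rw [a, Complex.ofReal_inv, mul_inv_cancel_left₀ (h0 ξ)]
    · intro h
      apply L2C_ext_FT
      filter_upwards [h1, h] with ξ a b
      rw [a, b, Complex.ofReal_inv, inv_mul_cancel_left₀ (h0 ξ)]
  rw [hfix]
  constructor
  · rintro ⟨h, h1⟩
    exact (hmain h).mp h1
  · intro h1
    have h : u ∈ (linOp β f c ψ).domain := by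
      rw [mem_linOp_domain hq, mem_multiplierOp_domain_iff (f := f) (c := c)]
      exact (Lp.memLp (FT y)).ae_eq h1
    exact ⟨h, (hmain h).mpr h1⟩

/-- An everywhere defined multiplication operator is closed, hence bounded by the closed graph
theorem. Testing on the indicator of a small ball on which m > C > ‖A'‖ gives a contradiction;
continuity of m provides the ball. -/
theorem bound_of_forall_memLp_mul {m : ℝ → ℝ} (hm : Continuous m) (hm0 : ∀ x, 0 ≤ m x)
    (h : ∀ y : L2C, MemLp (fun x => (m x : ℂ) * y x) 2 volume) : ∃ C : ℝ, ∀ x, m x ≤ C := by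
  have hdom : ∀ y : L2C, y ∈ (mulOp m).domain := h
  let A : L2C →ₗ[ℂ] L2C :=
    (mulOp m).toFun ∘ₗ LinearMap.codRestrict (mulOp m).domain LinearMap.id hdom
  have hA : ∀ y, A y =ᵐ[volume] fun x => (m x : ℂ) * y x := fun y => coeFn_mulOp (hdom y)
  have hpos : ∀ x, 0 < 1 + m x := fun x => by linarith [hm0 x]
  have hc1 : Continuous fun x => (1 + m x)⁻¹ := (by fun_prop : Continuous fun x => 1 + m x).inv₀
    fun x => (hpos x).ne'
  have h1 : MemLp (fun x => (((1 + m x)⁻¹ : ℝ) : ℂ)) ∞ (volume : Measure ℝ) :=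
    memLp_top_real hc1 (C := 1) fun x => by
      rw [abs_of_pos (inv_pos.mpr (hpos x))]
      exact inv_le_one_of_one_le₀ (by linarith [hm0 x])
  have h2 : MemLp (fun x => (((1 + m x)⁻¹ * m x : ℝ) : ℂ)) ∞ (volume : Measure ℝ) :=
    memLp_top_real (hc1.mul hm) (C := 1) fun x => by
      rw [abs_of_nonneg (mul_nonneg (inv_pos.mpr (hpos x)).le (hm0 x)), inv_mul_le_iff₀ (hpos x)]
      linarith [hm0 x]
  have e : ∀ y, bmul (fun x => (((1 + m x)⁻¹ : ℝ) : ℂ)) (A y)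
      = bmul (fun x => (((1 + m x)⁻¹ * m x : ℝ) : ℂ)) y := by
    intro y
    refine Lp.ext ?_
    filter_upwards [coeFn_bmul h1 (A y), coeFn_bmul h2 y, hA y] with x a b d
    rw [a, b, d]
    push_cast
    ring
  have hinj : ∀ a b : L2C, bmul (fun x => (((1 + m x)⁻¹ : ℝ) : ℂ)) a
      = bmul (fun x => (((1 + m x)⁻¹ : ℝ) : ℂ)) b → a = b := by
    intro a b hab
    refine Lp.ext ?_
    have ha := coeFn_bmul h1 a
    rw [hab] at ha
    filter_upwards [ha, coeFn_bmul h1 b] with x h3 h4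
    rw [h3] at h4
    refine mul_left_cancel₀ ?_ h4
    exact_mod_cast (inv_pos.mpr (hpos x)).ne'
  let A' : L2C →L[ℂ] L2C := ContinuousLinearMap.ofSeqClosedGraph (g := A) fun u x y hu hy => by
    refine hinj _ _ ?_
    have t1 := ((bmul (fun x => (((1 + m x)⁻¹ : ℝ) : ℂ))).continuous.tendsto y).comp hy
    have t2 := ((bmul (fun x => (((1 + m x)⁻¹ * m x : ℝ) : ℂ))).continuous.tendsto x).comp hu
    have e' : (⇑(bmul (fun x => (((1 + m x)⁻¹ : ℝ) : ℂ))) ∘ ⇑A ∘ u)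
        = (⇑(bmul (fun x => (((1 + m x)⁻¹ * m x : ℝ) : ℂ))) ∘ u) := funext fun n => e (u n)
    rw [e'] at t1
    rw [tendsto_nhds_unique t1 t2, e]
  refine ⟨‖A'‖, fun x₀ => ?_⟩
  by_contra! hx
  obtain ⟨C, hC1, hC2⟩ := exists_between hx
  obtain ⟨r, hr, hball⟩ := Metric.eventually_nhds_iff_ball.mp
    (hm.continuousAt.eventually (lt_mem_nhds hC2))
  set y : L2C := indicatorConstLp 2 (measurableSet_ball (x := x₀) (ε := r))
    (measure_ball_lt_top.ne) (1 : ℂ) with hy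
  have hyn : 0 < ‖y‖ := by
    rw [hy, norm_indicatorConstLp (by norm_num) (by norm_num), norm_one, one_mul]
    refine Real.rpow_pos_of_pos ?_ _
    rw [Measure.real, ENNReal.toReal_pos_iff]
    exact ⟨Metric.measure_ball_pos _ _ hr, measure_ball_lt_top⟩
  have hC0 : 0 ≤ C := (norm_nonneg A').trans hC1.le
  have h3 : C * ‖y‖ ≤ ‖A' y‖ := by
    have h4 : ‖(C : ℂ) • y‖ ≤ ‖A' y‖ := by
      refine Lp.norm_le_norm_of_ae_le ?_
      filter_upwards [hA y, Lp.coeFn_smul (C : ℂ) y, (indicatorConstLp_coeFn : y =ᵐ[volume] _)]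
        with x a b d
      have e5 : (A' y : ℝ → ℂ) x = (m x : ℂ) * y x := a
      rw [e5, b, Pi.smul_apply, smul_eq_mul, d, norm_mul, norm_mul, Complex.norm_real,
        Complex.norm_real, Real.norm_of_nonneg hC0, Real.norm_of_nonneg (hm0 x)]
      by_cases hxb : x ∈ Metric.ball x₀ r
      · exact mul_le_mul_of_nonneg_right (hball x hxb).le (norm_nonneg _)
      · rw [indicator_of_notMem hxb]; simp
    rwa [norm_smul, Complex.norm_real, Real.norm_of_nonneg hC0] at h4
  have h5 := A'.le_opNorm y
  nlinarith

theorem japanese_pos (s x : ℝ) : 0 < japanese s x := by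
  unfold japanese
  positivity

theorem continuous_japanese (s : ℝ) : Continuous (japanese s) := by
  unfold japanese
  refine Continuous.rpow_const (by fun_prop) fun x => Or.inl ?_
  positivity

/-- S⁻¹ maps L² into the domain of N, which is H^α, so the quotient of (1 + ξ²)^{α/2} by s
multiplies L² into itself and is therefore bounded. -/
theorem exists_japanese_le_waveSymbol {α : ℝ} (hβ : Continuous β) (hδ : 0 < δ)
    (hs : ∀ ξ, δ ≤ waveSymbol β f c ξ)
    (hq : MemLp (fun x => (wavePotential f ψ x : ℂ)) ∞ volume)
    (hdom : ∀ u : L2C, u ∈ (linOp β f c ψ).domain ↔ InH α u) :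
    ∃ C : ℝ, ∀ ξ, japanese α ξ ≤ C * waveSymbol β f c ξ := by
  have h0 : ∀ ξ, 0 < waveSymbol β f c ξ := fun ξ => hδ.trans_le (hs ξ)
  have hR := memLp_top_inv_waveSymbol hβ hδ hs
  obtain ⟨C, hC⟩ := bound_of_forall_memLp_mul (m := fun ξ => japanese α ξ * (waveSymbol β f c ξ)⁻¹)
    ((continuous_japanese α).mul ((waveSymbol_continuous hβ).inv₀ fun ξ => (h0 ξ).ne'))
    (fun ξ => mul_nonneg (japanese_pos α ξ).le (inv_pos.mpr (h0 ξ)).le) (fun y => by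
      have h1 := coeFn_FT_fmul hR (FT.symm y)
      rw [LinearIsometryEquiv.apply_symm_apply] at h1
      have h2 : fmul (fun ξ => (((waveSymbol β f c ξ)⁻¹ : ℝ) : ℂ)) (FT.symm y)
          ∈ (linOp β f c ψ).domain := by
        rw [mem_linOp_domain hq, mem_multiplierOp_domain_iff (f := f) (c := c)]
        refine (Lp.memLp y).ae_eq ?_
        filter_upwards [h1] with ξ a
        rw [a, Complex.ofReal_inv, mul_inv_cancel_left₀]
        exact_mod_cast (h0 ξ).ne'
      rw [hdom, inH_iff] at h2
      refine h2.ae_eq ?_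
      filter_upwards [h1] with ξ a
      rw [a]
      push_cast
      ring)
  refine ⟨C, fun ξ => ?_⟩
  have := hC ξ
  rwa [← div_eq_mul_inv, div_le_iff₀ (h0 ξ)] at this

theorem tendsto_inv_waveSymbol {α : ℝ} (hα : 0 < α) (hδ : 0 < δ)
    (hs : ∀ ξ, δ ≤ waveSymbol β f c ξ) {C : ℝ}
    (hC : ∀ ξ, japanese α ξ ≤ C * waveSymbol β f c ξ) :
    Tendsto (fun ξ => (waveSymbol β f c ξ)⁻¹) (cocompact ℝ) (𝓝 0) := by
  have h0 : ∀ ξ, 0 < waveSymbol β f c ξ := fun ξ => hδ.trans_le (hs ξ)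
  have hCpos : 0 < C := by
    by_contra! h
    nlinarith [hC 0, h0 0, japanese_pos α 0]
  have h1 : Tendsto (fun ξ : ℝ => japanese α ξ) (cocompact ℝ) atTop := by
    refine (tendsto_rpow_atTop (half_pos hα)).comp ?_
    refine tendsto_atTop_add_const_left _ _ ?_
    exact (tendsto_pow_atTop two_ne_zero).comp (tendsto_norm_cocompact_atTop (E := ℝ))
  refine (tendsto_inv_atTop_zero.comp (tendsto_atTop_mono (fun ξ => ?_) (h1.const_mul_atTop (inv_pos.mpr hCpos))))
  rw [inv_mul_le_iff₀ hCpos]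
  exact hC ξ

end Operators
end

noncomputable section

/-! ### Differentiating the wave equation in the speed. -/

section WaveCurve

theorem japanese_neg (s x : ℝ) : japanese (-s) x = (japanese s x)⁻¹ := by
  rw [japanese, japanese, neg_div, Real.rpow_neg (by positivity)]

theorem japanese_neg_le_one {s : ℝ} (hs : 0 ≤ s) (x : ℝ) : japanese (-s) x ≤ 1 := by
  rw [japanese_neg, japanese]
  exact inv_le_one_of_one_le₀ (Real.one_le_rpow (by nlinarith [norm_nonneg x]) (by linarith))

theorem memLp_top_japanese_neg {s : ℝ} (hs : 0 ≤ s) :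
    MemLp (fun x => (japanese (-s) x : ℂ)) ∞ (volume : Measure ℝ) :=
  memLp_top_real (continuous_japanese _) (C := 1) fun x => by
    rw [abs_of_pos (japanese_pos _ _)]; exact japanese_neg_le_one hs x

theorem eq_fmul_of_besselPotential_eq {s : ℝ} (hs : 0 ≤ s) {u g : L2C}
    (h : TemperedDistribution.besselPotential ℝ ℂ s (u : 𝓢'(ℝ, ℂ)) = (g : 𝓢'(ℝ, ℂ))) :
    u = fmul (fun x => (japanese (-s) x : ℂ)) g := by
  rw [besselPotential_eq_iff] at h
  apply L2C_ext_FT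
  filter_upwards [h, coeFn_FT_fmul (memLp_top_japanese_neg hs) g] with x a b
  rw [b, a, japanese_neg, Complex.ofReal_inv, inv_mul_cancel_left₀]
  exact_mod_cast (japanese_pos s x).ne'

theorem memLp_two_japanese_neg {s : ℝ} (hs : 1 ≤ s) :
    MemLp (fun x => (japanese (-s) x : ℂ)) 2 (volume : Measure ℝ) := by
  have hc : Continuous fun x => (japanese (-s) x : ℂ) :=
    Complex.continuous_ofReal.comp (continuous_japanese _)
  rw [memLp_two_iff_integrable_sq_norm hc.aestronglyMeasurable]
  refine integrable_inv_one_add_sq.mono' (hc.norm.pow 2).aestronglyMeasurable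
    (Eventually.of_forall fun x => ?_)
  rw [Complex.norm_real, norm_pow, norm_norm, Real.norm_of_nonneg (japanese_pos _ _).le, japanese,
    ← Real.rpow_mul_natCast (by positivity), ← Real.rpow_neg_one, Real.norm_eq_abs, sq_abs]
  refine Real.rpow_le_rpow_of_exponent_le (by nlinarith [sq_nonneg x]) ?_
  push_cast
  linarith

/-- Sobolev embedding: the sup norm is at most the L¹ norm of the transform, and Cauchy–Schwarz
applies because (1 + ξ²)^{-s/2} is square integrable for s ≥ 1. -/
theorem exists_sup_bound {s : ℝ} (hs : 1 ≤ s) :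
    ∃ K : ℝ, 0 ≤ K ∧ ∀ y : L2C, ∀ᵐ x, ‖fmul (fun x => (japanese (-s) x : ℂ)) y x‖ ≤ K * ‖y‖ := by
  have hk := memLp_two_japanese_neg hs
  have ht := memLp_top_japanese_neg (zero_le_one.trans hs)
  refine ⟨‖hk.toLp _‖, norm_nonneg _, fun y => ?_⟩
  set u := fmul (fun x => (japanese (-s) x : ℂ)) y with hu
  obtain ⟨h1, h2⟩ := integral_norm_mul_norm_le (hk.toLp _) (FT y)
  rw [LinearIsometryEquiv.norm_map] at h2
  have e : (fun x => ‖hk.toLp _ x‖ * ‖FT y x‖) =ᵐ[volume] fun x => ‖FT u x‖ := by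
    filter_upwards [hk.coeFn_toLp, coeFn_FT_fmul ht y] with x a b
    rw [b, a, norm_mul]
  have hi : Integrable (FT u) :=
    (integrable_norm_iff (Lp.aestronglyMeasurable _)).mp (h1.congr e)
  rw [integral_congr_ae e] at h2
  have h3 := FT_symm_toLp_ae_eq hi (Lp.memLp (FT u))
  rw [Lp.toLp_coeFn, LinearIsometryEquiv.symm_apply_apply] at h3
  filter_upwards [h3] with x hx
  rw [hx]
  refine le_trans ?_ h2
  rw [Real.fourierInv_eq]
  refine (norm_integral_le_integral_norm _).trans_eq ?_
  simp

/-- The uniform smallness of ψ_{c'} − ψ_c makes the Taylor remainder at most Cε(c')‖ψ_{c'} − ψ_c‖ in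
L², which is o(c' − c). L² differentiability of the curve alone would not control the superposition
F(ψ). -/
theorem hasDerivWithinAt_comp_of_sup {I : Set ℝ} {c : ℝ} (hc : c ∈ I) {ψ : ℝ → L2R} {ψ' : L2R}
    {G : ℝ → L2C} {F : ℝ → ℝ} (hF : ContDiff ℝ ∞ F)
    (hG : ∀ c' ∈ I, G c' =ᵐ[volume] fun x => (F (ψ c' x) : ℂ))
    (hψ : HasDerivWithinAt ψ ψ' I c) {ε : ℝ → ℝ} (hε : Tendsto ε (𝓝[I] c) (𝓝 0))
    (hsup : ∀ c' ∈ I, ∀ᵐ x, |ψ c' x - ψ c x| ≤ ε c') {M : ℝ} (hM : ∀ᵐ x, |ψ c x| ≤ M)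
    (hq : MemLp (fun x => ((deriv F (ψ c x) : ℝ) : ℂ)) ∞ volume) :
    HasDerivWithinAt G (bmul (fun x => ((deriv F (ψ c x) : ℝ) : ℂ)) (complexify ψ')) I c := by
  set q : ℝ → ℂ := fun x => ((deriv F (ψ c x) : ℝ) : ℂ) with hqd
  let A : L2R →L[ℝ] L2C := (bmul q).restrictScalars ℝ ∘L complexifyL
  have h1 : HasDerivWithinAt (fun c' => A (ψ c')) (A ψ') I c :=
    A.hasFDerivAt.comp_hasDerivWithinAt c hψ
  -- For c' near c the values of ψ_{c'} stay within 1 of those of ψ_c, hence the radius M + 1.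
  obtain ⟨C, hC0, -, hC⟩ := exists_taylor_bound hF (M + 1)
  have h2 : HasDerivWithinAt (fun c' => G c' - A (ψ c')) 0 I c := by
    rw [hasDerivWithinAt_iff_isLittleO]
    have hO : (fun c' => ψ c' - ψ c) =O[𝓝[I] c] fun c' => c' - c :=
      hψ.hasFDerivWithinAt.isBigO_sub
    have ho : (fun c' => (C * ε c') * ‖ψ c' - ψ c‖) =o[𝓝[I] c] fun c' => (1 : ℝ) * (c' - c) := by
      refine Asymptotics.IsLittleO.mul_isBigO ?_ hO.norm_left
      rw [Asymptotics.isLittleO_one_iff]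
      simpa using hε.const_mul C
    simp only [one_mul] at ho
    refine Asymptotics.IsBigO.trans_isLittleO (Asymptotics.IsBigO.of_bound 1 ?_) ho
    filter_upwards [self_mem_nhdsWithin, hε.eventually (gt_mem_nhds one_pos)] with c' hc' hε1
    rw [smul_zero, sub_zero, one_mul]
    refine le_trans ?_ (le_abs_self _)
    have e1 : ‖complexify (ψ c' - ψ c)‖ = ‖ψ c' - ψ c‖ := norm_complexify _
    rw [← e1]
    refine Lp.norm_le_mul_norm_of_ae_le_mul ?_
    have e2 : G c' - A (ψ c') - (G c - A (ψ c)) = G c' - G c - bmul q (complexify (ψ c' - ψ c)) := by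
      have : bmul q (complexify (ψ c' - ψ c)) = A (ψ c') - A (ψ c) := A.map_sub _ _
      rw [this]; abel
    rw [e2]
    filter_upwards [Lp.coeFn_sub (G c' - G c) (bmul q (complexify (ψ c' - ψ c))),
      Lp.coeFn_sub (G c') (G c), hG c' hc', hG c hc, coeFn_bmul hq (complexify (ψ c' - ψ c)),
      coeFn_complexify (ψ c' - ψ c), Lp.coeFn_sub (ψ c') (ψ c), hsup c' hc', hM]
      with x a1 a2 a3 a4 a5 a6 a7 a8 a9
    have b1 : ψ c x ∈ Icc (-(M + 1)) (M + 1) := by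
      rw [mem_Icc, ← abs_le]; linarith
    have b2 : ψ c' x ∈ Icc (-(M + 1)) (M + 1) := by
      rw [mem_Icc, ← abs_le]
      have := abs_sub_abs_le_abs_sub (ψ c' x) (ψ c x)
      linarith
    have b3 := (hC _ b1 _ b2).2
    rw [a1, Pi.sub_apply, a2, Pi.sub_apply, a3, a4, a5, a6, a7, Pi.sub_apply, hqd]
    rw [← Complex.ofReal_sub, ← Complex.ofReal_mul, ← Complex.ofReal_sub, Complex.norm_real,
      Complex.norm_real, Real.norm_eq_abs, Real.norm_eq_abs]
    refine b3.trans ?_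
    gcongr
  have h3 := h2.add h1
  rw [zero_add] at h3
  refine h3.congr_of_mem (fun c' _ => ?_) hc
  simp

theorem uniqueDiffWithinAt_of_ordConnected {I : Set ℝ} (hI : I.OrdConnected) (hn : I.Nontrivial)
    {c : ℝ} (hc : c ∈ I) : UniqueDiffWithinAt ℝ I c :=
  uniqueDiffWithinAt_convex hI.convex (hI.convex.nontrivial_iff_nonempty_interior.mp hn)
    (subset_closure hc)

/-- With S and its inverse R taken at the fixed speed c, the equation at speed c' reads ψ + (c' −
c)Rψ = R(f(ψ) − f'(0)ψ). The operators are bounded and independent of c', so both sides can be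
differentiated at c' = c. The resulting identity is N∂_cψ = −ψ. -/
theorem exists_deriv_wave {α : ℝ} (hα : 0 < α) {β f : ℝ → ℝ} (hβ : Continuous β)
    (hf : ContDiff ℝ ∞ f) {I : Set ℝ} (hI : I.OrdConnected) (hn : I.Nontrivial) {ψ : ℝ → L2R}
    (hψ_curve : IsC1CurveInH (α + 1) I ψ) (hψ_wave : ∀ c ∈ I, IsSolitaryWave β f c (ψ c))
    {c : ℝ} (hc : c ∈ I) {δ : ℝ} (hδ : 0 < δ) (hs : ∀ ξ, δ ≤ waveSymbol β f c ξ)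
    (hq : MemLp (fun x => (wavePotential f (ψ c) x : ℂ)) ∞ volume) :
    ∃ ψ' : L2R, HasDerivWithinAt ψ ψ' I c ∧
      complexify ψ' = fmul (fun ξ => (((waveSymbol β f c ξ)⁻¹ : ℝ) : ℂ))
        (bmul (fun x => (wavePotential f (ψ c) x : ℂ)) (complexify ψ') - complexify (ψ c)) := by
  obtain ⟨g, hg, hgψ⟩ := hψ_curve
  have hα1 : 0 ≤ α + 1 := by linarith
  set J := fmul (fun x => (japanese (-(α + 1)) x : ℂ)) with hJ
  set R := fmul (fun ξ => (((waveSymbol β f c ξ)⁻¹ : ℝ) : ℂ)) with hR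
  have hRm := memLp_top_inv_waveSymbol (f := f) (c := c) hβ hδ hs
  have hu := uniqueDiffWithinAt_of_ordConnected hI hn hc
  have hψJ : ∀ c' ∈ I, complexify (ψ c') = J (g c') := fun c' hc' =>
    eq_fmul_of_besselPotential_eq hα1 (hgψ c' hc')
  have hgd : HasDerivWithinAt g (derivWithin g I c) I c :=
    ((hg.differentiableOn (by norm_num)) c hc).hasDerivWithinAt
  obtain ⟨K, hK0, hK⟩ := exists_sup_bound (s := α + 1) (by linarith)
  set ψ' : L2R := reL (J (derivWithin g I c)) with hψ'
  have hψd : HasDerivWithinAt ψ ψ' I c := by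
    have h1 : HasDerivWithinAt (fun c' => (reL ∘L J.restrictScalars ℝ) (g c'))
        ((reL ∘L J.restrictScalars ℝ) (derivWithin g I c)) I c :=
      (reL ∘L J.restrictScalars ℝ).hasFDerivAt.comp_hasDerivWithinAt c hgd
    refine h1.congr_of_mem (fun c' hc' => ?_) hc
    change ψ c' = reL (J (g c'))
    rw [← hψJ c' hc', reL_complexify]
  refine ⟨ψ', hψd, ?_⟩
  have hsup : ∀ c' ∈ I, ∀ᵐ x, |ψ c' x - ψ c x| ≤ K * ‖g c' - g c‖ := by
    intro c' hc'
    have e : complexify (ψ c' - ψ c) = J (g c' - g c) := by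
      rw [complexify_sub, hψJ c' hc', hψJ c hc, map_sub]
    filter_upwards [hK (g c' - g c), coeFn_complexify (ψ c' - ψ c), Lp.coeFn_sub (ψ c') (ψ c)]
      with x h1 h2 h3
    rw [← hJ, ← e, h2, h3, Pi.sub_apply, Complex.norm_real] at h1
    exact h1
  have hM : ∀ᵐ x, |ψ c x| ≤ K * ‖g c‖ := by
    filter_upwards [hK (g c), coeFn_complexify (ψ c)] with x h1 h2
    rw [← hJ, ← hψJ c hc, h2, Complex.norm_real] at h1
    exact h1
  have hε : Tendsto (fun c' => K * ‖g c' - g c‖) (𝓝[I] c) (𝓝 0) := by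
    have := ((hgd.continuousWithinAt.tendsto.sub_const (g c)).norm.const_mul K)
    simpa using this
  -- the equation of the wave, solved for the linear part
  have hwave : ∀ c' ∈ I, ∃ G : L2C, G =ᵐ[volume] (fun x => ((f (ψ c' x) - deriv f 0 * ψ c' x : ℝ) : ℂ))
      ∧ complexify (ψ c') + ((c' - c : ℝ) : ℂ) • R (complexify (ψ c')) = R G := by
    intro c' hc'
    obtain ⟨hd, hw⟩ := hψ_wave c' hc'
    refine ⟨multiplierOp β ⟨complexify (ψ c'), hd⟩ + ((c' - deriv f 0 : ℝ) : ℂ) • complexify (ψ c'),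
      ?_, ?_⟩
    · filter_upwards [hw, Lp.coeFn_add (multiplierOp β ⟨complexify (ψ c'), hd⟩)
        (((c' - deriv f 0 : ℝ) : ℂ) • complexify (ψ c')),
        Lp.coeFn_smul ((c' - deriv f 0 : ℝ) : ℂ) (complexify (ψ c')), coeFn_complexify (ψ c')]
        with x a1 a2 a3 a4
      rw [a2, Pi.add_apply, a3, Pi.smul_apply, a4, smul_eq_mul]
      push_cast at a1 ⊢
      linear_combination a1
    · apply L2C_ext_FT
      rw [map_add, map_smul]
      filter_upwards [Lp.coeFn_add (FT (complexify (ψ c')))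
        (((c' - c : ℝ) : ℂ) • FT (R (complexify (ψ c')))),
        Lp.coeFn_smul ((c' - c : ℝ) : ℂ) (FT (R (complexify (ψ c')))),
        coeFn_FT_fmul hRm (complexify (ψ c')),
        coeFn_FT_fmul hRm (multiplierOp β ⟨complexify (ψ c'), hd⟩
          + ((c' - deriv f 0 : ℝ) : ℂ) • complexify (ψ c')),
        coeFn_FT_multiplierOp hd,
        Lp.coeFn_add (FT (multiplierOp β ⟨complexify (ψ c'), hd⟩))
          (((c' - deriv f 0 : ℝ) : ℂ) • FT (complexify (ψ c'))),
        Lp.coeFn_smul ((c' - deriv f 0 : ℝ) : ℂ) (FT (complexify (ψ c')))]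
        with ξ a1 a2 a3 a4 a5 a6 a7
      rw [a1, Pi.add_apply, a2, Pi.smul_apply, a3, a4, map_add, map_smul, a6, Pi.add_apply, a7,
        Pi.smul_apply, a5, smul_eq_mul, smul_eq_mul]
      have h0 : (waveSymbol β f c ξ : ℂ) ≠ 0 := by
        exact_mod_cast (hδ.trans_le (hs ξ)).ne'
      rw [Complex.ofReal_inv]
      field_simp
      rw [waveSymbol]
      push_cast
      ring
  choose! G hG hGR using hwave
  have hfd : Differentiable ℝ f := hf.differentiable (by simp)
  have hderF : ∀ y, deriv (fun y => f y - deriv f 0 * y) y = deriv f y - deriv f 0 := by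
    intro y
    rw [deriv_fun_sub (hfd y) (by fun_prop)]
    simp
  have hq' : MemLp (fun x => ((deriv (fun y => f y - deriv f 0 * y) (ψ c x) : ℝ) : ℂ)) ∞ volume := by
    simp only [hderF]
    exact hq
  have hGd := hasDerivWithinAt_comp_of_sup hc (F := fun y => f y - deriv f 0 * y)
    (hf.sub (contDiff_const.mul contDiff_id)) hG hψd hε hsup hM hq'
  simp only [hderF] at hGd
  have d1 : HasDerivWithinAt (fun c' => R (G c'))
      (R (bmul (fun x => (wavePotential f (ψ c) x : ℂ)) (complexify ψ'))) I c :=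
    (R.restrictScalars ℝ).hasFDerivAt.comp_hasDerivWithinAt c hGd
  have d2 : HasDerivWithinAt (fun c' => complexify (ψ c')) (complexify ψ') I c :=
    complexifyL.hasFDerivAt.comp_hasDerivWithinAt c hψd
  have d3 : HasDerivWithinAt (fun c' => R (complexify (ψ c'))) (R (complexify ψ')) I c :=
    (R.restrictScalars ℝ).hasFDerivAt.comp_hasDerivWithinAt c d2
  have d4 : HasDerivWithinAt (fun c' : ℝ => c' - c) 1 I c :=
    (hasDerivWithinAt_id c I).sub_const c
  have d5 := d2.add (d4.smul d3)
  have d6 : HasDerivWithinAt (fun c' => R (G c'))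
      (complexify ψ' + ((c - c) • R (complexify ψ') + (1 : ℝ) • R (complexify (ψ c)))) I c := by
    refine d5.congr_of_mem (fun c' hc' => ?_) hc
    rw [← hGR c' hc', Complex.coe_smul]
    rfl
  have h := (d1.derivWithin hu).symm.trans (d6.derivWithin hu)
  rw [map_sub, h]
  simp

end WaveCurve
end

noncomputable section

/-! ### The operator S^{-1/2} q S^{-1/2} and the negative index. -/

section LinearizedOperator

theorem inner_fmul_ofReal {a : ℝ → ℝ} (ha : MemLp (fun ξ => (a ξ : ℂ)) ∞ volume) (u v : L2C) :
    inner ℂ (fmul (fun ξ => (a ξ : ℂ)) u) v = inner ℂ u (fmul (fun ξ => (a ξ : ℂ)) v) := by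
  rw [inner_fmul_left ha]
  simp

theorem inner_bmul_ofReal {a : ℝ → ℝ} (ha : MemLp (fun x => (a x : ℂ)) ∞ volume) (u v : L2C) :
    inner ℂ (bmul (fun x => (a x : ℂ)) u) v = inner ℂ u (bmul (fun x => (a x : ℂ)) v) := by
  have h : (fun x => star (a x : ℂ)) = fun x => (a x : ℂ) := by simp
  rw [inner_bmul_left ha (by rwa [h]), h]

/-- The symbol `s^{-1/2}`. -/
def invSqrt (s : ℝ → ℝ) (ξ : ℝ) : ℝ := (√(s ξ))⁻¹

variable {s q : ℝ → ℝ} {δ : ℝ}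

theorem continuous_invSqrt (hs : Continuous s) (hδ : 0 < δ) (hsδ : ∀ ξ, δ ≤ s ξ) :
    Continuous (invSqrt s) :=
  hs.sqrt.inv₀ fun ξ => (Real.sqrt_pos.mpr (hδ.trans_le (hsδ ξ))).ne'

theorem abs_invSqrt_le (hδ : 0 < δ) (hsδ : ∀ ξ, δ ≤ s ξ) (ξ : ℝ) : |invSqrt s ξ| ≤ (√δ)⁻¹ := by
  rw [invSqrt, abs_of_nonneg (by positivity)]
  exact inv_anti₀ (Real.sqrt_pos.mpr hδ) (Real.sqrt_le_sqrt (hsδ ξ))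

theorem memLp_invSqrt (hs : Continuous s) (hδ : 0 < δ) (hsδ : ∀ ξ, δ ≤ s ξ) :
    MemLp (fun ξ => (invSqrt s ξ : ℂ)) ∞ volume :=
  memLp_top_real (continuous_invSqrt hs hδ hsδ) (abs_invSqrt_le hδ hsδ)

theorem memLp_inv (hs : Continuous s) (hδ : 0 < δ) (hsδ : ∀ ξ, δ ≤ s ξ) :
    MemLp (fun ξ => (((s ξ)⁻¹ : ℝ) : ℂ)) ∞ volume := by
  have h0 : ∀ ξ, 0 < s ξ := fun ξ => hδ.trans_le (hsδ ξ)
  refine memLp_top_real (hs.inv₀ fun ξ => (h0 ξ).ne') (C := δ⁻¹) fun ξ => ?_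
  rw [abs_of_pos (inv_pos.mpr (h0 ξ))]
  exact inv_anti₀ hδ (hsδ ξ)

theorem invSqrt_mul_self (hδ : 0 < δ) (hsδ : ∀ ξ, δ ≤ s ξ) (ξ : ℝ) :
    invSqrt s ξ * invSqrt s ξ = (s ξ)⁻¹ := by
  rw [invSqrt, ← mul_inv, Real.mul_self_sqrt (hδ.trans_le (hsδ ξ)).le]

theorem fmul_invSqrt_sq (hs : Continuous s) (hδ : 0 < δ) (hsδ : ∀ ξ, δ ≤ s ξ) (u : L2C) :
    fmul (fun ξ => (invSqrt s ξ : ℂ)) (fmul (fun ξ => (invSqrt s ξ : ℂ)) u)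
      = fmul (fun ξ => (((s ξ)⁻¹ : ℝ) : ℂ)) u := by
  rw [fmul_fmul (memLp_invSqrt hs hδ hsδ) (memLp_invSqrt hs hδ hsδ)]
  congr 2
  ext ξ
  rw [← invSqrt_mul_self hδ hsδ ξ, Complex.ofReal_mul]

theorem tendsto_invSqrt (hlim : Tendsto (fun ξ => (s ξ)⁻¹) (cocompact ℝ) (𝓝 0)) :
    Tendsto (fun ξ => (invSqrt s ξ : ℂ)) (cocompact ℝ) (𝓝 0) := by
  have h := hlim.sqrt
  rw [Real.sqrt_zero] at h
  have h2 := (Complex.continuous_ofReal.tendsto 0).comp h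
  rw [Complex.ofReal_zero] at h2
  refine h2.congr fun ξ => ?_
  simp [invSqrt, Real.sqrt_inv]

/-- The compact operator `S^{-1/2} q S^{-1/2}` on `L²(ℝ; ℂ)`. -/
def birmanSchwinger (s q : ℝ → ℝ) : L2C →L[ℂ] L2C :=
  fmul (fun ξ => (invSqrt s ξ : ℂ)) ∘L bmul (fun x => (q x : ℂ)) ∘L fmul (fun ξ => (invSqrt s ξ : ℂ))

theorem conjL_fmul_ofReal {a : ℝ → ℝ} (ha : MemLp (fun ξ => (a ξ : ℂ)) ∞ volume)
    (he : ∀ ξ, a (-ξ) = a ξ) (u : L2C) :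
    conjL (fmul (fun ξ => (a ξ : ℂ)) u) = fmul (fun ξ => (a ξ : ℂ)) (conjL u) :=
  conjL_fmul ha (fun ξ => by simp [he]) u

theorem conjL_birmanSchwinger (hs : Continuous s) (hδ : 0 < δ) (hsδ : ∀ ξ, δ ≤ s ξ)
    (he : ∀ ξ, s (-ξ) = s ξ) (hq : MemLp (fun x => (q x : ℂ)) ∞ volume) (u : L2C) :
    conjL (birmanSchwinger s q u) = birmanSchwinger s q (conjL u) := by
  have hP := conjL_fmul_ofReal (memLp_invSqrt hs hδ hsδ) (fun ξ => by rw [invSqrt, he, invSqrt])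
  rw [birmanSchwinger, ContinuousLinearMap.comp_apply, ContinuousLinearMap.comp_apply, hP,
    conjL_bmul_ofReal hq, hP]
  rfl

theorem birmanSchwinger_isCompact (hs : Continuous s) (hδ : 0 < δ) (hsδ : ∀ ξ, δ ≤ s ξ)
    (hlim : Tendsto (fun ξ => (s ξ)⁻¹) (cocompact ℝ) (𝓝 0))
    {q₀ : ℝ → ℂ} (hq0c : MemLp q₀ ∞ volume) (hq0 : Tendsto q₀ (cocompact ℝ) (𝓝 0))
    (hqq : (fun x => (q x : ℂ)) =ᵐ[volume] q₀) : IsCompactOperator (birmanSchwinger s q) := by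
  rw [birmanSchwinger, bmul_congr hqq]
  exact (isCompactOperator_bmul_fmul hq0c (memLp_invSqrt hs hδ hsδ) hq0
    (tendsto_invSqrt hlim)).clm_comp (fmul (fun ξ => (invSqrt s ξ : ℂ)))

theorem realOp_isCompact {A : L2C →L[ℂ] L2C} (hA : IsCompactOperator A) :
    IsCompactOperator (realOp A) := by
  have h1 : IsCompactOperator (A ∘ complexifyL) := by
    obtain ⟨K, hK, hKn⟩ := hA
    exact ⟨K, hK, complexifyL.continuous.continuousAt (by rw [map_zero]; exact hKn)⟩
  exact h1.continuous_comp reL.continuous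

theorem inner_birmanSchwinger (hs : Continuous s) (hδ : 0 < δ) (hsδ : ∀ ξ, δ ≤ s ξ)
    (hq : MemLp (fun x => (q x : ℂ)) ∞ volume) (u v : L2C) :
    inner ℂ (birmanSchwinger s q u) v = inner ℂ u (birmanSchwinger s q v) := by
  have hP := inner_fmul_ofReal (memLp_invSqrt hs hδ hsδ)
  simp only [birmanSchwinger, ContinuousLinearMap.comp_apply]
  rw [hP, inner_bmul_ofReal hq, hP]

theorem realOp_isSymmetric {A : L2C →L[ℂ] L2C} (hA : ∀ u, conjL (A u) = A (conjL u))
    (hs : ∀ u v, inner ℂ (A u) v = inner ℂ u (A v)) : (realOp A : L2R →ₗ[ℝ] L2R).IsSymmetric := by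
  intro u v
  apply Complex.ofReal_injective
  change ((inner ℝ (realOp A u) v : ℝ) : ℂ) = ((inner ℝ u (realOp A v) : ℝ) : ℂ)
  rw [← inner_complexify, ← inner_complexify, complexify_realOp hA, complexify_realOp hA, hs]

/-- Split x into real and imaginary parts: an operator commuting with conjugation has no cross terms
in the real part of its form, and orthogonality to real vectors passes to both parts. -/
theorem re_inner_le_of_real {A : L2C →L[ℂ] L2C} (hA : ∀ u, conjL (A u) = A (conjL u))
    {ι : Type*} {v : ι → L2R}
    (hle : ∀ x : L2R, (∀ i, inner ℝ (v i) x = 0) → inner ℝ (realOp A x) x ≤ ‖x‖ ^ 2)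
    (x : L2C) (hx : ∀ i, inner ℂ (complexify (v i)) x = 0) :
    RCLike.re (inner ℂ (A x) x) ≤ ‖x‖ ^ 2 := by
  set a := reL x with ha
  set b := -reL (Complex.I • x) with hb
  have hxe : x = complexify a + Complex.I • complexify b := eq_complexify_add x
  have h1 : ∀ i, inner ℝ (v i) a = 0 ∧ inner ℝ (v i) b = 0 := by
    intro i
    have := hx i
    rw [hxe, inner_add_right, inner_smul_right, inner_complexify, inner_complexify] at this
    have hre := congrArg Complex.re this
    have him := congrArg Complex.im this
    simp at hre him
    exact ⟨hre, him⟩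
  have h2 := hle a fun i => (h1 i).1
  have h3 := hle b fun i => (h1 i).2
  have e1 : A x = complexify (realOp A a) + Complex.I • complexify (realOp A b) := by
    rw [complexify_realOp hA, complexify_realOp hA, ← map_smul, ← map_add, ← hxe]
  have e2 : ∀ a' b' : L2R, RCLike.re (inner ℂ (complexify a' + Complex.I • complexify b')
      (complexify a + Complex.I • complexify b)) = inner ℝ a' a + inner ℝ b' b := by
    intro a' b'
    simp only [inner_add_left, inner_add_right, inner_smul_left, inner_smul_right, inner_complexify]
    simp
  have e3 : ‖x‖ ^ 2 = ‖a‖ ^ 2 + ‖b‖ ^ 2 := by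
    have h4 : (‖x‖ ^ 2 : ℝ) = RCLike.re (inner ℂ x x) := (inner_self_eq_norm_sq x).symm
    rw [h4]
    conv_lhs => rw [hxe]
    rw [e2, real_inner_self_eq_norm_sq, real_inner_self_eq_norm_sq]
  rw [e3, e1]
  conv_lhs => rw [hxe]
  rw [e2]
  linarith

theorem finrank_iSup_eq_card_filter (hs : Continuous s) (hδ : 0 < δ) (hsδ : ∀ ξ, δ ≤ s ξ)
    (he : ∀ ξ, s (-ξ) = s ξ) (hlim : Tendsto (fun ξ => (s ξ)⁻¹) (cocompact ℝ) (𝓝 0))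
    {q₀ : ℝ → ℂ} (hq0c : MemLp q₀ ∞ volume) (hq0 : Tendsto q₀ (cocompact ℝ) (𝓝 0))
    (hqq : (fun x => (q x : ℂ)) =ᵐ[volume] q₀) {E : ℝ → Submodule ℂ L2C}
    (hE : ∀ ν u, u ∈ E ν ↔ u = fmul (fun ξ => (((s ξ)⁻¹ : ℝ) : ℂ))
      (bmul (fun x => (q x : ℂ)) u + (ν : ℂ) • u))
    {m : ℕ} {v : Fin m → L2R} {μ : Fin m → ℝ} (hv : IsEigenfamily (realOp (birmanSchwinger s q)) v μ)
    (hQ : ∀ x, (∀ i, inner ℝ (v i) x = 0) → ‖realOp (birmanSchwinger s q) x‖ ≤ 1 / 2 * ‖x‖) :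
    Module.finrank ℂ (⨆ ν : {ν : ℝ // ν < 0}, E ν : Submodule ℂ L2C)
      = (Finset.univ.filter fun i => 1 < μ i).card := by
  have hq : MemLp (fun x => (q x : ℂ)) ∞ volume := hq0c.ae_eq hqq.symm
  have hTc := conjL_birmanSchwinger hs hδ hsδ he hq
  have hTs := realOp_isSymmetric hTc (inner_birmanSchwinger hs hδ hsδ hq)
  set P := fmul (fun ξ => (invSqrt s ξ : ℂ)) with hP
  set Q := bmul (fun x => (q x : ℂ)) with hQd
  -- With Z = (S + k)^{-1/2} this shift gives ‖ZqZ‖ ≤ ‖q‖/(δ + k) < 1.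
  set k : ℝ := ‖Q‖ + 1 with hk
  have hk0 : 0 < k := by positivity
  have hks : Continuous fun ξ => s ξ + k := by fun_prop
  have hkδ : ∀ ξ, δ + k ≤ s ξ + k := fun ξ => by linarith [hsδ ξ]
  have hδk : 0 < δ + k := by positivity
  set Z := fmul (fun ξ => (invSqrt (fun ξ => s ξ + k) ξ : ℂ)) with hZ
  have hZm := memLp_invSqrt hks hδk hkδ
  have hZn : ∀ x, ‖Z x‖ ≤ (√(δ + k))⁻¹ * ‖x‖ := fun x =>
    norm_fmul_le hZm (Eventually.of_forall fun ξ => by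
      rw [Complex.norm_real]; exact abs_invSqrt_le hδk hkδ ξ) x
  have hZop : ‖Z‖ ≤ (√(δ + k))⁻¹ := ContinuousLinearMap.opNorm_le_bound _ (by positivity) hZn
  have hsq : (√(δ + k))⁻¹ * (√(δ + k))⁻¹ = (δ + k)⁻¹ := by
    rw [← mul_inv, Real.mul_self_sqrt hδk.le]
  have hZZ := fmul_invSqrt_sq hks hδk hkδ
  have hPP := fmul_invSqrt_sq hs hδ hsδ
  have hRm := memLp_inv hs hδ hsδ
  have hkm := memLp_inv hks hδk hkδ
  rw [← Fintype.card_subtype]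
  refine finrank_iSup_eigenspaces_eq_card (P := P) (q := Q) (Z := Z) (k := k) (a := (δ + k)⁻¹)
    (e := fun i : {i // 1 < μ i} => complexify (v i)) (μ := fun i => μ i)
    (inner_fmul_ofReal (memLp_invSqrt hs hδ hsδ)) (inner_fmul_ofReal hZm) (inner_bmul_ofReal hq)
    (fun ν u => by rw [hPP]; exact hE ν u) (fun f => ?_) ?_ hk0 (by positivity) ?_ (fun x => ?_) ?_
    ?_ (fun i => ?_) (fun i => i.2) ?_
  · rw [hPP, hZZ]
    apply L2C_ext_FT
    filter_upwards [coeFn_FT_fmul hRm f,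
      coeFn_FT_fmul hkm (f + (k : ℂ) • fmul (fun ξ => (((s ξ)⁻¹ : ℝ) : ℂ)) f),
      Lp.coeFn_add (FT f) ((k : ℂ) • FT (fmul (fun ξ => (((s ξ)⁻¹ : ℝ) : ℂ)) f)),
      Lp.coeFn_smul (k : ℂ) (FT (fmul (fun ξ => (((s ξ)⁻¹ : ℝ) : ℂ)) f))] with ξ a b c d
    rw [b, map_add, map_smul, c, Pi.add_apply, d, Pi.smul_apply, a, smul_eq_mul]
    have h1 : (s ξ : ℂ) ≠ 0 := by exact_mod_cast (hδ.trans_le (hsδ ξ)).ne'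
    have h2 : (s ξ + k : ℂ) ≠ 0 := by exact_mod_cast (hδk.trans_le (hkδ ξ)).ne'
    push_cast
    field_simp
  · calc ‖Z * Q * Z‖ ≤ ‖Z‖ * ‖Q‖ * ‖Z‖ :=
          (norm_mul_le _ _).trans (mul_le_mul_of_nonneg_right (norm_mul_le _ _) (norm_nonneg _))
      _ ≤ (√(δ + k))⁻¹ * ‖Q‖ * (√(δ + k))⁻¹ := by gcongr
      _ = (δ + k)⁻¹ * ‖Q‖ := by rw [← hsq]; ring
      _ < 1 := by
          rw [inv_mul_lt_iff₀ hδk]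
          linarith
  · exact inv_strictAnti₀ hk0 (by linarith)
  · calc ‖Z x‖ ^ 2 ≤ ((√(δ + k))⁻¹ * ‖x‖) ^ 2 := by gcongr; exact hZn x
      _ = _ := by rw [mul_pow, sq (√(δ + k))⁻¹, hsq]
  · have h1 : IsCompactOperator (Q ∘L fmul (fun ξ => (((s ξ + k)⁻¹ : ℝ) : ℂ))) := by
      rw [hQd, bmul_congr hqq]
      refine isCompactOperator_bmul_fmul hq0c hkm hq0 ?_
      have h2 : Tendsto (fun ξ => (s ξ + k)⁻¹) (cocompact ℝ) (𝓝 0) := by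
        refine squeeze_zero (fun ξ => ?_) (fun ξ => ?_) hlim
        · exact inv_nonneg.mpr (hδk.le.trans (hkδ ξ))
        · exact inv_anti₀ (hδ.trans_le (hsδ ξ)) (by linarith)
      have h3 := (Complex.continuous_ofReal.tendsto 0).comp h2
      rwa [Complex.ofReal_zero] at h3
    refine h1.of_adjoint fun x y => ?_
    rw [ContinuousLinearMap.comp_apply, inner_bmul_ofReal hq, inner_fmul_ofReal hkm, ← hZZ]
    rfl
  · have ho := hv.orthonormal
    constructor
    · intro i
      rw [norm_complexify]
      exact ho.1 i
    · intro i j hij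
      have : inner ℝ (v i) (v j) = 0 := ho.2 fun h => hij (Subtype.ext h)
      change inner ℂ (complexify (v i)) (complexify (v j)) = 0
      rw [inner_complexify, this, Complex.ofReal_zero]
  · have h1 := complexify_realOp hTc (v i)
    rw [hv.apply_eq, complexify_smul] at h1
    exact h1.symm
  · exact fun x hx => re_inner_le_of_real hTc (v := fun i : {i // 1 < μ i} => v i)
      (fun y hy => hv.inner_le hTs hQ fun i hi => hy ⟨i, hi⟩) x hx

end LinearizedOperator
end

noncomputable section

/-! ### The contractions B_l with symbol ip/(ip − l). -/

section GrowthFamily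

variable {p : ℝ → ℝ}

/-- The symbol `ip / (ip - l)`. -/
def growthSymbol (p : ℝ → ℝ) (l ξ : ℝ) : ℂ := Complex.I * p ξ / (Complex.I * p ξ - l)

theorem growthSymbol_den_ne_zero {l : ℝ} (hl : 0 < l) (ξ : ℝ) : Complex.I * p ξ - (l : ℂ) ≠ 0 := by
  intro h
  have := congrArg Complex.re h
  simp at this
  exact hl.ne' this

theorem le_norm_growthSymbol_den {l : ℝ} (hl : 0 < l) (ξ : ℝ) : l ≤ ‖Complex.I * p ξ - (l : ℂ)‖ := by
  have := Complex.abs_re_le_norm (Complex.I * p ξ - (l : ℂ))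
  simpa [abs_of_pos hl] using this

theorem norm_growthSymbol_le (l ξ : ℝ) : ‖growthSymbol p l ξ‖ ≤ 1 := by
  rw [growthSymbol, norm_div]
  refine div_le_one_of_le₀ ?_ (norm_nonneg _)
  have := Complex.abs_im_le_norm (Complex.I * p ξ - (l : ℂ))
  simpa using this

theorem continuous_growthSymbol (hp : Continuous p) {l : ℝ} (hl : 0 < l) :
    Continuous (growthSymbol p l) := by
  unfold growthSymbol
  exact (by fun_prop : Continuous fun ξ => Complex.I * (p ξ : ℂ)).div (by fun_prop)
    (growthSymbol_den_ne_zero hl)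

theorem memLp_growthSymbol (hp : Continuous p) {l : ℝ} (hl : 0 < l) :
    MemLp (growthSymbol p l) ∞ volume :=
  memLp_top_of_bound' (continuous_growthSymbol hp hl) (norm_growthSymbol_le l)

theorem growthSymbol_neg (hodd : ∀ ξ, p (-ξ) = -p ξ) (l ξ : ℝ) :
    growthSymbol p l (-ξ) = star (growthSymbol p l ξ) := by
  simp [growthSymbol, hodd]

/-- The real operator with symbol `ip / (ip - l)`. -/
def growthOp (p : ℝ → ℝ) (l : ℝ) : L2R →L[ℝ] L2R := realOp (fmul (growthSymbol p l))

theorem complexify_growthOp (hp : Continuous p) (hodd : ∀ ξ, p (-ξ) = -p ξ) {l : ℝ} (hl : 0 < l)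
    (u : L2R) : complexify (growthOp p l u) = fmul (growthSymbol p l) (complexify u) :=
  complexify_realOp (conjL_fmul (memLp_growthSymbol hp hl) (growthSymbol_neg hodd l)) u

theorem norm_growthOp_le (hp : Continuous p) (hodd : ∀ ξ, p (-ξ) = -p ξ) {l : ℝ} (hl : 0 < l) :
    ‖growthOp p l‖ ≤ 1 :=
  norm_realOp_le (conjL_fmul (memLp_growthSymbol hp hl) (growthSymbol_neg hodd l)) zero_le_one
    (norm_fmul_le (memLp_growthSymbol hp hl) (Eventually.of_forall (norm_growthSymbol_le l)))

theorem norm_growthSymbol_sub_le {l l' : ℝ} (hl : 0 < l) (hl' : 0 < l') (ξ : ℝ) :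
    ‖growthSymbol p l' ξ - growthSymbol p l ξ‖ ≤ |l' - l| / l := by
  have h1 := growthSymbol_den_ne_zero (p := p) hl ξ
  have h2 := growthSymbol_den_ne_zero (p := p) hl' ξ
  have e : growthSymbol p l' ξ - growthSymbol p l ξ
      = growthSymbol p l' ξ * (((l' - l : ℝ) : ℂ) / (Complex.I * p ξ - l)) := by
    rw [growthSymbol, growthSymbol]
    field_simp
    push_cast
    ring
  rw [e, norm_mul, norm_div, Complex.norm_real, Real.norm_eq_abs]
  refine (mul_le_of_le_one_left (by positivity) (norm_growthSymbol_le l' ξ)).trans ?_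
  exact div_le_div_of_nonneg_left (abs_nonneg _) hl (le_norm_growthSymbol_den hl ξ)

theorem continuousOn_growthOp (hp : Continuous p) (hodd : ∀ ξ, p (-ξ) = -p ξ) :
    ContinuousOn (growthOp p) (Ioi 0) := by
  intro l hl
  rw [mem_Ioi] at hl
  rw [ContinuousWithinAt, tendsto_iff_norm_sub_tendsto_zero]
  have h1 : Tendsto (fun l' : ℝ => |l' - l| / l) (𝓝[Ioi 0] l) (𝓝 0) := by
    have h2 : Continuous fun l' : ℝ => |l' - l| / l := by fun_prop
    have h3 := h2.tendsto l
    simp only [sub_self, abs_zero, zero_div] at h3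
    exact h3.mono_left nhdsWithin_le_nhds
  refine squeeze_zero' (Eventually.of_forall fun _ => norm_nonneg _) ?_ h1
  filter_upwards [self_mem_nhdsWithin] with l' hl'
  refine ContinuousLinearMap.opNorm_le_bound _ (by positivity) fun u => ?_
  rw [sub_apply, ← norm_complexify, complexify_sub, complexify_growthOp hp hodd hl',
    complexify_growthOp hp hodd hl, ← sub_apply, ← norm_complexify u]
  have e : fmul (growthSymbol p l') - fmul (growthSymbol p l)
      = fmul (fun ξ => growthSymbol p l' ξ - growthSymbol p l ξ) := by
    rw [fmul, fmul, fmul, ← bmul_sub (memLp_growthSymbol hp hl') (memLp_growthSymbol hp hl)]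
    ext1 u
    simp
  rw [e]
  exact norm_fmul_le ((memLp_growthSymbol hp hl').sub (memLp_growthSymbol hp hl))
    (Eventually.of_forall fun ξ => norm_growthSymbol_sub_le hl hl' ξ) _

/-- The symbol tends to 1 wherever p ≠ 0. Where p vanishes it is 0 for every l, so these points must
form a null set. -/
theorem tendsto_growthOp_zero (hp : Continuous p)
    (hp0 : ∀ᵐ ξ, p ξ ≠ 0) (u : L2R) :
    Tendsto (fun l => growthOp p l u) (𝓝[>] 0) (𝓝 u) := by
  have h1 : Tendsto (fun l => fmul (growthSymbol p l) (complexify u)) (𝓝[>] 0)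
      (𝓝 (fmul (fun _ => 1) (complexify u))) := by
    refine tendsto_fmul_of_dominated (C := 1) ?_
      (memLp_top_of_bound' continuous_const (C := 1) (by simp)) ?_ (by simp) ?_ _
    · filter_upwards [self_mem_nhdsWithin] with l hl using memLp_growthSymbol hp hl
    · filter_upwards [self_mem_nhdsWithin] with l hl
      exact Eventually.of_forall (norm_growthSymbol_le l)
    · filter_upwards [hp0] with ξ hξ
      have h2 : ContinuousAt (fun l : ℝ => growthSymbol p l ξ) 0 := by
        unfold growthSymbol
        refine ContinuousAt.div (by fun_prop) (by fun_prop) ?_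
        simp [hξ]
      have h3 : growthSymbol p 0 ξ = 1 := by
        simp [growthSymbol, hξ]
      have h4 := h2.tendsto
      rw [h3] at h4
      exact h4.mono_left nhdsWithin_le_nhds
  rw [fmul_apply, bmul_one, LinearIsometryEquiv.symm_apply_apply] at h1
  have h2 := (reL.continuous.tendsto _).comp h1
  rw [reL_complexify] at h2
  exact h2

theorem tendsto_growthOp_atTop (hp : Continuous p) (u : L2R) :
    Tendsto (fun l => growthOp p l u) atTop (𝓝 0) := by
  have h1 : Tendsto (fun l => fmul (growthSymbol p l) (complexify u)) atTop
      (𝓝 (fmul (fun _ => 0) (complexify u))) := by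
    refine tendsto_fmul_of_dominated (C := 1) ?_
      (memLp_top_of_bound' continuous_const (C := 1) (by simp)) ?_ (by simp) ?_ _
    · filter_upwards [eventually_gt_atTop 0] with l hl using memLp_growthSymbol hp hl
    · filter_upwards [eventually_gt_atTop 0] with l hl
      exact Eventually.of_forall (norm_growthSymbol_le l)
    · refine Eventually.of_forall fun ξ => ?_
      rw [tendsto_zero_iff_norm_tendsto_zero]
      have h2 : Tendsto (fun l : ℝ => |p ξ| / l) atTop (𝓝 0) :=
        tendsto_const_nhds.div_atTop tendsto_id
      refine squeeze_zero' (Eventually.of_forall fun _ => norm_nonneg _) ?_ h2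
      filter_upwards [eventually_gt_atTop 0] with l hl
      rw [growthSymbol, norm_div, norm_mul, Complex.norm_I, one_mul, Complex.norm_real,
        Real.norm_eq_abs]
      exact div_le_div_of_nonneg_left (abs_nonneg _) hl (le_norm_growthSymbol_den hl ξ)
  have h0 : fmul (fun _ => 0) (complexify u) = 0 := by
    have h3 : MemLp (fun _ : ℝ => (0 : ℂ)) ∞ volume := memLp_top_const 0
    have h4 := norm_fmul_le h3 (C := 0) (by simp) (complexify u)
    rw [zero_mul] at h4
    exact norm_le_zero_iff.mp h4
  rw [h0] at h1
  have h2 := (reL.continuous.tendsto _).comp h1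
  rw [map_zero] at h2
  exact h2

/-- The symbol of 1 − B is −l/(ip − l); moving the factor ip from e onto x, with the sign change
from conjugation, leaves l·ip/(ip − l) against g. -/
theorem inner_sub_growthOp (hp : Continuous p) (hodd : ∀ ξ, p (-ξ) = -p ξ) {e g : L2R}
    (heg : FT (complexify e) =ᵐ[volume] fun ξ => Complex.I * p ξ * FT (complexify g) ξ)
    {l : ℝ} (hl : 0 < l) (x : L2R) :
    inner ℝ e (x - growthOp p l x) = l * inner ℝ g (growthOp p l x) := by
  apply Complex.ofReal_injective
  push_cast
  rw [← inner_complexify, ← inner_complexify, complexify_sub, complexify_growthOp hp hodd hl,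
    ← FT.inner_map_map, ← FT.inner_map_map (complexify g), L2.inner_def, L2.inner_def,
    ← integral_const_mul, map_sub]
  refine integral_congr_ae ?_
  filter_upwards [heg, coeFn_FT_fmul (memLp_growthSymbol hp hl) (complexify x),
    Lp.coeFn_sub (FT (complexify x)) (FT (fmul (growthSymbol p l) (complexify x)))] with ξ a b d
  rw [d, Pi.sub_apply, b, a]
  have h1 := growthSymbol_den_ne_zero (p := p) hl ξ
  simp only [RCLike.inner_apply, map_mul, Complex.conj_I, Complex.conj_ofReal, growthSymbol]
  field_simp
  ring

theorem sub_growthOp_eq (hp : Continuous p) (hodd : ∀ ξ, p (-ξ) = -p ξ) {e g : L2R}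
    (heg : FT (complexify e) =ᵐ[volume] fun ξ => Complex.I * p ξ * FT (complexify g) ξ)
    {l : ℝ} (hl : 0 < l) : e - growthOp p l e = -(l • growthOp p l g) := by
  apply complexify_injective
  rw [complexify_sub, complexify_neg, complexify_smul, complexify_growthOp hp hodd hl,
    complexify_growthOp hp hodd hl]
  apply L2C_ext_FT
  rw [map_sub, map_neg, map_smul]
  filter_upwards [heg, coeFn_FT_fmul (memLp_growthSymbol hp hl) (complexify e),
    coeFn_FT_fmul (memLp_growthSymbol hp hl) (complexify g),
    Lp.coeFn_sub (FT (complexify e)) (FT (fmul (growthSymbol p l) (complexify e))),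
    Lp.coeFn_neg ((l : ℂ) • FT (fmul (growthSymbol p l) (complexify g))),
    Lp.coeFn_smul (l : ℂ) (FT (fmul (growthSymbol p l) (complexify g)))] with ξ a b d e1 e2 e3
  rw [e1, Pi.sub_apply, e2, Pi.neg_apply, e3, Pi.smul_apply, b, d, a, smul_eq_mul]
  have h1 := growthSymbol_den_ne_zero (p := p) hl ξ
  simp only [growthSymbol]
  field_simp
  ring

end GrowthFamily
end

noncomputable section

/-! ### From the abstract fixed vector to a growing mode. -/

section GrowingMode

theorem fmul_eq_zero {a : ℝ → ℂ} (ha : MemLp a ∞ volume) (h0 : ∀ᵐ ξ, a ξ ≠ 0) {u : L2C}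
    (h : fmul a u = 0) : u = 0 := by
  apply L2C_ext_FT
  have h1 := coeFn_FT_fmul ha u
  rw [h, map_zero] at h1
  rw [map_zero]
  filter_upwards [h1, h0, Lp.coeFn_zero ℂ 2 (volume : Measure ℝ)] with ξ e e0 e1
  rw [e1, Pi.zero_apply] at e ⊢
  exact (mul_eq_zero.mp e.symm).resolve_left e0

theorem HasWeakDeriv.conjL {u v : L2C} (h : HasWeakDeriv u v) :
    HasWeakDeriv (conjL u) (conjL v) := by
  rw [HasWeakDeriv, FT_conjL, FT_conjL]
  filter_upwards [ae_neg h, coeFn_reflL (_root_.conjL (FT u)), coeFn_reflL (_root_.conjL (FT v)),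
    ae_neg (coeFn_conjL (FT u)), ae_neg (coeFn_conjL (FT v))] with x a b d e1 e2
  rw [b, d, e1, e2, a]
  simp

variable {s q : ℝ → ℝ} {δ : ℝ}

theorem invSqrt_ne_zero (hδ : 0 < δ) (hsδ : ∀ ξ, δ ≤ s ξ) (ξ : ℝ) : (invSqrt s ξ : ℂ) ≠ 0 := by
  have : 0 < √(s ξ) := Real.sqrt_pos.mpr (hδ.trans_le (hsδ ξ))
  exact_mod_cast (inv_pos.mpr this).ne'

/-- The dictionary to the abstract theorem is e = S^{1/2}ψₓ, g = S^{-1/2}ψ and φ = S^{1/2}∂_cψ. Then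
Nψₓ = 0 becomes Te = e, N∂_cψ = −ψ becomes φ − Tφ = −g, the derivative relation becomes ê = ip ĝ,
and ⟨g, φ⟩ = ⟨ψ, ∂_cψ⟩. -/
theorem exists_growing_mode (hs : Continuous s) (hδ : 0 < δ) (hsδ : ∀ ξ, δ ≤ s ξ)
    (hse : ∀ ξ, s (-ξ) = s ξ) (hlim : Tendsto (fun ξ => (s ξ)⁻¹) (cocompact ℝ) (𝓝 0))
    {q₀ : ℝ → ℂ} (hq0c : MemLp q₀ ∞ volume) (hq0 : Tendsto q₀ (cocompact ℝ) (𝓝 0))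
    (hqq : (fun x => (q x : ℂ)) =ᵐ[volume] q₀) {ψ d ψ' : L2R}
    (hd : HasWeakDeriv (complexify ψ) (complexify d)) (hd0 : d ≠ 0)
    (hdfix : complexify d = fmul (fun ξ => (((s ξ)⁻¹ : ℝ) : ℂ))
      (bmul (fun x => (q x : ℂ)) (complexify d)))
    (hker : ∀ u : L2C, u = fmul (fun ξ => (((s ξ)⁻¹ : ℝ) : ℂ)) (bmul (fun x => (q x : ℂ)) u) →
      ∃ a : ℂ, u = a • complexify d)
    (hψ' : complexify ψ' = fmul (fun ξ => (((s ξ)⁻¹ : ℝ) : ℂ))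
      (bmul (fun x => (q x : ℂ)) (complexify ψ') - complexify ψ))
    {m : ℕ} {v : Fin m → L2R} {μ : Fin m → ℝ} (hv : IsEigenfamily (realOp (birmanSchwinger s q)) v μ)
    (hQ : ∀ x, (∀ i, inner ℝ (v i) x = 0) → ‖realOp (birmanSchwinger s q) x‖ ≤ 1 / 2 * ‖x‖)
    (hsign : 0 < (-1 : ℝ) ^ (Finset.univ.filter fun i => 1 < μ i).card * inner ℝ ψ ψ') :
    ∃ l > 0, ∃ w : L2R, w ≠ 0 ∧ complexify w =
      fmul (fun ξ => growthSymbol (fun ξ => 2 * Real.pi * ξ * s ξ) l ξ * (((s ξ)⁻¹ : ℝ) : ℂ))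
        (bmul (fun x => (q x : ℂ)) (complexify w)) := by
  have hq : MemLp (fun x => (q x : ℂ)) ∞ volume := hq0c.ae_eq hqq.symm
  have hTc := conjL_birmanSchwinger hs hδ hsδ hse hq
  have hTs := realOp_isSymmetric hTc (inner_birmanSchwinger hs hδ hsδ hq)
  have hPm := memLp_invSqrt hs hδ hsδ
  have hPc := conjL_fmul_ofReal hPm fun ξ => by rw [invSqrt, hse, invSqrt]
  have hQc := conjL_bmul_ofReal hq
  have hPP := fmul_invSqrt_sq hs hδ hsδ
  set T := birmanSchwinger s q with hT
  set P := fmul (fun ξ => (invSqrt s ξ : ℂ)) with hP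
  set Q := bmul (fun x => (q x : ℂ)) with hQd
  set p : ℝ → ℝ := fun ξ => 2 * Real.pi * ξ * s ξ with hpdef
  have hTa : ∀ u, T u = P (Q (P u)) := fun _ => rfl
  have hPinj : ∀ u, P u = 0 → u = 0 := fun u =>
    fmul_eq_zero hPm (Eventually.of_forall (invSqrt_ne_zero hδ hsδ))
  have hp : Continuous p := by fun_prop
  have hodd : ∀ ξ, p (-ξ) = -p ξ := fun ξ => by simp only [hpdef, hse]; ring
  have hp0 : ∀ᵐ ξ, p ξ ≠ 0 := by
    filter_upwards [ae_ne_zero] with ξ hξ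
    have := (hδ.trans_le (hsδ ξ)).ne'
    simp [hpdef, hξ, this, Real.pi_ne_zero]
  -- S^{1/2} is unbounded, so e and φ are written as P applied to the values of Sψₓ = qψₓ and S∂_cψ
  -- = q∂_cψ − ψ.
  set e : L2R := realOp P (realOp Q d) with he
  set g : L2R := realOp P ψ with hg
  set φ : L2R := realOp P (realOp Q ψ' - ψ) with hφ
  have hec : complexify e = P (Q (complexify d)) := by
    rw [he, complexify_realOp hPc, complexify_realOp hQc]
  have hgc : complexify g = P (complexify ψ) := complexify_realOp hPc ψ
  have hφc : complexify φ = P (Q (complexify ψ') - complexify ψ) := by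
    rw [hφ, complexify_realOp hPc, complexify_sub, complexify_realOp hQc]
  have hPe : P (complexify e) = complexify d := by rw [hec, hPP, ← hdfix]
  have hPφ : P (complexify φ) = complexify ψ' := by rw [hφc, hPP, ← hψ']
  have hTe : realOp T e = e := by
    apply complexify_injective
    rw [complexify_realOp hTc, hTa, hPe, ← hec]
  have he0 : e ≠ 0 := by
    intro h
    rw [h, complexify_zero, map_zero] at hPe
    exact hd0 (complexify_injective (by rw [← hPe, complexify_zero]))
  have hkerT : ∀ x, realOp T x = x → ∃ a : ℝ, x = a • e := by
    intro x hx
    have h1 : P (Q (P (complexify x))) = complexify x := by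
      rw [← hTa, ← complexify_realOp hTc, hx]
    obtain ⟨a, ha⟩ := hker (P (complexify x)) (by
      rw [← hPP, h1])
    have h2 : complexify x - a • complexify e = 0 := by
      apply hPinj
      rw [map_sub, map_smul, hPe, ha, sub_self]
    refine ⟨a.re, ?_⟩
    have h3 : reL (a • complexify e) = a.re • e := by
      refine Lp.ext ?_
      filter_upwards [coeFn_reL (a • complexify e), Lp.coeFn_smul a (complexify e),
        coeFn_complexify e, Lp.coeFn_smul a.re e] with x b1 b2 b3 b4
      rw [b1, b2, b4, Pi.smul_apply, Pi.smul_apply, b3]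
      simp
    rw [← h3, ← sub_eq_zero.mp h2, reL_complexify]
  have hφT : φ - realOp T φ = -g := by
    apply complexify_injective
    rw [complexify_sub, complexify_neg, complexify_realOp hTc, hTa, hPφ, hφc, hgc, map_sub]
    abel
  have heg : FT (complexify e) =ᵐ[volume] fun ξ => Complex.I * p ξ * FT (complexify g) ξ := by
    have h1 := coeFn_FT_fmul hPm (complexify e)
    rw [← hP, hPe] at h1
    rw [hgc]
    filter_upwards [h1, coeFn_FT_fmul hPm (complexify ψ), hd] with ξ b1 b2 b3
    rw [b2]
    rw [b3] at b1
    have h2 := invSqrt_ne_zero hδ hsδ ξ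
    refine mul_left_cancel₀ h2 ?_
    rw [← b1]
    have h3 : (invSqrt s ξ : ℂ) * invSqrt s ξ * s ξ = 1 := by
      have := invSqrt_mul_self hδ hsδ ξ
      have h4 : s ξ ≠ 0 := (hδ.trans_le (hsδ ξ)).ne'
      have h5 : invSqrt s ξ * invSqrt s ξ * s ξ = 1 := by rw [this, inv_mul_cancel₀ h4]
      exact_mod_cast h5
    simp only [hpdef]
    push_cast
    linear_combination (-(2 * Real.pi * Complex.I * ξ * FT (complexify ψ) ξ)) * h3
  have hin : inner ℝ g φ = inner ℝ ψ ψ' := by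
    apply Complex.ofReal_injective
    rw [← inner_complexify, ← inner_complexify, hgc, inner_fmul_ofReal hPm, ← hP, hPφ]
  obtain ⟨l, hl, z, hz0, hz⟩ := IsEigenfamily.exists_fixed hTs
    (realOp_isCompact (birmanSchwinger_isCompact hs hδ hsδ hlim hq0c hq0 hqq)) hv hQ hTe he0 hkerT
    (B := growthOp p) (fun l hl => norm_growthOp_le hp hodd hl) (continuousOn_growthOp hp hodd)
    (tendsto_growthOp_zero hp hp0) (tendsto_growthOp_atTop hp) hφT
    (fun l hl x => inner_sub_growthOp hp hodd heg hl x)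
    (fun l hl => sub_growthOp_eq hp hodd heg hl) (by rw [hin]; exact hsign)
  refine ⟨l, hl, realOp P z, ?_, ?_⟩
  · intro h
    have h1 := complexify_realOp hPc z
    rw [h, complexify_zero] at h1
    exact hz0 (complexify_injective (by rw [hPinj _ h1.symm, complexify_zero]))
  · have hb := memLp_growthSymbol hp hl
    have h1 : complexify z = fmul (growthSymbol p l) (P (Q (P (complexify z)))) := by
      conv_lhs => rw [← hz]
      rw [complexify_growthOp hp hodd hl, complexify_realOp hTc, hTa]
    rw [complexify_realOp hPc]
    conv_lhs => rw [h1]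
    rw [fmul_fmul hPm hb, fmul_fmul (memLp_top_mul hPm hb) hPm]
    congr 2
    ext ξ
    rw [← invSqrt_mul_self hδ hsδ ξ]
    push_cast
    ring

/-- On the Fourier side the fixed point equation gives (s − q)w the transform l/(ip − l) times that
of qw; multiplying by 2πiξ yields lw = ∂ₓNw. -/
theorem solvesLinearized_of_fixed {β f : ℝ → ℝ} {c : ℝ} {ψ : L2R} (hβ : Continuous β) (hδ : 0 < δ)
    (hs : ∀ ξ, δ ≤ waveSymbol β f c ξ)
    (hq : MemLp (fun x => (wavePotential f ψ x : ℂ)) ∞ volume) {l : ℝ} (hl : 0 < l) {w : L2C}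
    (hw : w = fmul (fun ξ => growthSymbol (fun ξ => 2 * Real.pi * ξ * waveSymbol β f c ξ) l ξ *
        (((waveSymbol β f c ξ)⁻¹ : ℝ) : ℂ)) (bmul (fun x => (wavePotential f ψ x : ℂ)) w)) :
    SolvesLinearized β f c ψ (fun t => Real.exp (l * t) • w) := by
  set s := waveSymbol β f c with hsd
  set p : ℝ → ℝ := fun ξ => 2 * Real.pi * ξ * s ξ with hpdef
  have hsc : Continuous s := waveSymbol_continuous hβ
  have hp : Continuous p := by fun_prop
  have hb := memLp_growthSymbol hp hl
  have hRm : MemLp (fun ξ => (((s ξ)⁻¹ : ℝ) : ℂ)) ∞ volume := memLp_top_inv_waveSymbol hβ hδ hs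
  have h0 : ∀ ξ, (s ξ : ℂ) ≠ 0 := fun ξ => by exact_mod_cast (hδ.trans_le (hs ξ)).ne'
  set y := bmul (fun x => (wavePotential f ψ x : ℂ)) w with hy
  have hwF := coeFn_FT_fmul (memLp_top_mul hb hRm) y
  rw [← hw] at hwF
  have hM : w ∈ (multiplierOp β).domain := by
    rw [mem_multiplierOp_domain_iff (f := f) (c := c)]
    refine (Lp.memLp (FT (fmul (growthSymbol p l) y))).ae_eq ?_
    filter_upwards [hwF, coeFn_FT_fmul hb y] with ξ a b
    rw [a, b, Complex.ofReal_inv, ← hsd]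
    have := h0 ξ
    field_simp
  have hfm : MemLp (fun x => ((deriv f (ψ x) : ℝ) : ℂ)) ∞ volume := by
    refine (memLp_top_deriv hq 0 1).ae_eq (Eventually.of_forall fun x => ?_)
    simp
  have hV : w ∈ (mulOp fun x => deriv f (ψ x)).domain := mem_mulOp_domain_of_memLp_top hfm w
  set z := mulOp (fun x => deriv f (ψ x)) ⟨w, hV⟩ - multiplierOp β ⟨w, hM⟩ with hz
  have hVe : (mulOp (fun x => deriv f (ψ x)) ⟨w, hV⟩ : L2C) = y + ((deriv f 0 : ℝ) : ℂ) • w := by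
    refine Lp.ext ?_
    filter_upwards [coeFn_mulOp hV, Lp.coeFn_add y (((deriv f 0 : ℝ) : ℂ) • w),
      Lp.coeFn_smul ((deriv f 0 : ℝ) : ℂ) w, coeFn_bmul hq w] with x a1 a2 a3 a4
    rw [a1, a2, Pi.add_apply, a3, Pi.smul_apply, hy, a4, wavePotential, smul_eq_mul]
    push_cast
    ring
  have hder : HasWeakDeriv ((c : ℂ) • w - z) ((l : ℂ) • w) := by
    rw [HasWeakDeriv, hz, hVe, map_sub, map_sub, map_add, map_smul, map_smul, map_smul]
    filter_upwards [hwF, Lp.coeFn_sub ((c : ℂ) • FT w) (FT y + ((deriv f 0 : ℝ) : ℂ) • FT w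
        - FT (multiplierOp β ⟨w, hM⟩)),
      Lp.coeFn_sub (FT y + ((deriv f 0 : ℝ) : ℂ) • FT w) (FT (multiplierOp β ⟨w, hM⟩)),
      Lp.coeFn_add (FT y) (((deriv f 0 : ℝ) : ℂ) • FT w),
      Lp.coeFn_smul (c : ℂ) (FT w), Lp.coeFn_smul (l : ℂ) (FT w),
      Lp.coeFn_smul ((deriv f 0 : ℝ) : ℂ) (FT w), coeFn_FT_multiplierOp hM]
      with ξ a1 a2 a3 a4 a5 a6 a7 a8
    rw [a6, a2, Pi.sub_apply, a3, Pi.sub_apply, a4, Pi.add_apply, a5, a7, a8, Pi.smul_apply,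
      Pi.smul_apply, Pi.smul_apply, smul_eq_mul, smul_eq_mul, smul_eq_mul]
    have e1 : (c : ℂ) * FT w ξ - (FT y ξ + ((deriv f 0 : ℝ) : ℂ) * FT w ξ
        - (β (2 * Real.pi * ξ) : ℂ) * FT w ξ) = s ξ * FT w ξ - FT y ξ := by
      rw [hsd, waveSymbol]
      push_cast
      ring
    rw [e1, a1, Complex.ofReal_inv]
    have h1 := growthSymbol_den_ne_zero (p := p) hl ξ
    have h2 := h0 ξ
    have h3 : growthSymbol p l ξ * (Complex.I * p ξ - l) = Complex.I * p ξ :=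
      div_mul_cancel₀ _ h1
    have h4 : (p ξ : ℂ) = 2 * Real.pi * ξ * s ξ := by simp only [hpdef]; push_cast; ring
    rw [h4] at h3
    field_simp
    linear_combination (-FT y ξ) * h3
  have hdist := (hasWeakDeriv_iff _ _).mp hder
  intro t
  set a : ℂ := ((Real.exp (l * t) : ℝ) : ℂ) with ha
  have e3 : Real.exp (l * t) • w = a • w := (Complex.coe_smul _ _).symm
  have e2 : (l * Real.exp (l * t)) • w = a • ((l : ℂ) • w) := by
    rw [smul_smul, ha, ← Complex.ofReal_mul, mul_comm]
    exact (Complex.coe_smul _ _).symm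
  have hVt : Real.exp (l * t) • w ∈ (mulOp fun x => deriv f (ψ x)).domain := by
    rw [e3]; exact Submodule.smul_mem _ _ hV
  have hMt : Real.exp (l * t) • w ∈ (multiplierOp β).domain := by
    rw [e3]; exact Submodule.smul_mem _ _ hM
  refine ⟨(l * Real.exp (l * t)) • w, ?_, hVt, hMt, ?_⟩
  · have h1 : HasDerivAt (fun t => Real.exp (l * t)) (l * Real.exp (l * t)) t := by
      have := ((hasDerivAt_id t).const_mul l).exp
      simpa [mul_comm] using this
    exact h1.smul_const w
  · have e1 : (mulOp (fun x => deriv f (ψ x)) ⟨Real.exp (l * t) • w, hVt⟩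
        - multiplierOp β ⟨Real.exp (l * t) • w, hMt⟩ : L2C) = a • z := by
      rw [hz, smul_sub, ← LinearPMap.map_smul, ← LinearPMap.map_smul]
      congr 2
    rw [e1, e2]
    simp only [e3]
    let D : L2C →L[ℂ] 𝓢'(ℝ, ℂ) := Lp.toTemperedDistributionCLM ℂ volume 2
    let Δ : 𝓢'(ℝ, ℂ) →L[ℂ] 𝓢'(ℝ, ℂ) := LineDeriv.lineDerivOpCLM ℂ 𝓢'(ℝ, ℂ) (1 : ℝ)
    have hD : D ((l : ℂ) • w) = Δ (D ((c : ℂ) • w - z)) := hdist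
    change D (a • (l : ℂ) • w) - (c : ℂ) • Δ (D (a • w)) + Δ (D (a • z)) = 0
    rw [map_smul D, hD, ← map_smul Δ, ← map_smul Δ, ← map_smul D, ← map_smul D, ← map_sub Δ,
      ← map_sub D, ← map_add Δ, ← map_add D, smul_sub, smul_comm a (c : ℂ) w]
    rw [show (c : ℂ) • a • w - a • z - (c : ℂ) • a • w + a • z = 0 by abel, map_zero, map_zero]

end GrowingMode
end

noncomputable section

/-! ### Smoothness of the wave profile. -/

section Regularity

variable {β f : ℝ → ℝ} {c δ : ℝ} {ψ : L2R}

theorem memH_wavePotential (hf : ContDiff ℝ ∞ f) {k : ℕ} (h : MemH (k + 1) (complexify ψ)) :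
    MemH (k + 1) (fun x => (wavePotential f ψ x : ℂ)) :=
  (h.congr_ae (coeFn_complexify ψ)).comp (F := fun y => deriv f y - deriv f 0)
    ((contDiff_infty_iff_deriv.mp hf).2.sub contDiff_const) (sub_self _)

theorem MemH.memLp_top {k : ℕ} {g : ℝ → ℂ} (h : MemH (k + 1) g) : MemLp g ∞ volume :=
  h.choose_spec.1.memLp_top

theorem tendsto_ofReal_inv {s : ℝ → ℝ} (hlim : Tendsto (fun ξ => (s ξ)⁻¹) (cocompact ℝ) (𝓝 0)) :
    Tendsto (fun ξ => (((s ξ)⁻¹ : ℝ) : ℂ)) (cocompact ℝ) (𝓝 0) := by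
  have h := (Complex.continuous_ofReal.tendsto 0).comp hlim
  rwa [Complex.ofReal_zero] at h

/-- Bootstrap: if ψ has order k + 1, so does q; then the equation d = m(D)(q d) puts the derivative
d in order k + 1, so ψ has order k + 2. -/
theorem memH_of_hasWeakDeriv_fixed (hf : ContDiff ℝ ∞ f) {m : ℝ → ℂ} (hm : MemLp m ∞ volume)
    (hm0 : Tendsto m (cocompact ℝ) (𝓝 0)) {d : L2C} (hd : HasWeakDeriv (complexify ψ) d)
    (hfix : d = fmul m (bmul (fun x => (wavePotential f ψ x : ℂ)) d)) (k : ℕ) :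
    MemH (k + 1) (complexify ψ) := by
  induction k with
  | zero => exact ⟨d, hasWeakDerivFun_coe.mpr hd, Lp.memLp d⟩
  | succ k ih =>
    have hq := memH_wavePotential hf ih
    exact ⟨d, hasWeakDerivFun_coe.mpr hd, memH_of_fixed hq.memLp_top hm hm0 (fun g hg => hq.mul hg) hfix⟩

theorem complexify_ne_zero_of_pos (h : ∀ᵐ x : ℝ, 0 < ψ x) : complexify ψ ≠ 0 := by
  intro h0
  have h1 : ∀ᵐ _ : ℝ, False := by
    filter_upwards [h, coeFn_complexify ψ, Lp.coeFn_zero ℂ 2 (volume : Measure ℝ)] with x a b d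
    rw [h0, d] at b
    exact a.ne' (Complex.ofReal_injective b.symm)
  exact h1.exists.elim fun _ h => h

theorem HasWeakDeriv.ne_zero {u v : L2C} (h : HasWeakDeriv u v) (hu : u ≠ 0) : v ≠ 0 := by
  intro hv
  refine hu (L2C_ext_FT ?_)
  have h0 : ∀ᵐ x : ℝ, x ≠ 0 := by simp [ae_iff]
  rw [HasWeakDeriv, hv, map_zero] at h
  rw [map_zero]
  filter_upwards [h, h0, Lp.coeFn_zero ℂ 2 (volume : Measure ℝ)] with x a b d
  rw [d, Pi.zero_apply] at a ⊢
  refine (mul_eq_zero.mp a.symm).resolve_left ?_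
  simp [b, Real.pi_ne_zero]

theorem waveSymbol_neg (he : ∀ ξ, β (-ξ) = β ξ) (ξ : ℝ) :
    waveSymbol β f c (-ξ) = waveSymbol β f c ξ := by
  rw [waveSymbol, waveSymbol, mul_neg, he]

end Regularity

end
-- The instability criterion.
theorem mainTheorem4
    -- the symbol `β` of `M`
    (α γ a₁ a₂ b b₀ : ℝ) (hα₀ : 0 < α) (hα₁ : α < 1) (hγ₀ : 0 ≤ γ) (hγα : γ ≤ α)
    (ha₁ : 0 < a₁) (ha₂ : 0 < a₂)
    (β : ℝ → ℝ) (hβ_cont : Continuous β) (hβ_even : ∀ ξ, β (-ξ) = β ξ)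
    (hβ_low : ∀ ξ, b₀ ≤ |ξ| → a₁ * |ξ| ^ γ ≤ β ξ)
    (hβ_upp : ∀ ξ, b₀ ≤ |ξ| → β ξ ≤ a₂ * (1 + |ξ|) ^ α)
    (hb : ∀ ξ, b < β ξ)
    (hη : HasDerivInL2 (fun ξ => β ξ - |ξ| ^ α))
    -- the nonlinearity
    (f : ℝ → ℝ) (hf : ContDiff ℝ ∞ f)
    -- the curve of positive solitary waves
    (I : Set ℝ) (hI : I.OrdConnected) (hI_nontriv : I.Nontrivial) (hI_pos : I ⊆ Ioi 0)
    (ψ : ℝ → L2R) (hψ_curve : IsC1CurveInH (α + 1) I ψ)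
    (hψ_pos : ∀ c ∈ I, ∀ᵐ x : ℝ, 0 < ψ c x)
    (hψ_wave : ∀ c ∈ I, IsSolitaryWave β f c (ψ c))
    -- the linearized operator at the wave speed `c`
    (c : ℝ) (hc : c ∈ I)
    (hgap : 0 < c + b - deriv f 0)
    (hdom : ∀ u : L2C, u ∈ (linOp β f c (ψ c)).domain ↔ InH α u)
    (hker : ∃ dψ : L2C,
      (dψ : 𝓢'(ℝ, ℂ)) = ∂_{(1 : ℝ)} (complexify (ψ c) : 𝓢'(ℝ, ℂ)) ∧
      eigenspaceOf (linOp β f c (ψ c)) 0 = Submodule.span ℂ {dψ})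
    (hcond :
      (Even (negIndex (linOp β f c (ψ c))) ∧
        0 < derivWithin (fun c' => inner ℝ (ψ c') (ψ c')) I c) ∨
      (Odd (negIndex (linOp β f c (ψ c))) ∧
        derivWithin (fun c' => inner ℝ (ψ c') (ψ c')) I c < 0)) :
    ∃ l : ℝ, 0 < l ∧ ∃ w : L2R, w ≠ 0 ∧ (∀ s : ℝ, 0 ≤ s → InH s (complexify w)) ∧
      SolvesLinearized β f c (ψ c) (fun t => Real.exp (l * t) • complexify w) := by
  set q : ℝ → ℝ := wavePotential f (ψ c) with hqd
  set s : ℝ → ℝ := waveSymbol β f c with hsd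
  have hδ := hgap
  have hs : ∀ ξ, c + b - deriv f 0 ≤ s ξ := fun ξ => by
    have := hb (2 * Real.pi * ξ)
    simp only [hsd, waveSymbol]
    linarith
  have hsc : Continuous s := waveSymbol_continuous hβ_cont
  have hse : ∀ ξ, s (-ξ) = s ξ := waveSymbol_neg hβ_even
  obtain ⟨dψ, hdψ, hdker⟩ := hker
  have hwd : HasWeakDeriv (complexify (ψ c)) dψ := (hasWeakDeriv_iff _ _).mpr hdψ
  have hψ1 : MemH (0 + 1) (complexify (ψ c)) := ⟨dψ, hasWeakDerivFun_coe.mpr hwd, Lp.memLp dψ⟩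
  have hq1 : MemH (0 + 1) (fun x => (q x : ℂ)) := memH_wavePotential hf hψ1
  have hq : MemLp (fun x => (q x : ℂ)) ∞ volume := hq1.memLp_top
  obtain ⟨q₀, hq₀c, hq₀, hqq⟩ := hq1.choose_spec.1.exists_continuous
  obtain ⟨C, hC⟩ := exists_japanese_le_waveSymbol hβ_cont hδ hs hq hdom
  have hlim : Tendsto (fun ξ => (s ξ)⁻¹) (cocompact ℝ) (𝓝 0) := tendsto_inv_waveSymbol hα₀ hδ hs hC
  have hR : MemLp (fun ξ => (((s ξ)⁻¹ : ℝ) : ℂ)) ∞ volume :=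
    memLp_top_inv_waveSymbol hβ_cont hδ hs
  have hE := mem_eigenspaceOf_linOp hβ_cont hδ hs hq
  have hE0 : ∀ u, u ∈ Submodule.span ℂ {dψ} ↔
      u = fmul (fun ξ => (((s ξ)⁻¹ : ℝ) : ℂ)) (bmul (fun x => (q x : ℂ)) u) := fun u => by
    rw [← hdker, hE, Complex.ofReal_zero, zero_smul, add_zero]
  -- Conjugation commutes with weak differentiation and fixes ψ, so uniqueness of weak derivatives
  -- makes dψ real and the kernel usable in the real Hilbert space.
  have hdreal : conjL dψ = dψ := by
    have h := hwd.conjL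
    rw [conjL_complexify] at h
    exact h.unique hwd
  have hdc : complexify (reL dψ) = dψ := complexify_reL hdreal
  have hd0 : reL dψ ≠ 0 := fun h => by
    rw [h, complexify_zero] at hdc
    exact hwd.ne_zero (complexify_ne_zero_of_pos (hψ_pos c hc)) hdc.symm
  have hdfix := (hE0 dψ).mp (Submodule.mem_span_singleton_self dψ)
  obtain ⟨ψ', hψ', hψ'eq⟩ := exists_deriv_wave hα₀ hβ_cont hf hI hI_nontriv hψ_curve hψ_wave hc hδ
    hs hq
  have hP := conjL_birmanSchwinger hsc hδ hs hse hq
  obtain ⟨m, v, μ, hv, hQ⟩ := IsCompactOperator.exists_eigenfamily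
    (realOp_isCompact (birmanSchwinger_isCompact hsc hδ hs hlim (hq.ae_eq hqq) hq₀ hqq))
    (realOp_isSymmetric hP (inner_birmanSchwinger hsc hδ hs hq))
  have hn : negIndex (linOp β f c (ψ c)) = (Finset.univ.filter fun i => 1 < μ i).card :=
    finrank_iSup_eq_card_filter hsc hδ hs hse hlim (hq.ae_eq hqq) hq₀ hqq hE hv hQ
  have hderiv : derivWithin (fun c' => inner ℝ (ψ c') (ψ c')) I c = 2 * inner ℝ (ψ c) ψ' := by
    rw [(hψ'.inner ℝ hψ').derivWithin (uniqueDiffWithinAt_of_ordConnected hI hI_nontriv hc),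
      real_inner_comm (ψ c) ψ', two_mul]
  have hsign : 0 < (-1 : ℝ) ^ (Finset.univ.filter fun i => 1 < μ i).card * inner ℝ (ψ c) ψ' := by
    rw [← hn]
    rw [hderiv] at hcond
    rcases hcond with ⟨h1, h2⟩ | ⟨h1, h2⟩
    · rw [h1.neg_one_pow]; linarith
    · rw [h1.neg_one_pow]; linarith
  obtain ⟨l, hl, w, hw0, hw⟩ := exists_growing_mode hsc hδ hs hse hlim (hq.ae_eq hqq) hq₀ hqq
    (d := reL dψ) (by rwa [hdc]) hd0 (by rwa [hdc])
    (fun u hu => by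
      obtain ⟨a, ha⟩ := Submodule.mem_span_singleton.mp ((hE0 u).mpr hu)
      exact ⟨a, by rw [hdc, ha]⟩) hψ'eq hv hQ hsign
  refine ⟨l, hl, w, hw0, fun r _ => ?_, solvesLinearized_of_fixed hβ_cont hδ hs hq hl hw⟩
  have hp : Continuous fun ξ => 2 * Real.pi * ξ * s ξ := by fun_prop
  -- The growth factor has modulus at most 1, so the decay of the full symbol comes from 1/s.
  have hm0 : Tendsto (fun ξ => growthSymbol (fun ξ => 2 * Real.pi * ξ * s ξ) l ξ *
      (((s ξ)⁻¹ : ℝ) : ℂ)) (cocompact ℝ) (𝓝 0) := by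
    refine squeeze_zero_norm (fun ξ => ?_) (tendsto_zero_iff_norm_tendsto_zero.mp
      (tendsto_ofReal_inv hlim))
    rw [norm_mul]
    exact mul_le_of_le_one_left (norm_nonneg _) (norm_growthSymbol_le l ξ)
  obtain ⟨k, hk⟩ := exists_nat_ge r
  refine inH_of_memH (k := k + 1) (memH_of_fixed hq (memLp_top_mul (memLp_growthSymbol hp hl) hR) hm0
    (fun g hg => ?_) hw) (by push_cast; linarith)
  exact (memH_wavePotential hf
    (memH_of_hasWeakDeriv_fixed hf hR (tendsto_ofReal_inv hlim) hwd hdfix k)).mul hg
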